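/- **Setting.** All systems are finite-dimensional. $H(\cdot)$ is von Neumann entropy (natural logarithm), $H(K|L)=H(KL)-H(L)$, $I(K{:}L|M)=H(K|M)+H(L|M)-H(KL|M)$. $\tau(\mathscr H,T)=e^{-\mathscr H/k_BT}/\mathrm{Tr}\,e^{-\mathscr H/k_BT}$. A *quantum error-correcting engine* consists of a reference $R$ (zero Hamiltonian), a system $S$, an ancilla $A$ with energy basis $|\varepsilon_x\rangle$, a hot bath $B_h$ and a cold bath $B_c$ (temperatures $T_h,T_c>0$), a measurement apparatus $M$ (temperature $T_m>0$), and classical registers $X,Y$ with initial pointer states $|0\rangle$; $Y$ has a Hamiltonian $\mathscr H^Y$ of which $|0\rangle^Y$ is a ground state. Put $E=RSAB_hB_c$. The cycle is: 1. Initially $\sigma_i=\psi^{RS}\otimes\tau_c^A\otimes\tau_h^{B_h}\otimes\tau_c^{B_c}\otimes|0\rangle\langle0|^X\otimes|0\rangle\langle0|^Y$ with $\psi^{RS}$ pure. 2. $A$ is measured in its energy basis and the outcome $x$, with Gibbs probability $p(x)$, is recorded in $X$ ($\sigma_0$); a unitary $U_{\mathrm{enc},x}$ acts on $SA$ ($\sigma_{\mathrm{enc}}$).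 3. A unitary on $SAB_h$ commuting with $\mathscr H^S+\mathscr H^A+\mathscr H^{B_h}$ acts ($\sigma_1$; given $x$, the state of $E$ is $\sigma_{1,x}^E$). 4. A quantum instrument $\{\mathcal N_{y|x}\}_y$ (completely positive trace-non-increasing maps with trace-preserving sum) acts on $SA$ and $y$ is recorded in $Y$ ($\sigma_2$). It is realized by a unitary on $SAYM$, with $M$ initially in $\tau(\mathscr H^M,T_m)$ and $Y$ in $|0\rangle$, such that tracing out $M$ gives $\mathcal N_{|x}(\cdot)=\sum_y\mathcal N_{y|x}(\cdot)\otimes|y\rangle\langle y|^Y$. 5. A unitary $U_{\mathrm{dec},xy}$ acts on $SA$ ($\sigma_3$). 6. A unitary on $AB_c$ commuting with $\mathscr H^A+\mathscr H^{B_c}$ and mapping $\omega\otimes\tau_c^{B_c}$, for every state $\omega$ of $A$, to a product $\tau_c^A\otimes\xi$ acts ($\sigma_f$). 7. $X$ and $Y$ are reset to $|0\rangle$ ($\sigma_{\mathrm{erase}}$). Let $\mathscr U$ be the expectation of $\mathscr H^S+\mathscr H^A+\mathscr H^Y$, and $\Delta\mathscr U=\mathscr U_{\mathrm{erase}}-\mathscr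 U_i$. Let $Q_h,Q_c,Q_{\mathrm{meas}},Q^Y_{\mathrm{erase}}$ be the decreases of $\langle\mathscr H^{B_h}\rangle$, $\langle\mathscr H^{B_c}\rangle$ (from $\sigma_i$ to $\sigma_f$), of $\langle\mathscr H^M\rangle$ (over step 4) and of $\langle\mathscr H^Y\rangle$ (from $\sigma_i$ to $\sigma_f$). Over step 4 put $$Q^Y_{\mathrm{meas}}=k_BT_m\big[\Delta H(Y|X)-I(Y{:}M|X)_{\sigma_2}\big],\qquad Q^{RSA|Y}_{\mathrm{meas}}=k_BT_m\big[\Delta H(RSA|XY)-I(RSA{:}M|XY)_{\sigma_2}\big].$$ The work is $W_{\mathrm{tot}}=(\mathscr U_{\mathrm{enc}}-\mathscr U_0)+(\mathscr U_2-\mathscr U_1-Q_{\mathrm{meas}})+(\mathscr U_3-\mathscr U_2)$, the input heat is $Q_{\mathrm{input}}=Q_h+Q^Y_{\mathrm{meas}}$, the efficiency is $\eta=-W_{\mathrm{tot}}/Q_{\mathrm{input}}$, and $\eta_C=1-T_c/T_h$. The entanglement fidelity is $F_e=\langle\psi|\sigma_f^{RS}|\psi\rangle$. The efficacy of a map $\mathcal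 N$ with respect to a state $\rho$ is $\mathscr E(\mathcal N;\rho)=\mathrm{Tr}[\mathcal N^\dagger\circ\mathcal N(\rho)]$; $\mathcal N_{|x}$ acts on $E$ as the identity outside $SA$. **Assumptions**, with real tolerances $\delta_1,\delta_2,\delta_3$ making "$\ll$" and "$\approx$" quantitative: $Q^{RSA|Y}_{\mathrm{meas}}\le0$ and 1. $Q_{\mathrm{input}}>0$ and $|\Delta\mathscr U|\le\delta_1Q_{\mathrm{input}}$; 2. $H(X|E)_{\sigma_f}\le\delta_2H(Y|EX)_{\sigma_f}$; 3. $\big||Q^Y_{\mathrm{erase}}|-k_BT_cH(Y|X)_{\sigma_2}\big|\le\delta_3\,k_BT_cH(Y|X)_{\sigma_2}$; 4. $|Q^{RSA|Y}_{\mathrm{meas}}|\ge\frac{T_c}{T_h}Q^Y_{\mathrm{meas}}$. **Statement.** If these assumptions hold and $F_e=1$, then $$\frac{Q_{\mathrm{input}}}{k_BT_h}\Big(\frac{\eta-\eta_C}{1-\eta_C}\Big)+\sum_xp(x)\big[-\ln\mathscr E(\mathcal N_{|x};\sigma^E_{1,x})\big]\le\delta_2H(Y|EX)_{\sigma_f}+\delta_3H(Y|X)_{\sigma_2}.$$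 In particular, in the idealized regime $\delta_2=\delta_3=0$ the left-hand side is $\le0$, and moreover: if every $\mathcal N_{|x}$ is subunital ($\mathcal N_{|x}(I)\le I$), then $\eta\le\eta_C$; if all instruments are efficient ($\mathcal N_{y|x}(\cdot)=K_{xy}(\cdot)K_{xy}^\dagger$), then every $\mathcal N_{|x}$ is subunital and so $\eta\le\eta_C$; and if $\eta>\eta_C$, then for some $x$ the map $\mathcal N_{|x}$ has efficacy $\mathscr E(\mathcal N_{|x};\sigma^E_{1,x})>1$ and is not subunital. -/

import Mathlib

set_option synthInstance.maxSize 2000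

namespace QEC

open Matrix
open scoped Kronecker ComplexOrder

noncomputable section

/-! ### Finite-dimensional quantum systems

A system with a chosen orthonormal basis labelled by a finite type `n` has operators
`Matrix n n ℂ`; the composite of `k` and `l` is labelled by `k × l`. An equivalence
`n ≃ k × l` exhibits `k` as a subsystem of `n`. -/

section Generic

variable {n n' k k' l m : Type*}
  [Fintype n] [DecidableEq n] [Fintype n'] [DecidableEq n']
  [Fintype k] [DecidableEq k] [Fintype k'] [DecidableEq k']
  [Fintype l] [DecidableEq l] [Fintype m] [DecidableEq m]

/-- The operator `U ⊗ 1` on the total system `n` given by an operator `U` on the subsystem `k`. -/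
def embed (e : n ≃ k × l) (U : Matrix k k ℂ) : Matrix n n ℂ :=
  (U ⊗ₖ (1 : Matrix l l ℂ)).submatrix e e

/-- The reduced state on the subsystem `k` (partial trace over `l`). -/
def marginal (e : n ≃ k × l) (ρ : Matrix n n ℂ) : Matrix k k ℂ :=
  Matrix.of fun i j => ∑ t : l, ρ (e.symm (i, t)) (e.symm (j, t))

/-- The map `N ⊗ id` on the total system, for `N` acting on the subsystem `k` only. -/
def applyLocal (e : n ≃ k × l) (e' : n' ≃ k' × l)
    (N : Matrix k k ℂ →ₗ[ℂ] Matrix k' k' ℂ) : Matrix n n ℂ →ₗ[ℂ] Matrix n' n' ℂ where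
  toFun ρ := Matrix.of fun i j =>
    N (Matrix.of fun a b => ρ (e.symm (a, (e' i).2)) (e.symm (b, (e' j).2))) (e' i).1 (e' j).1
  map_add' ρ σ := by
    ext i j
    have h : (Matrix.of fun a b =>
          (ρ + σ) (e.symm (a, (e' i).2)) (e.symm (b, (e' j).2)) : Matrix k k ℂ)
        = (Matrix.of fun a b => ρ (e.symm (a, (e' i).2)) (e.symm (b, (e' j).2)))
          + (Matrix.of fun a b => σ (e.symm (a, (e' i).2)) (e.symm (b, (e' j).2))) := by
      ext a b; simp
    simp only [Matrix.of_apply, Matrix.add_apply] at h ⊢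
    rw [h, map_add, Matrix.add_apply]
  map_smul' c ρ := by
    ext i j
    have h : (Matrix.of fun a b =>
          (c • ρ) (e.symm (a, (e' i).2)) (e.symm (b, (e' j).2)) : Matrix k k ℂ)
        = c • (Matrix.of fun a b => ρ (e.symm (a, (e' i).2)) (e.symm (b, (e' j).2))) := by
      ext a b; simp
    simp only [Matrix.of_apply, Matrix.smul_apply, RingHom.id_apply] at h ⊢
    rw [h, map_smul, Matrix.smul_apply]

/-- Conjugation `U ρ U†`. -/
def conj (U ρ : Matrix n n ℂ) : Matrix n n ℂ := U * ρ * Uᴴ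

/-- The pointer projector `|x⟩⟨x|`. -/
def proj (x : n) : Matrix n n ℂ := Matrix.single x x 1

/-- The expectation value `Tr[ρ O]`. -/
def expect (ρ O : Matrix n n ℂ) : ℝ := (ρ * O).trace.re

/-- The Gibbs state `exp(-β H) / Tr exp(-β H)`. -/
def gibbs (β : ℝ) (H : Matrix n n ℂ) : Matrix n n ℂ :=
  ((NormedSpace.exp ((-β : ℂ) • H)).trace)⁻¹ • NormedSpace.exp ((-β : ℂ) • H)

/-- The von Neumann entropy `-Tr[ρ ln ρ]`. -/
def entropy (ρ : Matrix n n ℂ) : ℝ := -((ρ * cfc Real.log ρ).trace.re)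

/-- The conditional entropy `H(K|L) = H(KL) - H(L)` of a state of `KL`. -/
def condEntropy (ρ : Matrix (k × l) (k × l) ℂ) : ℝ :=
  entropy ρ - entropy (marginal (Equiv.prodComm k l) ρ)

/-- The conditional mutual information `I(K:L|M) = H(K|M) + H(L|M) - H(KL|M)` of a state of
`KLM`. -/
def condMutualInfo (ρ : Matrix (k × l × m) (k × l × m) ℂ) : ℝ :=
  condEntropy (marginal
      (⟨fun i => ((i.1, i.2.2), i.2.1), fun i => (i.1.1, i.2, i.1.2), fun _ => rfl, fun _ => rfl⟩ :
        k × l × m ≃ (k × m) × l) ρ)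
    + condEntropy (marginal (Equiv.prodComm k (l × m)) ρ)
    - condEntropy (ρ.submatrix (Equiv.prodAssoc k l m) (Equiv.prodAssoc k l m))

/-- Complete positivity. -/
def IsCP (N : Matrix k k ℂ →ₗ[ℂ] Matrix k' k' ℂ) : Prop :=
  ∀ (r : ℕ) (ρ : Matrix (k × Fin r) (k × Fin r) ℂ), ρ.PosSemidef →
    (applyLocal (Equiv.refl _) (Equiv.refl _) N ρ).PosSemidef

/-- A linear map is subunital if `N(1) ≤ 1`. -/
def IsSubunital (N : Matrix k k ℂ →ₗ[ℂ] Matrix k' k' ℂ) : Prop :=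
  (1 - N 1).PosSemidef

/-- The adjoint map, determined by `Tr[B N(C)] = Tr[N†(B) C]` (see `trace_adjointMap_mul`). -/
def adjointMap (N : Matrix k k ℂ →ₗ[ℂ] Matrix k' k' ℂ) (B : Matrix k' k' ℂ) : Matrix k k ℂ :=
  Matrix.of fun i j => (B * N (Matrix.single j i 1)).trace

set_option linter.unusedSectionVars false in
theorem trace_adjointMap_mul (N : Matrix k k ℂ →ₗ[ℂ] Matrix k' k' ℂ) (B : Matrix k' k' ℂ)
    (C : Matrix k k ℂ) : (adjointMap N B * C).trace = (B * N C).trace := by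
  have hC : N C = ∑ i, ∑ j, C i j • N (Matrix.single i j 1) := by
    conv_lhs => rw [Matrix.matrix_eq_sum_single C]
    rw [map_sum]
    refine Finset.sum_congr rfl fun i _ => ?_
    rw [map_sum]
    refine Finset.sum_congr rfl fun j _ => ?_
    rw [← map_smul, Matrix.smul_single, smul_eq_mul, mul_one]
  rw [hC]
  simp only [Finset.mul_sum, Matrix.trace_sum, Matrix.mul_smul, Matrix.trace_smul, smul_eq_mul]
  rw [Finset.sum_comm]
  simp only [adjointMap, Matrix.trace, Matrix.diag_apply, Matrix.mul_apply, Matrix.of_apply]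
  exact Finset.sum_congr rfl fun i _ => Finset.sum_congr rfl fun j _ => mul_comm _ _

/-- The efficacy `Tr[N†(N(ρ))]` of a map with respect to a state. -/
def efficacy (N : Matrix k k ℂ →ₗ[ℂ] Matrix k' k' ℂ) (ρ : Matrix k k ℂ) : ℝ :=
  (adjointMap N (N ρ)).trace.re

/-- The map `N(ρ) = ∑ y, N_y(ρ) ⊗ |y⟩⟨y|` writing the outcome of an instrument in a register. -/
def recordMap (N : l → Matrix k k ℂ →ₗ[ℂ] Matrix k k ℂ) :
    Matrix k k ℂ →ₗ[ℂ] Matrix (k × l) (k × l) ℂ where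
  toFun ρ := ∑ y, N y ρ ⊗ₖ proj y
  map_add' ρ σ := by
    simp only [map_add, Matrix.add_kronecker, Finset.sum_add_distrib]
  map_smul' c ρ := by
    simp only [map_smul, Matrix.smul_kronecker, Finset.smul_sum, RingHom.id_apply]

/-- A quantum instrument: completely positive trace-non-increasing maps whose sum is trace
preserving. -/
structure IsInstrument (N : l → Matrix k k ℂ →ₗ[ℂ] Matrix k k ℂ) : Prop where
  cp : ∀ y, IsCP (N y)
  trace_le : ∀ y (ρ : Matrix k k ℂ), ρ.PosSemidef → (N y ρ).trace.re ≤ ρ.trace.re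
  trace_sum : ∀ ρ : Matrix k k ℂ, (∑ y, N y ρ).trace = ρ.trace

/-- An efficient instrument: every outcome has a single Kraus operator. -/
def IsEfficient (N : l → Matrix k k ℂ →ₗ[ℂ] Matrix k k ℂ) : Prop :=
  ∀ y, ∃ K : Matrix k k ℂ, ∀ ρ, N y ρ = K * ρ * Kᴴ

end Generic

/-! ### The engine

`R` reference, `S` system, `A` ancilla, `H` hot bath, `C` cold bath, `M` measurement apparatus,
`Y` syndrome register. The basis of `A` is its energy basis; the outcomes of the initial energy
measurement, hence also the pointer states of the register `X`, are labelled by `A` as well.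
Possible syndrome outcomes depending on `x` are covered by letting some maps `inst x y` vanish. -/

/-- Labels of the basis of the composite `E = RSAB_hB_c`. -/
abbrev EIdx (R S A H C : Type*) := R × S × A × H × C

/-- A quantum error-correcting engine with feedback control. -/
structure Engine (R S A H C M Y : Type*)
    [Fintype R] [DecidableEq R] [Fintype S] [DecidableEq S] [Fintype A] [DecidableEq A]
    [Fintype H] [DecidableEq H] [Fintype C] [DecidableEq C] [Fintype M] [DecidableEq M]
    [Fintype Y] [DecidableEq Y] where
  /-- Boltzmann's constant and the temperatures of the hot bath, cold bath and apparatus. -/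
  kB : ℝ
  Th : ℝ
  Tc : ℝ
  Tm : ℝ
  kB_pos : 0 < kB
  Th_pos : 0 < Th
  Tc_pos : 0 < Tc
  Tm_pos : 0 < Tm
  /-- The initial pure state of `RS`, a purification of the initial state of `S`. -/
  psi : R × S → ℂ
  psi_unit : star psi ⬝ᵥ psi = 1
  /-- The local Hamiltonians; that of `R` is zero. -/
  hamS : Matrix S S ℂ
  hamS_herm : hamS.IsHermitian
  energyA : A → ℝ
  hamH : Matrix H H ℂ
  hamH_herm : hamH.IsHermitian
  hamC : Matrix C C ℂ
  hamC_herm : hamC.IsHermitian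
  hamM : Matrix M M ℂ
  hamM_herm : hamM.IsHermitian
  hamY : Matrix Y Y ℂ
  hamY_herm : hamY.IsHermitian
  /-- The initial pointer states of the registers `X` and `Y`; the latter is a ground state. -/
  x₀ : A
  y₀ : Y
  y₀_ground : ∃ ε : ℝ, hamY *ᵥ Pi.single y₀ 1 = (ε : ℂ) • Pi.single y₀ 1 ∧
    (hamY - (ε : ℂ) • (1 : Matrix Y Y ℂ)).PosSemidef
  /-- The encoding unitaries. -/
  Uenc : A → Matrix (S × A) (S × A) ℂ
  Uenc_unitary : ∀ x, Uenc x ∈ Matrix.unitaryGroup (S × A) ℂ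
  /-- The interaction with the hot bath: it commutes with the total Hamiltonian. -/
  Uh : Matrix ((S × A) × H) ((S × A) × H) ℂ
  Uh_unitary : Uh ∈ Matrix.unitaryGroup ((S × A) × H) ℂ
  Uh_comm : Commute Uh
    ((hamS ⊗ₖ (1 : Matrix A A ℂ)
        + (1 : Matrix S S ℂ) ⊗ₖ Matrix.diagonal fun a => (energyA a : ℂ)) ⊗ₖ (1 : Matrix H H ℂ)
      + (1 : Matrix (S × A) (S × A) ℂ) ⊗ₖ hamH)
  /-- The error-syndrome instruments. -/
  inst : A → Y → Matrix (S × A) (S × A) ℂ →ₗ[ℂ] Matrix (S × A) (S × A) ℂ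
  inst_isInstrument : ∀ x, IsInstrument (inst x)
  /-- Their physical realization: a unitary interaction of `SA`, the register `Y` in its initial
  pointer state, and the apparatus `M` in a thermal state. -/
  Umeas : A → Matrix ((S × A) × Y × M) ((S × A) × Y × M) ℂ
  Umeas_unitary : ∀ x, Umeas x ∈ Matrix.unitaryGroup ((S × A) × Y × M) ℂ
  Umeas_realizes : ∀ x (ρ : Matrix (S × A) (S × A) ℂ),
    marginal (Equiv.prodAssoc (S × A) Y M).symm
      (conj (Umeas x) (ρ ⊗ₖ (proj y₀ ⊗ₖ gibbs (1 / (kB * Tm)) hamM)))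
      = recordMap (inst x) ρ
  /-- The decoding (feedback) unitaries. -/
  Udec : A → Y → Matrix (S × A) (S × A) ℂ
  Udec_unitary : ∀ x y, Udec x y ∈ Matrix.unitaryGroup (S × A) ℂ
  /-- The interaction of `A` with the cold bath: it commutes with the total Hamiltonian. -/
  Uc : Matrix (A × C) (A × C) ℂ
  Uc_unitary : Uc ∈ Matrix.unitaryGroup (A × C) ℂ
  Uc_comm : Commute Uc
    ((Matrix.diagonal fun a => (energyA a : ℂ)) ⊗ₖ (1 : Matrix C C ℂ)
      + (1 : Matrix A A ℂ) ⊗ₖ hamC)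
  /-- It replaces any state of `A` by a fresh, uncorrelated copy of the thermal state (as a SWAP
  with a copy of `A` contained in the cold bath does). -/
  Uc_resets : ∀ ω : Matrix A A ℂ, ω.PosSemidef → ω.trace = 1 → ∃ ξ : Matrix C C ℂ,
    conj Uc (ω ⊗ₖ gibbs (1 / (kB * Tc)) hamC)
      = gibbs (1 / (kB * Tc)) (Matrix.diagonal fun a => (energyA a : ℂ)) ⊗ₖ ξ

namespace Engine

variable {R S A H C M Y : Type*}
    [Fintype R] [DecidableEq R] [Fintype S] [DecidableEq S] [Fintype A] [DecidableEq A]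
    [Fintype H] [DecidableEq H] [Fintype C] [DecidableEq C] [Fintype M] [DecidableEq M]
    [Fintype Y] [DecidableEq Y]

/-! #### Subsystems -/

/-- `A` inside `E`. -/
def eA : EIdx R S A H C ≃ A × (R × S × H × C) :=
  ⟨fun i => (i.2.2.1, i.1, i.2.1, i.2.2.2.1, i.2.2.2.2),
   fun j => (j.2.1, j.2.2.1, j.1, j.2.2.2.1, j.2.2.2.2), fun _ => rfl, fun _ => rfl⟩

/-- `SA` inside `E`. -/
def eSA : EIdx R S A H C ≃ (S × A) × (R × H × C) :=
  ⟨fun i => ((i.2.1, i.2.2.1), i.1, i.2.2.2.1, i.2.2.2.2),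
   fun j => (j.2.1, j.1.1, j.1.2, j.2.2.1, j.2.2.2), fun _ => rfl, fun _ => rfl⟩

/-- `SAB_h` inside `E`. -/
def eSAH : EIdx R S A H C ≃ ((S × A) × H) × (R × C) :=
  ⟨fun i => (((i.2.1, i.2.2.1), i.2.2.2.1), i.1, i.2.2.2.2),
   fun j => (j.2.1, j.1.1.1, j.1.1.2, j.1.2, j.2.2), fun _ => rfl, fun _ => rfl⟩

/-- `AB_c` inside `E`. -/
def eAC : EIdx R S A H C ≃ (A × C) × (R × S × H) :=
  ⟨fun i => ((i.2.2.1, i.2.2.2.2), i.1, i.2.1, i.2.2.2.1),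
   fun j => (j.2.1, j.2.2.1, j.1.1, j.2.2.2, j.1.2), fun _ => rfl, fun _ => rfl⟩

/-- `SAY` inside `EY`. -/
def eSAY : EIdx R S A H C × Y ≃ ((S × A) × Y) × (R × H × C) :=
  ⟨fun i => (((i.1.2.1, i.1.2.2.1), i.2), i.1.1, i.1.2.2.2.1, i.1.2.2.2.2),
   fun j => ((j.2.1, j.1.1.1, j.1.1.2, j.2.2.1, j.2.2.2), j.1.2), fun _ => rfl, fun _ => rfl⟩

/-- `SAYM` inside `EYM`. -/
def eSAYM : EIdx R S A H C × Y × M ≃ ((S × A) × Y × M) × (R × H × C) :=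
  ⟨fun i => (((i.1.2.1, i.1.2.2.1), i.2.1, i.2.2), i.1.1, i.1.2.2.2.1, i.1.2.2.2.2),
   fun j => ((j.2.1, j.1.1.1, j.1.1.2, j.2.2.1, j.2.2.2), j.1.2.1, j.1.2.2),
   fun _ => rfl, fun _ => rfl⟩

/-- `S` inside `EXY`. -/
def fS : EIdx R S A H C × A × Y ≃ S × (R × A × H × C × A × Y) :=
  ⟨fun i => (i.1.2.1, i.1.1, i.1.2.2.1, i.1.2.2.2.1, i.1.2.2.2.2, i.2.1, i.2.2),
   fun j => ((j.2.1, j.1, j.2.2.1, j.2.2.2.1, j.2.2.2.2.1), j.2.2.2.2.2.1, j.2.2.2.2.2.2),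
   fun _ => rfl, fun _ => rfl⟩

/-- `A` inside `EXY`. -/
def fA : EIdx R S A H C × A × Y ≃ A × (R × S × H × C × A × Y) :=
  ⟨fun i => (i.1.2.2.1, i.1.1, i.1.2.1, i.1.2.2.2.1, i.1.2.2.2.2, i.2.1, i.2.2),
   fun j => ((j.2.1, j.2.2.1, j.1, j.2.2.2.1, j.2.2.2.2.1), j.2.2.2.2.2.1, j.2.2.2.2.2.2),
   fun _ => rfl, fun _ => rfl⟩

/-- `B_h` inside `EXY`. -/
def fH : EIdx R S A H C × A × Y ≃ H × (R × S × A × C × A × Y) :=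
  ⟨fun i => (i.1.2.2.2.1, i.1.1, i.1.2.1, i.1.2.2.1, i.1.2.2.2.2, i.2.1, i.2.2),
   fun j => ((j.2.1, j.2.2.1, j.2.2.2.1, j.1, j.2.2.2.2.1), j.2.2.2.2.2.1, j.2.2.2.2.2.2),
   fun _ => rfl, fun _ => rfl⟩

/-- `B_c` inside `EXY`. -/
def fC : EIdx R S A H C × A × Y ≃ C × (R × S × A × H × A × Y) :=
  ⟨fun i => (i.1.2.2.2.2, i.1.1, i.1.2.1, i.1.2.2.1, i.1.2.2.2.1, i.2.1, i.2.2),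
   fun j => ((j.2.1, j.2.2.1, j.2.2.2.1, j.2.2.2.2.1, j.1), j.2.2.2.2.2.1, j.2.2.2.2.2.2),
   fun _ => rfl, fun _ => rfl⟩

/-- `Y` inside `EXY`. -/
def fY : EIdx R S A H C × A × Y ≃ Y × (EIdx R S A H C × A) :=
  ⟨fun i => (i.2.2, i.1, i.2.1), fun j => (j.2.1, j.2.2, j.1), fun _ => rfl, fun _ => rfl⟩

/-- `RS` inside `EXY`. -/
def fRS : EIdx R S A H C × A × Y ≃ (R × S) × (A × H × C × A × Y) :=
  ⟨fun i => ((i.1.1, i.1.2.1), i.1.2.2.1, i.1.2.2.2.1, i.1.2.2.2.2, i.2.1, i.2.2),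
   fun j => ((j.1.1, j.1.2, j.2.1, j.2.2.1, j.2.2.2.1), j.2.2.2.2.1, j.2.2.2.2.2),
   fun _ => rfl, fun _ => rfl⟩

/-- `YX` inside `EXY`. -/
def fYX : EIdx R S A H C × A × Y ≃ (Y × A) × EIdx R S A H C :=
  ⟨fun i => ((i.2.2, i.2.1), i.1), fun j => (j.2, j.1.2, j.1.1), fun _ => rfl, fun _ => rfl⟩

/-- `XE` inside `EXY`. -/
def fXE : EIdx R S A H C × A × Y ≃ (A × EIdx R S A H C) × Y :=
  ⟨fun i => ((i.2.1, i.1), i.2.2), fun j => (j.1.2, j.1.1, j.2), fun _ => rfl, fun _ => rfl⟩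

/-- `EXY` regrouped as `Y` and `EX`. -/
def fYEX : Y × (EIdx R S A H C × A) ≃ EIdx R S A H C × A × Y := fY.symm

/-- `(RSA)(XY)` inside `EXY`. -/
def fRSAXY : EIdx R S A H C × A × Y ≃ ((R × S × A) × (A × Y)) × (H × C) :=
  ⟨fun i => (((i.1.1, i.1.2.1, i.1.2.2.1), i.2.1, i.2.2), i.1.2.2.2.1, i.1.2.2.2.2),
   fun j => ((j.1.1.1, j.1.1.2.1, j.1.1.2.2, j.2.1, j.2.2), j.1.2.1, j.1.2.2),
   fun _ => rfl, fun _ => rfl⟩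

/-- `YMX` inside `XEYM`. -/
def gYMX : A × EIdx R S A H C × Y × M ≃ (Y × M × A) × EIdx R S A H C :=
  ⟨fun i => ((i.2.2.1, i.2.2.2, i.1), i.2.1), fun j => (j.1.2.2, j.2, j.1.1, j.1.2.1),
   fun _ => rfl, fun _ => rfl⟩

/-- `(RSA)M(XY)` inside `XEYM`. -/
def gRSAMXY : A × EIdx R S A H C × Y × M ≃ ((R × S × A) × M × (A × Y)) × (H × C) :=
  ⟨fun i => (((i.2.1.1, i.2.1.2.1, i.2.1.2.2.1), i.2.2.2, i.1, i.2.2.1),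
      i.2.1.2.2.2.1, i.2.1.2.2.2.2),
   fun j => (j.1.2.2.1, (j.1.1.1, j.1.1.2.1, j.1.1.2.2, j.2.1, j.2.2), j.1.2.2.2, j.1.2.1),
   fun _ => rfl, fun _ => rfl⟩

/-- `M` inside `XEYM`. -/
def gM : A × EIdx R S A H C × Y × M ≃ M × (A × EIdx R S A H C × Y) :=
  ⟨fun i => (i.2.2.2, i.1, i.2.1, i.2.2.1), fun j => (j.2.1, j.2.2.1, j.2.2.2, j.1),
   fun _ => rfl, fun _ => rfl⟩

variable (Q : Engine R S A H C M Y)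

/-! #### Initial states -/

/-- The Hamiltonian of the ancilla, diagonal in its energy basis. -/
def hamA : Matrix A A ℂ := Matrix.diagonal fun a => (Q.energyA a : ℂ)

def tauA : Matrix A A ℂ := gibbs (1 / (Q.kB * Q.Tc)) Q.hamA
def tauH : Matrix H H ℂ := gibbs (1 / (Q.kB * Q.Th)) Q.hamH
def tauC : Matrix C C ℂ := gibbs (1 / (Q.kB * Q.Tc)) Q.hamC
def tauM : Matrix M M ℂ := gibbs (1 / (Q.kB * Q.Tm)) Q.hamM

/-- The Gibbs distribution of the initial energy measurement. -/
def pX (x : A) : ℝ :=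
  Real.exp (-Q.energyA x / (Q.kB * Q.Tc)) / ∑ a, Real.exp (-Q.energyA a / (Q.kB * Q.Tc))

/-- `|ψ⟩⟨ψ|` on `RS`. -/
def psiState : Matrix (R × S) (R × S) ℂ := Matrix.vecMulVec Q.psi (star Q.psi)

/-- The initial state `ψ ⊗ τ_A ⊗ τ_h ⊗ τ_c` of `E`. -/
def rhoI : Matrix (EIdx R S A H C) (EIdx R S A H C) ℂ :=
  (Q.psiState ⊗ₖ (Q.tauA ⊗ₖ (Q.tauH ⊗ₖ Q.tauC))).submatrix
    (Equiv.prodAssoc R S (A × H × C)).symm (Equiv.prodAssoc R S (A × H × C)).symm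

/-! #### States of `E` conditioned on the outcomes -/

/-- After the initial measurement, given `x`. -/
def rho0 (x : A) : Matrix (EIdx R S A H C) (EIdx R S A H C) ℂ :=
  ((Q.pX x)⁻¹ : ℂ) • (embed eA (proj x) * Q.rhoI * embed eA (proj x))

/-- After encoding, given `x`. -/
def rhoEnc (x : A) : Matrix (EIdx R S A H C) (EIdx R S A H C) ℂ :=
  conj (embed eSA (Q.Uenc x)) (Q.rho0 x)

/-- After the thermal operation, given `x`. -/
def rho1 (x : A) : Matrix (EIdx R S A H C) (EIdx R S A H C) ℂ :=
  conj (embed eSAH Q.Uh) (Q.rhoEnc x)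

/-- After the syndrome measurement, given `x`: the state for outcome `y` times `p(y|x)`. -/
def rho2 (x : A) (y : Y) : Matrix (EIdx R S A H C) (EIdx R S A H C) ℂ :=
  applyLocal eSA eSA (Q.inst x y) (Q.rho1 x)

/-- After the feedback, given `x`: the state for outcome `y` times `p(y|x)`. -/
def rho3 (x : A) (y : Y) : Matrix (EIdx R S A H C) (EIdx R S A H C) ℂ :=
  conj (embed eSA (Q.Udec x y)) (Q.rho2 x y)

/-- After the reset of `A`, given `x`: the state for outcome `y` times `p(y|x)`. -/
def rhoF (x : A) (y : Y) : Matrix (EIdx R S A H C) (EIdx R S A H C) ℂ :=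
  conj (embed eAC Q.Uc) (Q.rho3 x y)

/-! #### Total states of `EXY` -/

/-- `∑ x y, p(x) ω_{xy} ⊗ |x⟩⟨x| ⊗ |y⟩⟨y|`. -/
def withXY (ω : A → Y → Matrix (EIdx R S A H C) (EIdx R S A H C) ℂ) :
    Matrix (EIdx R S A H C × A × Y) (EIdx R S A H C × A × Y) ℂ :=
  ∑ x, ∑ y, (Q.pX x : ℂ) • (ω x y ⊗ₖ (proj x ⊗ₖ proj y))

/-- `∑ x, p(x) ω_x ⊗ |x⟩⟨x| ⊗ |0⟩⟨0|`. -/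
def withX (ω : A → Matrix (EIdx R S A H C) (EIdx R S A H C) ℂ) :
    Matrix (EIdx R S A H C × A × Y) (EIdx R S A H C × A × Y) ℂ :=
  ∑ x, (Q.pX x : ℂ) • (ω x ⊗ₖ (proj x ⊗ₖ proj Q.y₀))

def sigmaI : Matrix (EIdx R S A H C × A × Y) (EIdx R S A H C × A × Y) ℂ :=
  Q.rhoI ⊗ₖ (proj Q.x₀ ⊗ₖ proj Q.y₀)
def sigma0 : Matrix (EIdx R S A H C × A × Y) (EIdx R S A H C × A × Y) ℂ := Q.withX Q.rho0
def sigmaEnc : Matrix (EIdx R S A H C × A × Y) (EIdx R S A H C × A × Y) ℂ := Q.withX Q.rhoEnc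
def sigma1 : Matrix (EIdx R S A H C × A × Y) (EIdx R S A H C × A × Y) ℂ := Q.withX Q.rho1
def sigma2 : Matrix (EIdx R S A H C × A × Y) (EIdx R S A H C × A × Y) ℂ := Q.withXY Q.rho2
def sigma3 : Matrix (EIdx R S A H C × A × Y) (EIdx R S A H C × A × Y) ℂ := Q.withXY Q.rho3
def sigmaF : Matrix (EIdx R S A H C × A × Y) (EIdx R S A H C × A × Y) ℂ := Q.withXY Q.rhoF

/-- After the erasure of both registers. -/
def sigmaErase : Matrix (EIdx R S A H C × A × Y) (EIdx R S A H C × A × Y) ℂ :=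
  marginal (Equiv.refl _) Q.sigmaF ⊗ₖ (proj Q.x₀ ⊗ₖ proj Q.y₀)

/-- The states of `XEYM` just before and just after the measurement interaction. -/
def sigma1M : Matrix (A × EIdx R S A H C × Y × M) (A × EIdx R S A H C × Y × M) ℂ :=
  ∑ x, (Q.pX x : ℂ) • (proj x ⊗ₖ (Q.rho1 x ⊗ₖ (proj Q.y₀ ⊗ₖ Q.tauM)))
def sigma2M : Matrix (A × EIdx R S A H C × Y × M) (A × EIdx R S A H C × Y × M) ℂ :=
  ∑ x, (Q.pX x : ℂ) •
    (proj x ⊗ₖ conj (embed eSAYM (Q.Umeas x)) (Q.rho1 x ⊗ₖ (proj Q.y₀ ⊗ₖ Q.tauM)))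

/-! #### Information-theoretic quantities -/

/-- `H(Y|X)`. -/
def HYX (σ : Matrix (EIdx R S A H C × A × Y) (EIdx R S A H C × A × Y) ℂ) : ℝ :=
  condEntropy (marginal fYX σ)

/-- `H(RSA|XY)`. -/
def HRSAXY (σ : Matrix (EIdx R S A H C × A × Y) (EIdx R S A H C × A × Y) ℂ) : ℝ :=
  condEntropy (marginal fRSAXY σ)

/-- `H(X|E)` in the final state. -/
def HXE : ℝ := condEntropy (marginal fXE Q.sigmaF)

/-- `H(Y|EX)` in the final state. -/
def HYEX : ℝ := condEntropy (Q.sigmaF.submatrix fYEX fYEX)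

/-- The entanglement fidelity `⟨ψ| σ_f^{RS} |ψ⟩`. -/
def fidelity : ℝ := (star Q.psi ⬝ᵥ (marginal fRS Q.sigmaF *ᵥ Q.psi)).re

/-- The map `N_{|x}` from `SA` to `SAY` given by the instrument used after outcome `x`. -/
def measMap (x : A) : Matrix (S × A) (S × A) ℂ →ₗ[ℂ] Matrix ((S × A) × Y) ((S × A) × Y) ℂ :=
  recordMap (Q.inst x)

/-- The efficacy of `N_{|x}` with respect to the pre-measurement state of `E` given `x`. -/
def efficacyX (x : A) : ℝ :=
  efficacy (applyLocal (eSA (R := R) (H := H) (C := C)) eSAY (Q.measMap x)) (Q.rho1 x)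

/-! #### Energy, heat, work and efficiency -/

/-- The Hamiltonian of `RSAY`. -/
def hamRSAY : Matrix (EIdx R S A H C × A × Y) (EIdx R S A H C × A × Y) ℂ :=
  embed fS Q.hamS + embed fA Q.hamA + embed fY Q.hamY

/-- The internal energy of `RSAY`. -/
def energy (σ : Matrix (EIdx R S A H C × A × Y) (EIdx R S A H C × A × Y) ℂ) : ℝ :=
  expect σ Q.hamRSAY

/-- The heats absorbed from the hot bath, the cold bath, and the apparatus, and the heat absorbed
when `Y` is erased: the decrease of the energy of the respective system. -/
def Qh : ℝ := expect Q.sigmaI (embed fH Q.hamH) - expect Q.sigmaF (embed fH Q.hamH)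
def Qc : ℝ := expect Q.sigmaI (embed fC Q.hamC) - expect Q.sigmaF (embed fC Q.hamC)
def Qmeas : ℝ := expect Q.sigma1M (embed gM Q.hamM) - expect Q.sigma2M (embed gM Q.hamM)
def QeraseY : ℝ := expect Q.sigmaI (embed fY Q.hamY) - expect Q.sigmaF (embed fY Q.hamY)

/-- The part `k T_m (ΔH(Y|X) - I(Y:M|X))` of the measurement heat absorbed by `Y`. -/
def QmeasY : ℝ :=
  Q.kB * Q.Tm * (HYX Q.sigma2 - HYX Q.sigma1 - condMutualInfo (marginal gYMX Q.sigma2M))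

/-- The part `k T_m (ΔH(RSA|XY) - I(RSA:M|XY))` of the measurement heat absorbed by `RSA`. -/
def QmeasRSA : ℝ :=
  Q.kB * Q.Tm *
    (HRSAXY Q.sigma2 - HRSAXY Q.sigma1 - condMutualInfo (marginal gRSAMXY Q.sigma2M))

/-- The work done in the encoding, measurement and decoding stages. -/
def Wenc : ℝ := Q.energy Q.sigmaEnc - Q.energy Q.sigma0
def Wmeas : ℝ := Q.energy Q.sigma2 - Q.energy Q.sigma1 - Q.Qmeas
def Wdec : ℝ := Q.energy Q.sigma3 - Q.energy Q.sigma2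
def Wtot : ℝ := Q.Wenc + Q.Wmeas + Q.Wdec

/-- The change of the internal energy of `RSAY` over a cycle. -/
def deltaU : ℝ := Q.energy Q.sigmaErase - Q.energy Q.sigmaI

/-- The input heat. -/
def Qinput : ℝ := Q.Qh + Q.QmeasY

/-- The thermodynamic efficiency. -/
def eta : ℝ := -Q.Wtot / Q.Qinput

/-- The Carnot efficiency. -/
def etaC : ℝ := 1 - Q.Tc / Q.Th

/-- The physical operating regime of the engine. The relations `a ≪ b` and `a ≈ b` are
quantified as `a ≤ δ b` and `|a - b| ≤ δ b` with relative tolerances `δ`; the idealized regime is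
`δ = 0`. -/
structure Regime (δ₁ δ₂ δ₃ : ℝ) : Prop where
  /-- The measurement does not heat the measured system. -/
  meas_nonpos : Q.QmeasRSA ≤ 0
  /-- There is input heat, and the internal energy change is negligible against it. -/
  input_pos : 0 < Q.Qinput
  deltaU_small : |Q.deltaU| ≤ δ₁ * Q.Qinput
  /-- The entropy of `X` is negligible against that of `Y` before erasure. -/
  memory_small : Q.HXE ≤ δ₂ * Q.HYEX
  /-- Landauer's bound is reached in the erasure of `Y`. -/
  landauer : |(|Q.QeraseY| - Q.kB * Q.Tc * HYX Q.sigma2)| ≤ δ₃ * (Q.kB * Q.Tc * HYX Q.sigma2)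
  /-- The measurement dissipates enough heat into the apparatus. -/
  dissipation : Q.Tc / Q.Th * Q.QmeasY ≤ |Q.QmeasRSA|

end Engine

end

end QEC

/-! The theorem is a second-law balance over one cycle in which the usual lower bound on the entropy
produced by the measurement is sharpened to minus the logarithm of its efficacy.

The key estimate is `neg_log_efficacy_le`. A positive trace-preserving map, written in the
eigenbases of a state and of its image, is a stochastic matrix. Gibbs' inequality between two joint
distributions, one of them normalized by the efficacy, then bounds the entropy gain below by
-ln(efficacy). Given x, the state of E before the measurement is a unitary image of pure states and
thermal baths, so its entropy is that of the two baths. After the measurement every step up to σ_f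
is unitary given x and y, so the entropy gained is still present in the final state of EXY.

At the end of the cycle, unit fidelity forces RS to be the pure state ψ, and the cold reset makes A
thermal. Subadditivity therefore bounds H(E) by the Shannon entropy of p plus the entropies of the
baths. The Gibbs variational principle bounds Q_h/k_BT_h and Q_c/k_BT_c by the entropy decreases of
the baths. Together these give `heat_add_efficacy_le`, whose right-hand side is H(X|E) + H(Y|EX) =
H(EXY) - H(E): the Shannon entropy of p enters once through the register X and once through the
fresh thermal state of A, and cancels.

The first law, `neg_Wtot`, expresses the extracted work as Q_h + Q_c + Q_meas + Q_erase^Y, since S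
and A return to their initial local states. The measurement heat is controlled by `Qmeas_le`, again
the variational principle, because Q_meas^Y and Q_meas^{RSA|Y} add up to k_BT_m times the entropy
decrease of the apparatus. In `tradeoff`, Landauer's condition pays for H(Y|X), which dominates
H(Y|EX) (`HYEX_le`), and the dissipation condition pays for Q_meas^Y/k_BT_h.

The consequences follow because a subunital map has efficacy at most 1
(`efficacy_applyLocal_le_one`), and a recorded efficient instrument is subunital
(`isSubunital_recordMap_of_isEfficient`). -/

namespace QEC

open Matrix
open scoped Kronecker ComplexOrder

noncomputable section

section Entropy

set_option linter.unusedSectionVars false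

variable {n m k l : Type*} [Fintype n] [DecidableEq n] [Fintype m] [DecidableEq m]
  [Fintype k] [DecidableEq k] [Fintype l] [DecidableEq l]

/-! ### Diagonalization and entropy -/

/-- `ρ = U diag(d) U†` with `U` unitary and `d` real. -/
structure Diagonalizes (U : Matrix n n ℂ) (d : n → ℝ) (ρ : Matrix n n ℂ) : Prop where
  left : Uᴴ * U = 1
  right : U * Uᴴ = 1
  eq : ρ = U * diagonal (fun i => (d i : ℂ)) * Uᴴ

theorem exists_diagonalizes {ρ : Matrix n n ℂ} (h : ρ.IsHermitian) :
    Diagonalizes (h.eigenvectorUnitary : Matrix n n ℂ) h.eigenvalues ρ where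
  left := Unitary.coe_star_mul_self _
  right := Unitary.coe_mul_star_self _
  eq := by
    conv_lhs => rw [h.spectral_theorem]
    rfl

theorem exists_diagonalizes_nonneg {ρ : Matrix n n ℂ} (h : ρ.PosSemidef) :
    ∃ U d, Diagonalizes U d ρ ∧ ∀ i, 0 ≤ d i :=
  ⟨_, _, exists_diagonalizes h.isHermitian, h.eigenvalues_nonneg⟩

theorem entropy_eq_sum_eigenvalues {ρ : Matrix n n ℂ} (h : ρ.IsHermitian) :
    entropy ρ = ∑ i, Real.negMulLog (h.eigenvalues i) := by
  have hd := exists_diagonalizes h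
  have hl : cfc Real.log ρ = (h.eigenvectorUnitary : Matrix n n ℂ)
      * diagonal (fun i => (Real.log (h.eigenvalues i) : ℂ))
      * (h.eigenvectorUnitary : Matrix n n ℂ)ᴴ := by
    rw [Matrix.IsHermitian.cfc_eq h]; rfl
  have : ρ * cfc Real.log ρ = (h.eigenvectorUnitary : Matrix n n ℂ)
      * (diagonal (fun i => (h.eigenvalues i : ℂ))
        * diagonal (fun i => (Real.log (h.eigenvalues i) : ℂ)))
      * (h.eigenvectorUnitary : Matrix n n ℂ)ᴴ := by
    rw [hl]
    conv_lhs => enter [1]; rw [hd.eq]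
    calc _ = (h.eigenvectorUnitary : Matrix n n ℂ) * diagonal (fun i => (h.eigenvalues i : ℂ))
          * ((h.eigenvectorUnitary : Matrix n n ℂ)ᴴ * (h.eigenvectorUnitary : Matrix n n ℂ))
          * diagonal (fun i => (Real.log (h.eigenvalues i) : ℂ))
          * (h.eigenvectorUnitary : Matrix n n ℂ)ᴴ := by noncomm_ring
      _ = _ := by rw [hd.left]; noncomm_ring
  rw [entropy, this, Matrix.trace_mul_comm, ← mul_assoc, hd.left, one_mul, diagonal_mul_diagonal,
    trace_diagonal, Complex.re_sum, ← Finset.sum_neg_distrib]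
  refine Finset.sum_congr rfl fun i _ => ?_
  rw [← Complex.ofReal_mul, Complex.ofReal_re, Real.negMulLog]; ring

namespace Diagonalizes

variable {U : Matrix n n ℂ} {d : n → ℝ} {ρ : Matrix n n ℂ}

theorem charpoly_eq (h : Diagonalizes U d ρ) :
    ρ.charpoly = ∏ i, (Polynomial.X - Polynomial.C (d i : ℂ)) := by
  rw [h.eq, charpoly_mul_comm, ← mul_assoc, h.left, one_mul, charpoly_diagonal]

theorem isHermitian (h : Diagonalizes U d ρ) : ρ.IsHermitian := by
  rw [h.eq]
  refine isHermitian_mul_mul_conjTranspose _ ?_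
  rw [IsHermitian, diagonal_conjTranspose]
  congr 1; ext i; simp

/-- All diagonalizations share the characteristic polynomial, hence the multiset of its roots. This
frees the entropy from the chosen `eigenvalues`, so each later entropy can be read off in whatever
basis is at hand. -/
theorem entropy_eq (h : Diagonalizes U d ρ) : entropy ρ = ∑ i, Real.negMulLog (d i) := by
  have h1 := h.charpoly_eq
  rw [h.isHermitian.charpoly_eq] at h1
  have h2 := congrArg Polynomial.roots h1
  have hr : ∀ f : n → ℂ, (∏ i, (Polynomial.X - Polynomial.C (f i))).roots
      = Finset.univ.val.map f := fun f => by
    rw [Polynomial.roots_prod _ _ (Finset.prod_ne_zero_iff.2 fun i _ => Polynomial.X_sub_C_ne_zero _)]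
    simp
  rw [hr, hr] at h2
  rw [entropy_eq_sum_eigenvalues h.isHermitian]
  have h3 := congrArg (fun s => (s.map fun z : ℂ => Real.negMulLog z.re).sum) h2
  simpa [Multiset.map_map] using h3

theorem of_diagonal (d : n → ℝ) : Diagonalizes 1 d (diagonal fun i => (d i : ℂ)) :=
  ⟨by simp, by simp, by simp⟩

theorem conj (h : Diagonalizes U d ρ) {V : Matrix n n ℂ} (hV : V ∈ unitaryGroup n ℂ) :
    Diagonalizes (V * U) d (conj V ρ) where
  left := by
    rw [conjTranspose_mul, mul_assoc, ← mul_assoc Vᴴ, ← star_eq_conjTranspose V,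
      mem_unitaryGroup_iff'.1 hV, one_mul, h.left]
  right := by
    rw [conjTranspose_mul, mul_assoc, ← mul_assoc U, h.right, one_mul,
      ← star_eq_conjTranspose V, mem_unitaryGroup_iff.1 hV]
  eq := by rw [QEC.conj, h.eq, conjTranspose_mul]; noncomm_ring

theorem reindex (h : Diagonalizes U d ρ) (e : m ≃ n) :
    Diagonalizes (U.submatrix e e) (d ∘ e) (ρ.submatrix e e) where
  left := by
    rw [conjTranspose_submatrix, submatrix_mul_equiv, h.left, submatrix_one_equiv]
  right := by
    rw [conjTranspose_submatrix, submatrix_mul_equiv, h.right, submatrix_one_equiv]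
  eq := by
    have : diagonal (fun i => (((d ∘ e) i : ℝ) : ℂ))
        = (diagonal fun i => (d i : ℂ)).submatrix e e := by
      rw [submatrix_diagonal_equiv]; rfl
    rw [this, conjTranspose_submatrix, submatrix_mul_equiv, submatrix_mul_equiv, ← h.eq]

theorem smul (h : Diagonalizes U d ρ) (c : ℝ) :
    Diagonalizes U (fun i => c * d i) ((c : ℂ) • ρ) where
  left := h.left
  right := h.right
  eq := by
    have : (diagonal fun i => ((c * d i : ℝ) : ℂ)) = (c : ℂ) • diagonal fun i => (d i : ℂ) := by
      ext i j; simp [diagonal_apply]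
    rw [this, mul_smul_comm, smul_mul_assoc, ← h.eq]

theorem kronecker (h : Diagonalizes U d ρ) {V : Matrix m m ℂ} {d' : m → ℝ} {σ : Matrix m m ℂ}
    (h' : Diagonalizes V d' σ) :
    Diagonalizes (U ⊗ₖ V) (fun i => d i.1 * d' i.2) (ρ ⊗ₖ σ) where
  left := by
    rw [conjTranspose_kronecker, ← mul_kronecker_mul, h.left, h'.left, one_kronecker_one]
  right := by
    rw [conjTranspose_kronecker, ← mul_kronecker_mul, h.right, h'.right, one_kronecker_one]
  eq := by
    have : (diagonal fun i : n × m => ((d i.1 * d' i.2 : ℝ) : ℂ))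
        = (diagonal fun i => (d i : ℂ)) ⊗ₖ diagonal fun i => (d' i : ℂ) := by
      rw [diagonal_kronecker_diagonal]; simp
    rw [this, conjTranspose_kronecker, ← mul_kronecker_mul, ← mul_kronecker_mul, ← h.eq, ← h'.eq]

theorem blockDiagonal {B : l → Matrix k k ℂ} {V : l → Matrix k k ℂ} {f : l → k → ℝ}
    (h : ∀ x, Diagonalizes (V x) (f x) (B x)) :
    Diagonalizes (blockDiagonal V) (fun i => f i.2 i.1) (blockDiagonal B) where
  left := by
    rw [blockDiagonal_conjTranspose, ← blockDiagonal_mul, ← blockDiagonal_one]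
    congr 1; ext1 x; exact (h x).left
  right := by
    rw [blockDiagonal_conjTranspose, ← blockDiagonal_mul, ← blockDiagonal_one]
    congr 1; ext1 x; exact (h x).right
  eq := by
    have : (diagonal fun i : k × l => ((f i.2 i.1 : ℝ) : ℂ))
        = Matrix.blockDiagonal fun x => diagonal fun a => (f x a : ℂ) := by
      rw [blockDiagonal_diagonal]
    rw [this, blockDiagonal_conjTranspose, ← blockDiagonal_mul, ← blockDiagonal_mul]
    congr 1; ext1 x; exact (h x).eq

theorem trace_eq (h : Diagonalizes U d ρ) : ρ.trace = ((∑ i, d i : ℝ) : ℂ) := by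
  rw [h.eq, trace_mul_comm, ← mul_assoc, h.left, one_mul, trace_diagonal]; push_cast; rfl

theorem conj_conjTranspose (h : Diagonalizes U d ρ) :
    Uᴴ * ρ * U = diagonal fun i => (d i : ℂ) := by
  rw [h.eq]
  calc _ = (Uᴴ * U) * diagonal (fun i => (d i : ℂ)) * (Uᴴ * U) := by noncomm_ring
    _ = _ := by rw [h.left]; simp

end Diagonalizes

theorem entropy_conj {V ρ : Matrix n n ℂ} (hV : V ∈ unitaryGroup n ℂ) (h : ρ.IsHermitian) :
    entropy (conj V ρ) = entropy ρ := by
  rw [((exists_diagonalizes h).conj hV).entropy_eq, (exists_diagonalizes h).entropy_eq]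

theorem entropy_submatrix (e : m ≃ n) {ρ : Matrix n n ℂ} (h : ρ.IsHermitian) :
    entropy (ρ.submatrix e e) = entropy ρ := by
  rw [((exists_diagonalizes h).reindex e).entropy_eq, (exists_diagonalizes h).entropy_eq]
  exact e.sum_comp fun i => Real.negMulLog (h.eigenvalues i)

theorem entropy_smul (c : ℝ) {ρ : Matrix n n ℂ} (h : ρ.IsHermitian) :
    entropy ((c : ℂ) • ρ) = c * entropy ρ + Real.negMulLog c * ρ.trace.re := by
  have hd := exists_diagonalizes h
  rw [(hd.smul c).entropy_eq, hd.entropy_eq, hd.trace_eq, Complex.ofReal_re, Finset.mul_sum,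
    Finset.mul_sum, ← Finset.sum_add_distrib]
  refine Finset.sum_congr rfl fun i _ => ?_
  rw [Real.negMulLog_mul]; ring

theorem entropy_kronecker {ρ : Matrix n n ℂ} {σ : Matrix m m ℂ} (h : ρ.IsHermitian)
    (h' : σ.IsHermitian) :
    entropy (ρ ⊗ₖ σ) = entropy ρ * σ.trace.re + ρ.trace.re * entropy σ := by
  have hd := exists_diagonalizes h
  have hd' := exists_diagonalizes h'
  rw [(hd.kronecker hd').entropy_eq, hd.entropy_eq, hd'.entropy_eq, hd.trace_eq, hd'.trace_eq,
    Complex.ofReal_re, Complex.ofReal_re, Finset.sum_mul_sum, Finset.sum_mul_sum,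
    Fintype.sum_prod_type, ← Finset.sum_add_distrib]
  refine Finset.sum_congr rfl fun i _ => ?_
  rw [← Finset.sum_add_distrib]
  refine Finset.sum_congr rfl fun j _ => ?_
  rw [Real.negMulLog_mul]; ring

theorem entropy_diagonal (d : n → ℝ) :
    entropy (diagonal fun i => (d i : ℂ)) = ∑ i, Real.negMulLog (d i) :=
  (Diagonalizes.of_diagonal d).entropy_eq

theorem entropy_proj (x : n) : entropy (proj x) = 0 := by
  have : (proj x : Matrix n n ℂ) = diagonal fun i => ((if i = x then 1 else 0 : ℝ) : ℂ) := by
    ext i j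
    by_cases hi : i = x <;> by_cases hij : i = j <;> subst_vars <;>
      simp_all [proj, eq_comm]
  rw [this, entropy_diagonal]
  refine Finset.sum_eq_zero fun i _ => ?_
  split_ifs <;> simp

theorem entropy_blockDiagonal {B : l → Matrix k k ℂ} (h : ∀ x, (B x).IsHermitian) :
    entropy (blockDiagonal B) = ∑ x, entropy (B x) := by
  rw [(Diagonalizes.blockDiagonal fun x => exists_diagonalizes (h x)).entropy_eq,
    Fintype.sum_prod_type_right]
  exact Finset.sum_congr rfl fun x _ => (exists_diagonalizes (h x)).entropy_eq.symm

/-- The entropy of a block diagonal operator. -/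
theorem entropy_of_blocks (e : n ≃ k × l) {σ : Matrix n n ℂ} {B : l → Matrix k k ℂ}
    (h : ∀ x, (B x).IsHermitian)
    (hσ : ∀ i x j x', σ (e.symm (i, x)) (e.symm (j, x')) = if x = x' then B x i j else 0) :
    entropy σ = ∑ x, entropy (B x) := by
  have hs : σ = (blockDiagonal B).submatrix e e := by
    ext i j
    have := hσ (e i).1 (e i).2 (e j).1 (e j).2
    simpa [blockDiagonal_apply] using this
  have hB : (blockDiagonal B).IsHermitian := by
    rw [IsHermitian, blockDiagonal_conjTranspose]
    congr 1; ext1 x; exact h x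
  rw [hs, entropy_submatrix _ hB, entropy_blockDiagonal h]

/-! ### Klein's inequality and the entropy gain of positive maps -/

/-- This is ln t ≤ t - 1 at t = q/a, multiplied by a. The linear terms q - a are kept so that
Klein's inequality needs no normalization. -/
theorem negMulLog_le_of_nonneg {a q : ℝ} (ha : 0 ≤ a) (hq : 0 < q) :
    Real.negMulLog a ≤ -(a * Real.log q) + q - a := by
  rcases ha.eq_or_lt with rfl | ha
  · simp [hq.le]
  · have h := Real.log_le_sub_one_of_pos (div_pos hq ha)
    rw [Real.log_div hq.ne' ha.ne'] at h
    have := mul_le_mul_of_nonneg_left h ha.le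
    rw [mul_sub, mul_sub, mul_div_cancel₀ _ ha.ne'] at this
    rw [Real.negMulLog]; linarith

theorem Diagonalizes.apply_diag_re {V : Matrix n n ℂ} {d : n → ℝ} {ρ : Matrix n n ℂ}
    (h : Diagonalizes V d ρ) (U : Matrix n n ℂ) (j : n) :
    ((Uᴴ * ρ * U) j j).re = ∑ i, Complex.normSq ((Uᴴ * V) j i) * d i := by
  have : Uᴴ * ρ * U = (Uᴴ * V) * diagonal (fun i => (d i : ℂ)) * (Uᴴ * V)ᴴ := by
    rw [h.eq, conjTranspose_mul, conjTranspose_conjTranspose]; noncomm_ring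
  rw [this, mul_apply, Complex.re_sum]
  refine Finset.sum_congr rfl fun i _ => ?_
  rw [mul_diagonal, conjTranspose_apply, mul_right_comm, Complex.star_def, Complex.mul_conj,
    ← Complex.ofReal_mul, Complex.ofReal_re]

theorem sum_normSq_row {W : Matrix n n ℂ} (h : W * Wᴴ = 1) (j : n) :
    ∑ i, Complex.normSq (W j i) = 1 := by
  have h1 := congrFun (congrFun h j) j
  rw [mul_apply, one_apply_eq] at h1
  have : ((∑ i, Complex.normSq (W j i) : ℝ) : ℂ) = 1 := by
    rw [← h1]; push_cast
    refine Finset.sum_congr rfl fun i _ => ?_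
    rw [conjTranspose_apply, Complex.star_def, Complex.mul_conj]
  exact_mod_cast this

theorem sum_normSq_col {W : Matrix n n ℂ} (h : Wᴴ * W = 1) (i : n) :
    ∑ j, Complex.normSq (W j i) = 1 := by
  have := sum_normSq_row (W := Wᴴ) (by rwa [conjTranspose_conjTranspose]) i
  simpa [conjTranspose_apply] using this

/-- Klein's inequality in an orthonormal basis: cross entropy bounds the entropy. -/
theorem entropy_le_crossEntropy {ρ U : Matrix n n ℂ} (hρ : ρ.PosSemidef) (hU : Uᴴ * U = 1)
    (hU' : U * Uᴴ = 1) {q : n → ℝ} (hq : ∀ j, 0 ≤ q j)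
    (h0 : ∀ j, q j = 0 → ((Uᴴ * ρ * U) j j).re = 0) :
    entropy ρ ≤ -(∑ j, ((Uᴴ * ρ * U) j j).re * Real.log (q j)) + ∑ j, q j - ρ.trace.re := by
  obtain ⟨V, d, hd, hn⟩ := exists_diagonalizes_nonneg hρ
  set W := Uᴴ * V with hW
  have hW1 : W * Wᴴ = 1 := by
    rw [hW, conjTranspose_mul, conjTranspose_conjTranspose, mul_assoc, ← mul_assoc V, hd.right,
      one_mul, hU]
  have hW2 : Wᴴ * W = 1 := by
    rw [hW, conjTranspose_mul, conjTranspose_conjTranspose, mul_assoc, ← mul_assoc U, hU',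
      one_mul, hd.left]
  have hg := hd.apply_diag_re U
  rw [← hW] at hg
  -- The weights |W j i|² are doubly stochastic, so averaging the scalar inequality with them
  -- recovers the spectrum of ρ on one side and its diagonal in the basis U on the other. Since
  -- `Real.log 0 = 0`, the indices with q j = 0 are harmless only because `h0` makes |W j i|² d i
  -- vanish there.
  have hpt : ∀ j i, Complex.normSq (W j i) * Real.negMulLog (d i)
      ≤ Complex.normSq (W j i) * (-(d i * Real.log (q j)) + q j - d i) := by
    intro j i
    rcases (hq j).eq_or_lt with hj | hj
    · have h1 := h0 j hj.symm
      rw [hg, Finset.sum_eq_zero_iff_of_nonneg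
        fun i _ => mul_nonneg (Complex.normSq_nonneg _) (hn i)] at h1
      rcases mul_eq_zero.1 (h1 i (Finset.mem_univ i)) with h2 | h2
      · simp [h2]
      · simp [h2, ← hj]
    · exact mul_le_mul_of_nonneg_left (negMulLog_le_of_nonneg (hn i) hj) (Complex.normSq_nonneg _)
  have hsum := Finset.sum_le_sum fun j (_ : j ∈ Finset.univ) =>
    Finset.sum_le_sum fun i (_ : i ∈ Finset.univ) => hpt j i
  have hL : ∑ j, ∑ i, Complex.normSq (W j i) * Real.negMulLog (d i) = entropy ρ := by
    rw [Finset.sum_comm, hd.entropy_eq]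
    refine Finset.sum_congr rfl fun i _ => ?_
    rw [← Finset.sum_mul, sum_normSq_col hW2, one_mul]
  have hR : ∑ j, ∑ i, Complex.normSq (W j i) * (-(d i * Real.log (q j)) + q j - d i)
      = -(∑ j, ((Uᴴ * ρ * U) j j).re * Real.log (q j)) + ∑ j, q j - ρ.trace.re := by
    have h1 : ∑ j, ∑ i, Complex.normSq (W j i) * d i = ρ.trace.re := by
      rw [Finset.sum_comm, hd.trace_eq, Complex.ofReal_re]
      refine Finset.sum_congr rfl fun i _ => ?_
      rw [← Finset.sum_mul, sum_normSq_col hW2, one_mul]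
    rw [← h1, ← Finset.sum_neg_distrib, ← Finset.sum_add_distrib, ← Finset.sum_sub_distrib]
    refine Finset.sum_congr rfl fun j _ => ?_
    have h2 : q j = ∑ i, Complex.normSq (W j i) * q j := by
      rw [← Finset.sum_mul, sum_normSq_row hW1, one_mul]
    rw [hg, Finset.sum_mul, ← Finset.sum_neg_distrib]
    conv_rhs => enter [1, 2]; rw [h2]
    rw [← Finset.sum_add_distrib, ← Finset.sum_sub_distrib]
    refine Finset.sum_congr rfl fun i _ => ?_
    ring
  rwa [hL, hR] at hsum

theorem posSemidef_re_diag_nonneg {ρ : Matrix n n ℂ} (h : ρ.PosSemidef) (i : n) :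
    0 ≤ (ρ i i).re := (Complex.le_def.1 (h.diag_nonneg (i := i))).1

theorem diag_conj_re_nonneg {ρ : Matrix n n ℂ} (h : ρ.PosSemidef) (U : Matrix n n ℂ) (j : n) :
    0 ≤ ((Uᴴ * ρ * U) j j).re :=
  posSemidef_re_diag_nonneg (h.conjTranspose_mul_mul_same U) j

theorem proj_posSemidef (x : n) : (proj x : Matrix n n ℂ).PosSemidef := by
  have : (proj x : Matrix n n ℂ) = vecMulVec (Pi.single x 1) (star (Pi.single x 1)) := by
    ext i j
    by_cases hi : x = i <;> by_cases hj : x = j <;> subst_vars <;>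
      simp_all [proj, vecMulVec_apply, eq_comm]
  rw [this]; exact posSemidef_vecMulVec_self_star _

theorem trace_proj (x : n) : (proj x : Matrix n n ℂ).trace = 1 := by simp [proj]

theorem sum_smul_proj (d : n → ℂ) : ∑ x, d x • (proj x : Matrix n n ℂ) = diagonal d := by
  ext i j
  rw [Matrix.sum_apply, Finset.sum_eq_single i]
  · by_cases h : i = j <;> simp [proj, h]
  · intro b _ hb; simp [proj, hb]
  · simp

theorem sum_proj : ∑ x, (proj x : Matrix n n ℂ) = 1 := by
  simpa using sum_smul_proj fun _ : n => (1 : ℂ)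

/-- Pairing the adjoint with the identity removes it. In this form the efficacy is nonnegative for
positive maps, and a bound on N(1) bounds it directly. -/
theorem efficacy_eq (N : Matrix n n ℂ →ₗ[ℂ] Matrix m m ℂ) (ρ : Matrix n n ℂ) :
    efficacy N ρ = (N ρ * N 1).trace.re := by
  rw [efficacy, ← trace_adjointMap_mul, mul_one]

/-- A pointwise Gibbs inequality: ln s ≤ s - 1 at s = b/(ac), with weight t a. The constant c will
be a normalization, and `h0` excludes the case where the convention `Real.log 0 = 0` would spoil the
bound. -/
theorem mul_log_sub_log_le {t a b c : ℝ} (ht : 0 ≤ t) (ha : 0 ≤ a) (hb : 0 ≤ b) (hc : 0 < c)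
    (h0 : b = 0 → t * a = 0) :
    t * (a * (Real.log b - Real.log a)) ≤ t * (b / c - a + a * Real.log c) := by
  rcases hb.eq_or_lt with rfl | hb
  · rcases mul_eq_zero.1 (h0 rfl) with h | h <;> simp [h]
  · refine mul_le_mul_of_nonneg_left ?_ ht
    rcases ha.eq_or_lt with rfl | ha
    · simp; positivity
    · have h := Real.log_le_sub_one_of_pos (show 0 < b / (a * c) by positivity)
      rw [Real.log_div hb.ne' (by positivity), Real.log_mul ha.ne' hc.ne'] at h
      have h2 := mul_le_mul_of_nonneg_left h ha.le
      have h3 : a * (b / (a * c) - 1) = b / c - a := by field_simp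
      rw [h3] at h2; linarith

/-- The entropy gain of a positive trace-preserving map is bounded below by the negative
logarithm of its efficacy. -/
theorem neg_log_efficacy_le (N : Matrix n n ℂ →ₗ[ℂ] Matrix m m ℂ)
    (hpos : ∀ ρ, ρ.PosSemidef → (N ρ).PosSemidef) (htr : ∀ ρ, (N ρ).trace = ρ.trace)
    {ρ : Matrix n n ℂ} (hρ : ρ.PosSemidef) (h1 : ρ.trace = 1) :
    -Real.log (efficacy N ρ) ≤ entropy (N ρ) - entropy ρ := by
  obtain ⟨V, a, hV, ha⟩ := exists_diagonalizes_nonneg hρ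
  obtain ⟨U, b, hU, hb⟩ := exists_diagonalizes_nonneg (hpos ρ hρ)
  set G : n → Matrix m m ℂ := fun i => Uᴴ * N (V * proj i * Vᴴ) * U with hG
  -- The probability of finding the j-th eigenvector of N ρ after applying N to the i-th eigenvector
  -- of ρ. It is a stochastic matrix sending the spectrum a to the spectrum b, and the rest of the
  -- argument is classical.
  set T : m → n → ℝ := fun j i => (G i j j).re with hT
  have hT0 : ∀ j i, 0 ≤ T j i := fun j i =>
    diag_conj_re_nonneg (hpos _ ((proj_posSemidef i).mul_mul_conjTranspose_same V)) U j
  have hUU : ∀ X : Matrix m m ℂ, (Uᴴ * X * U).trace = X.trace := fun X => by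
    rw [trace_mul_comm, ← mul_assoc, hU.right, one_mul]
  have hTs : ∀ i, ∑ j, T j i = 1 := by
    intro i
    have : (G i).trace = 1 := by
      rw [hG]; simp only []
      rw [hUU, htr, trace_mul_comm, ← mul_assoc, hV.left, one_mul, trace_proj]
    have h2 := congrArg Complex.re this
    rwa [trace, Complex.re_sum] at h2
  have hρ' : ρ = ∑ i, (a i : ℂ) • (V * proj i * Vᴴ) := by
    rw [hV.eq, ← sum_smul_proj, Finset.mul_sum, Finset.sum_mul]
    simp only [mul_smul_comm, smul_mul_assoc]
  have hTb : ∀ j, ∑ i, a i * T j i = b j := by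
    intro j
    have h2 := hU.conj_conjTranspose
    rw [hρ', map_sum, Finset.mul_sum, Finset.sum_mul] at h2
    have h3 := congrArg Complex.re (congrFun (congrFun h2 j) j)
    rw [diagonal_apply_eq, Complex.ofReal_re, Matrix.sum_apply, Complex.re_sum] at h3
    rw [← h3]
    refine Finset.sum_congr rfl fun i _ => ?_
    rw [map_smul, mul_smul_comm, smul_mul_assoc, Matrix.smul_apply, smul_eq_mul, Complex.re_ofReal_mul]
  have hsa : ∑ i, a i = 1 := by
    have h2 := hV.trace_eq; rw [h1] at h2; exact_mod_cast h2.symm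
  have hsb : ∑ j, b j = 1 := by
    have h2 := hU.trace_eq; rw [htr, h1] at h2; exact_mod_cast h2.symm
  -- The sum of T j i over i is the j-th diagonal entry of N 1 in the eigenbasis of N ρ. The
  -- efficacy is thus the total mass of the weights T j i * b j.
  have heff : efficacy N ρ = ∑ j, ∑ i, T j i * b j := by
    have hN1 : Uᴴ * N 1 * U = ∑ i, G i := by
      have : (1 : Matrix n n ℂ) = ∑ i, V * proj i * Vᴴ := by
        rw [← Finset.sum_mul, ← Finset.mul_sum, sum_proj, mul_one, hV.right]
      rw [this, map_sum, Finset.mul_sum, Finset.sum_mul]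
    have h2 : (N ρ * N 1).trace = ((diagonal fun i => (b i : ℂ)) * ∑ i, G i).trace := by
      rw [← hN1]
      conv_lhs => rw [hU.eq]
      rw [mul_assoc, mul_assoc, trace_mul_comm]
      congr 1; noncomm_ring
    rw [efficacy_eq, h2, trace, Complex.re_sum]
    refine Finset.sum_congr rfl fun j _ => ?_
    rw [diag_apply, diagonal_mul, Complex.re_ofReal_mul, Matrix.sum_apply, Complex.re_sum,
      Finset.mul_sum]
    exact Finset.sum_congr rfl fun i _ => mul_comm _ _
  have ha1 : ∀ i, a i ≤ 1 := fun i => hsa ▸ Finset.single_le_sum (fun i _ => ha i)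
    (Finset.mem_univ i)
  -- Since a i ≤ 1, the sums of T j i over i dominate b j, so the efficacy is at least the sum of
  -- the squares of b, which is positive because b sums to 1.
  have hc : 0 < efficacy N ρ := by
    have h2 : ∑ j, b j * b j ≤ efficacy N ρ := by
      rw [heff]
      refine Finset.sum_le_sum fun j _ => ?_
      rw [← Finset.sum_mul]
      refine mul_le_mul_of_nonneg_right ?_ (hb j)
      rw [← hTb j]
      exact Finset.sum_le_sum fun i _ => mul_le_of_le_one_left (hT0 j i) (ha1 i)
    refine lt_of_lt_of_le ?_ h2
    refine (Finset.sum_nonneg fun j _ => mul_nonneg (hb j) (hb j)).lt_of_ne fun h3 => ?_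
    rw [eq_comm, Finset.sum_eq_zero_iff_of_nonneg fun j _ => mul_nonneg (hb j) (hb j)] at h3
    have : ∑ j, b j = 0 := Finset.sum_eq_zero fun j hj => mul_self_eq_zero.1 (h3 j hj)
    linarith
  -- Gibbs' inequality between the joint distribution T j i * a i and the weights T j i * b j
  -- divided by their total mass.
  have hpt : ∀ j i, T j i * (a i * (Real.log (b j) - Real.log (a i)))
      ≤ T j i * (b j / efficacy N ρ - a i + a i * Real.log (efficacy N ρ)) := by
    refine fun j i => mul_log_sub_log_le (hT0 j i) (ha i) (hb j) hc fun h => ?_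
    have h2 := hTb j
    rw [h, Finset.sum_eq_zero_iff_of_nonneg fun i _ => mul_nonneg (ha i) (hT0 j i)] at h2
    rw [mul_comm]; exact h2 i (Finset.mem_univ i)
  have hsum := Finset.sum_le_sum fun j (_ : j ∈ Finset.univ) =>
    Finset.sum_le_sum fun i (_ : i ∈ Finset.univ) => hpt j i
  have hTa : ∑ j, ∑ i, T j i * a i = 1 := by
    rw [← hsb]
    refine Finset.sum_congr rfl fun j _ => ?_
    rw [← hTb j]; exact Finset.sum_congr rfl fun i _ => mul_comm _ _
  have hL : ∑ j, ∑ i, T j i * (a i * (Real.log (b j) - Real.log (a i)))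
      = entropy ρ - entropy (N ρ) := by
    have e1 : ∑ j, ∑ i, T j i * (a i * Real.log (b j)) = -entropy (N ρ) := by
      rw [hU.entropy_eq, ← Finset.sum_neg_distrib]
      refine Finset.sum_congr rfl fun j _ => ?_
      rw [Real.negMulLog, neg_mul, neg_neg]
      conv_rhs => enter [1]; rw [← hTb j]
      rw [Finset.sum_mul]
      exact Finset.sum_congr rfl fun i _ => by ring
    have e2 : ∑ j, ∑ i, T j i * (a i * Real.log (a i)) = -entropy ρ := by
      rw [Finset.sum_comm, hV.entropy_eq, ← Finset.sum_neg_distrib]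
      refine Finset.sum_congr rfl fun i _ => ?_
      rw [← Finset.sum_mul, hTs, Real.negMulLog]; ring
    simp only [mul_sub, Finset.sum_sub_distrib]
    rw [e1, e2]; ring
  have hR : ∑ j, ∑ i, T j i * (b j / efficacy N ρ - a i + a i * Real.log (efficacy N ρ))
      = Real.log (efficacy N ρ) := by
    have e1 : ∑ j, ∑ i, T j i * (b j / efficacy N ρ) = 1 := by
      simp only [← mul_div_assoc, ← Finset.sum_div]
      rw [← heff, div_self hc.ne']
    have e2 : ∑ j, ∑ i, T j i * (a i * Real.log (efficacy N ρ)) = Real.log (efficacy N ρ) := by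
      simp only [← mul_assoc, ← Finset.sum_mul]
      rw [hTa, one_mul]
    simp only [mul_sub, mul_add, Finset.sum_sub_distrib, Finset.sum_add_distrib]
    rw [e1, e2, hTa]; ring
  rw [hL, hR] at hsum
  linarith

end Entropy

section Marginals

set_option linter.unusedSectionVars false

variable {n m k k' k₂ l l' l₂ l₃ : Type*} [Fintype n] [DecidableEq n] [Fintype m] [DecidableEq m]
  [Fintype k] [DecidableEq k] [Fintype k'] [DecidableEq k'] [Fintype l] [DecidableEq l]
  [Fintype l'] [DecidableEq l'] [Fintype k₂] [DecidableEq k₂] [Fintype l₂] [DecidableEq l₂]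
  [Fintype l₃] [DecidableEq l₃]

/-! ### Partial traces -/

theorem marginal_apply (e : n ≃ k × l) (ρ : Matrix n n ℂ) (i j : k) :
    marginal e ρ i j = ∑ t : l, ρ (e.symm (i, t)) (e.symm (j, t)) := rfl

theorem marginal_posSemidef (e : n ≃ k × l) {ρ : Matrix n n ℂ} (h : ρ.PosSemidef) :
    (marginal e ρ).PosSemidef := by
  have : marginal e ρ
      = ∑ t : l, ρ.submatrix (fun i => e.symm (i, t)) (fun i => e.symm (i, t)) := by
    ext i j; simp [marginal_apply, Matrix.sum_apply]
  rw [this]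
  exact posSemidef_sum _ fun t _ => h.submatrix _

theorem trace_marginal (e : n ≃ k × l) (ρ : Matrix n n ℂ) : (marginal e ρ).trace = ρ.trace := by
  simp only [trace, diag_apply, marginal_apply]
  rw [← e.symm.sum_comp, Fintype.sum_prod_type]

theorem marginal_add (e : n ≃ k × l) (ρ σ : Matrix n n ℂ) :
    marginal e (ρ + σ) = marginal e ρ + marginal e σ := by
  ext i j; simp [marginal_apply, Finset.sum_add_distrib]

theorem marginal_smul (e : n ≃ k × l) (c : ℂ) (ρ : Matrix n n ℂ) :
    marginal e (c • ρ) = c • marginal e ρ := by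
  ext i j; simp [marginal_apply, Finset.mul_sum]

/-- The partial trace as a linear map. -/
def marginalLin (e : n ≃ k × l) : Matrix n n ℂ →ₗ[ℂ] Matrix k k ℂ where
  toFun := marginal e
  map_add' := marginal_add e
  map_smul' := marginal_smul e

theorem marginal_sum {ι : Type*} (s : Finset ι) (e : n ≃ k × l) (ρ : ι → Matrix n n ℂ) :
    marginal e (∑ i ∈ s, ρ i) = ∑ i ∈ s, marginal e (ρ i) :=
  map_sum (marginalLin e) ρ s

/-- Two presentations of the same subsystem. -/
theorem marginal_congr (e : n ≃ k × l) (e' : n ≃ k' × l') (g : k ≃ k')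
    (h₁ : ∀ i t, (e' (e.symm (i, t))).1 = g i)
    (h₂ : ∀ i j t, (e' (e.symm (i, t))).2 = (e' (e.symm (j, t))).2) (ρ : Matrix n n ℂ) :
    marginal e ρ = (marginal e' ρ).submatrix g g := by
  ext i j
  rw [submatrix_apply, marginal_apply, marginal_apply]
  have hs : ∀ a t, (e (e'.symm (g a, t))).1 = a := by
    intro a t
    have := h₁ (e (e'.symm (g a, t))).1 (e (e'.symm (g a, t))).2
    simpa using this.symm
  -- By `h₂` the complementary label in the presentation e' depends on t alone. It therefore gives
  -- one reparametrization of the traced-out part, valid for the row i and the column j at once.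
  have key : ∀ a t, e.symm (a, t) = e'.symm (g a, (e' (e.symm (i, t))).2) := by
    intro a t
    rw [← h₁ a t, h₂ i a t]; simp
  refine Fintype.sum_bijective (fun t => (e' (e.symm (i, t))).2) ⟨fun t t' h => ?_, fun u => ?_⟩
    _ _ fun t => ?_
  · have h3 := (key i t).trans ((congrArg (fun u => e'.symm (g i, u)) h).trans (key i t').symm)
    simpa using h3
  · refine ⟨(e (e'.symm (g i, u))).2, ?_⟩
    have : (i, (e (e'.symm (g i, u))).2) = e (e'.symm (g i, u)) := Prod.ext (hs i u).symm rfl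
    simp [this]
  · rw [← key i t, ← key j t]

theorem marginal_congr_left (e : n ≃ k × l) (e' : n ≃ k × l')
    (h₁ : ∀ i t, (e' (e.symm (i, t))).1 = i)
    (h₂ : ∀ i j t, (e' (e.symm (i, t))).2 = (e' (e.symm (j, t))).2) (ρ : Matrix n n ℂ) :
    marginal e ρ = marginal e' ρ :=
  marginal_congr e e' (Equiv.refl k) h₁ h₂ ρ

/-- The presentation of a subsystem of a subsystem. -/
def subEquiv (e : n ≃ k × l) (e₂ : k ≃ k₂ × l₂) : n ≃ k₂ × (l₂ × l) :=
  (e.trans (e₂.prodCongr (Equiv.refl l))).trans (Equiv.prodAssoc _ _ _)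

theorem marginal_marginal (e : n ≃ k × l) (e₂ : k ≃ k₂ × l₂) (ρ : Matrix n n ℂ) :
    marginal e₂ (marginal e ρ) = marginal (subEquiv e e₂) ρ := by
  ext i j
  simp only [marginal_apply, Fintype.sum_prod_type]
  rfl

theorem marginal_marginal_congr (e : n ≃ k × l) (e₂ : k ≃ k₂ × l₂) (e₃ : n ≃ k₂ × l₃)
    (h₁ : ∀ i t, (e₃ ((subEquiv e e₂).symm (i, t))).1 = i)
    (h₂ : ∀ i j t, (e₃ ((subEquiv e e₂).symm (i, t))).2 = (e₃ ((subEquiv e e₂).symm (j, t))).2)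
    (ρ : Matrix n n ℂ) : marginal e₂ (marginal e ρ) = marginal e₃ ρ := by
  rw [marginal_marginal]; exact marginal_congr_left _ _ h₁ h₂ ρ

theorem marginal_submatrix (f : m ≃ n) (e : m ≃ k × l) (ρ : Matrix n n ℂ) :
    marginal e (ρ.submatrix f f) = marginal (f.symm.trans e) ρ := rfl

theorem entropy_marginal_congr (e : n ≃ k × l) (e' : n ≃ k' × l') (g : k ≃ k')
    (h₁ : ∀ i t, (e' (e.symm (i, t))).1 = g i)
    (h₂ : ∀ i j t, (e' (e.symm (i, t))).2 = (e' (e.symm (j, t))).2) {ρ : Matrix n n ℂ}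
    (hρ : ρ.PosSemidef) : entropy (marginal e ρ) = entropy (marginal e' ρ) := by
  rw [marginal_congr e e' g h₁ h₂ ρ, entropy_submatrix _ (marginal_posSemidef e' hρ).isHermitian]

theorem trace_mul_embed (e : n ≃ k × l) (ρ : Matrix n n ℂ) (O : Matrix k k ℂ) :
    (ρ * embed e O).trace = (marginal e ρ * O).trace := by
  simp only [trace, diag_apply, mul_apply, marginal_apply, embed]
  rw [← e.symm.sum_comp fun i => ∑ j, ρ i j * ((O ⊗ₖ (1 : Matrix l l ℂ)).submatrix e e) j i,
    Fintype.sum_prod_type]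
  refine Finset.sum_congr rfl fun i _ => ?_
  simp only [Finset.sum_mul]
  conv_rhs => rw [Finset.sum_comm]
  refine Finset.sum_congr rfl fun t _ => ?_
  rw [← e.symm.sum_comp, Fintype.sum_prod_type]
  refine Finset.sum_congr rfl fun j _ => ?_
  rw [Finset.sum_eq_single t]
  · simp
  · intro s _ hs; simp [one_apply, hs]
  · simp

theorem expect_embed (e : n ≃ k × l) (ρ : Matrix n n ℂ) (O : Matrix k k ℂ) :
    expect ρ (embed e O) = expect (marginal e ρ) O := by
  rw [expect, trace_mul_embed, expect]

theorem expect_add_right (ρ O O' : Matrix n n ℂ) :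
    expect ρ (O + O') = expect ρ O + expect ρ O' := by
  simp [expect, mul_add]

theorem expect_smul (c : ℝ) (ρ O : Matrix n n ℂ) :
    expect ((c : ℂ) • ρ) O = c * expect ρ O := by
  simp [expect]

theorem expect_sum {ι : Type*} (s : Finset ι) (ρ : ι → Matrix n n ℂ) (O : Matrix n n ℂ) :
    expect (∑ i ∈ s, ρ i) O = ∑ i ∈ s, expect (ρ i) O := by
  simp [expect, Finset.sum_mul, trace_sum]

theorem marginal_kronecker_left (ρ : Matrix k k ℂ) (σ : Matrix l l ℂ) :
    marginal (Equiv.refl _) (ρ ⊗ₖ σ) = σ.trace • ρ := by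
  ext i j
  simp [marginal_apply, trace, Finset.mul_sum, mul_comm]

theorem marginal_kronecker_right (ρ : Matrix k k ℂ) (σ : Matrix l l ℂ) :
    marginal (Equiv.prodComm k l) (ρ ⊗ₖ σ) = ρ.trace • σ := by
  ext i j
  simp [marginal_apply, trace, Finset.sum_mul]

theorem embed_mul (e : n ≃ k × l) (U V : Matrix k k ℂ) :
    embed e U * embed e V = embed e (U * V) := by
  rw [embed, embed, submatrix_mul_equiv, ← mul_kronecker_mul, one_mul]; rfl

theorem embed_conjTranspose (e : n ≃ k × l) (U : Matrix k k ℂ) :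
    (embed e U)ᴴ = embed e Uᴴ := by
  rw [embed, conjTranspose_submatrix, conjTranspose_kronecker, conjTranspose_one]; rfl

theorem embed_one (e : n ≃ k × l) : embed e (1 : Matrix k k ℂ) = 1 := by
  rw [embed, one_kronecker_one, submatrix_one_equiv]

theorem embed_mem_unitaryGroup (e : n ≃ k × l) {U : Matrix k k ℂ} (h : U ∈ unitaryGroup k ℂ) :
    embed e U ∈ unitaryGroup n ℂ := by
  rw [mem_unitaryGroup_iff, star_eq_conjTranspose, embed_conjTranspose, embed_mul,
    ← star_eq_conjTranspose, mem_unitaryGroup_iff.1 h, embed_one]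

theorem conj_posSemidef {ρ : Matrix n n ℂ} (h : ρ.PosSemidef) (U : Matrix n n ℂ) :
    (conj U ρ).PosSemidef := h.mul_mul_conjTranspose_same U

theorem trace_conj {U : Matrix n n ℂ} (h : U ∈ unitaryGroup n ℂ) (ρ : Matrix n n ℂ) :
    (conj U ρ).trace = ρ.trace := by
  rw [conj, trace_mul_comm, ← mul_assoc, ← star_eq_conjTranspose, mem_unitaryGroup_iff'.1 h,
    one_mul]

/-- A unitary that commutes with an observable conserves its expectation value. -/
theorem expect_conj_of_commute {U O : Matrix n n ℂ} (h : U ∈ unitaryGroup n ℂ)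
    (hc : Commute U O) (ρ : Matrix n n ℂ) : expect (conj U ρ) O = expect ρ O := by
  have h1 : Uᴴ * O * U = O := by
    rw [mul_assoc, ← hc.eq, ← mul_assoc, ← star_eq_conjTranspose, mem_unitaryGroup_iff'.1 h,
      one_mul]
  rw [expect, conj, expect]
  congr 1
  calc (U * ρ * Uᴴ * O).trace = (U * (ρ * Uᴴ * O)).trace := by simp only [mul_assoc]
    _ = (ρ * (Uᴴ * O * U)).trace := by rw [trace_mul_comm]; simp only [mul_assoc]
    _ = _ := by rw [h1]

/-! ### Subadditivity and the Gibbs variational principle -/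

theorem one_kronecker_eq_embed (O : Matrix l l ℂ) :
    (1 : Matrix k k ℂ) ⊗ₖ O = embed (Equiv.prodComm k l) O := by
  ext ⟨i, i'⟩ ⟨j, j'⟩; simp [embed, mul_comm]

theorem kronecker_one_eq_embed (O : Matrix k k ℂ) :
    O ⊗ₖ (1 : Matrix l l ℂ) = embed (Equiv.refl _) O := rfl

theorem trace_mul_proj (ρ : Matrix n n ℂ) (i : n) : (ρ * proj i).trace = ρ i i := by
  simp [proj, trace_mul_single]

theorem entropy_le_add_prod {ρ : Matrix (k × l) (k × l) ℂ} (hρ : ρ.PosSemidef)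
    (h1 : ρ.trace = 1) :
    entropy ρ ≤ entropy (marginal (Equiv.refl _) ρ)
      + entropy (marginal (Equiv.prodComm k l) ρ) := by
  obtain ⟨U, a, hU, ha⟩ := exists_diagonalizes_nonneg (marginal_posSemidef (Equiv.refl _) hρ)
  obtain ⟨V, b, hV, hb⟩ := exists_diagonalizes_nonneg
    (marginal_posSemidef (Equiv.prodComm k l) hρ)
  -- Klein's inequality is applied in the product of the eigenbases of the two marginals, against
  -- the products of their eigenvalues.
  set W := U ⊗ₖ V with hW
  have hW1 : Wᴴ * W = 1 := by
    rw [hW, conjTranspose_kronecker, ← mul_kronecker_mul, hU.left, hV.left, one_kronecker_one]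
  have hW2 : W * Wᴴ = 1 := by
    rw [hW, conjTranspose_kronecker, ← mul_kronecker_mul, hU.right, hV.right, one_kronecker_one]
  set g : k × l → ℝ := fun i => ((Wᴴ * ρ * W) i i).re with hg
  have hg0 : ∀ i, 0 ≤ g i := diag_conj_re_nonneg hρ W
  have hcyc : ∀ X : Matrix (k × l) (k × l) ℂ, (Wᴴ * ρ * W * X).trace
      = (ρ * (W * X * Wᴴ)).trace := by
    intro X
    rw [mul_assoc, mul_assoc, trace_mul_comm]
    congr 1; noncomm_ring
  have hga : ∀ i, ∑ t, g (i, t) = a i := by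
    intro i
    have e1 : (Wᴴ * ρ * W * (proj i ⊗ₖ (1 : Matrix l l ℂ))).trace = (a i : ℂ) := by
      rw [hcyc, hW, ← mul_kronecker_mul, conjTranspose_kronecker, ← mul_kronecker_mul, mul_one,
        hV.right, kronecker_one_eq_embed, trace_mul_embed, ← mul_assoc, trace_mul_comm,
        ← mul_assoc, ← mul_assoc, hU.conj_conjTranspose, trace_mul_proj, diagonal_apply_eq]
    rw [kronecker_one_eq_embed, trace_mul_embed, trace_mul_proj, marginal_apply] at e1
    have := congrArg Complex.re e1
    rw [Complex.re_sum, Complex.ofReal_re] at this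
    exact this
  have hgb : ∀ t, ∑ i, g (i, t) = b t := by
    intro i
    have e1 : (Wᴴ * ρ * W * ((1 : Matrix k k ℂ) ⊗ₖ proj i)).trace = (b i : ℂ) := by
      rw [hcyc, hW, ← mul_kronecker_mul, conjTranspose_kronecker, ← mul_kronecker_mul, mul_one,
        hU.right, one_kronecker_eq_embed, trace_mul_embed, ← mul_assoc, trace_mul_comm,
        ← mul_assoc, ← mul_assoc, hV.conj_conjTranspose, trace_mul_proj, diagonal_apply_eq]
    rw [one_kronecker_eq_embed, trace_mul_embed, trace_mul_proj, marginal_apply] at e1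
    have := congrArg Complex.re e1
    rw [Complex.re_sum, Complex.ofReal_re] at this
    exact this
  -- The nonnegative array g has marginals a and b, so it vanishes wherever one of them does. This
  -- gives both the support condition of Klein's inequality and the splitting of ln(a b) under the
  -- sum.
  have hz : ∀ i t, a i * b t = 0 → g (i, t) = 0 := by
    intro i t h
    rcases mul_eq_zero.1 h with h | h
    · have h2 := hga i
      rw [h, Finset.sum_eq_zero_iff_of_nonneg fun t _ => hg0 (i, t)] at h2
      exact h2 t (Finset.mem_univ t)
    · have h2 := hgb t
      rw [h, Finset.sum_eq_zero_iff_of_nonneg fun i _ => hg0 (i, t)] at h2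
      exact h2 i (Finset.mem_univ i)
  have hmain := entropy_le_crossEntropy hρ hW1 hW2 (q := fun i => a i.1 * b i.2)
    (fun j => mul_nonneg (ha _) (hb _)) (fun j h => hz j.1 j.2 h)
  have hsa : ∑ i, a i = 1 := by
    have h2 := hU.trace_eq; rw [trace_marginal, h1] at h2; exact_mod_cast h2.symm
  have hsb : ∑ j, b j = 1 := by
    have h2 := hV.trace_eq; rw [trace_marginal, h1] at h2; exact_mod_cast h2.symm
  have hq : ∑ j : k × l, a j.1 * b j.2 = 1 := by
    rw [Fintype.sum_prod_type, ← Finset.sum_mul_sum, hsa, hsb, one_mul]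
  have hlog : ∀ i t, g (i, t) * Real.log (a i * b t)
      = g (i, t) * Real.log (a i) + g (i, t) * Real.log (b t) := by
    intro i t
    by_cases h : a i * b t = 0
    · simp [hz i t h]
    · rw [Real.log_mul (left_ne_zero_of_mul h) (right_ne_zero_of_mul h), mul_add]
  have hs : ∑ j, g j * Real.log (a j.1 * b j.2)
      = ∑ i, a i * Real.log (a i) + ∑ t, b t * Real.log (b t) := by
    rw [Fintype.sum_prod_type]
    simp only [hlog, Finset.sum_add_distrib]
    congr 1
    · refine Finset.sum_congr rfl fun i _ => ?_
      rw [← Finset.sum_mul, hga]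
    · rw [Finset.sum_comm]
      refine Finset.sum_congr rfl fun i _ => ?_
      rw [← Finset.sum_mul, hgb]
  have hs' : ∑ j, ((Wᴴ * ρ * W) j j).re * Real.log (a j.1 * b j.2)
      = ∑ i, a i * Real.log (a i) + ∑ t, b t * Real.log (b t) := hs
  rw [hs', hq, h1, Complex.one_re] at hmain
  rw [hU.entropy_eq, hV.entropy_eq]
  simp only [Real.negMulLog, neg_mul, Finset.sum_neg_distrib]
  linarith

/-- Subadditivity of the von Neumann entropy. -/
theorem entropy_le_add (e : n ≃ k × l) (e' : n ≃ l × k')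
    (h₁ : ∀ i t, (e' (e.symm (t, i))).1 = i)
    (h₂ : ∀ i j t, (e' (e.symm (t, i))).2 = (e' (e.symm (t, j))).2)
    {ρ : Matrix n n ℂ} (hρ : ρ.PosSemidef) (h1 : ρ.trace = 1) :
    entropy ρ ≤ entropy (marginal e ρ) + entropy (marginal e' ρ) := by
  have h := entropy_le_add_prod (hρ.submatrix e.symm)
    (by rw [← h1, ← trace_marginal (Equiv.refl _), ← trace_marginal e]; rfl)
  rw [entropy_submatrix _ hρ.isHermitian] at h
  rw [← marginal_congr_left (e.trans (Equiv.prodComm k l)) e' (fun i t => h₁ i t)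
    (fun i j t => h₂ i j t)]
  exact h

/-- The exponential commutes with the change of basis, so the Gibbs state is diagonal in any
eigenbasis of H, with the Boltzmann weights as eigenvalues. -/
theorem Diagonalizes.gibbs {U H : Matrix n n ℂ} {ε : n → ℝ} (h : Diagonalizes U ε H) (β : ℝ) :
    Diagonalizes U (fun i => Real.exp (-β * ε i) / ∑ j, Real.exp (-β * ε j)) (gibbs β H) := by
  have hU : IsUnit U := ⟨⟨U, Uᴴ, h.right, h.left⟩, rfl⟩
  have hinv : U⁻¹ = Uᴴ := inv_eq_left_inv h.left
  have hexp : NormedSpace.exp ((-β : ℂ) • H)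
      = U * diagonal (fun i => (Real.exp (-β * ε i) : ℂ)) * Uᴴ := by
    have h1 : (-β : ℂ) • H = U * diagonal (fun i => ((-β * ε i : ℝ) : ℂ)) * U⁻¹ := by
      have h2 := (h.smul (-β)).eq
      rw [hinv, ← h2]; push_cast; rfl
    rw [h1, exp_conj _ _ hU, exp_diagonal, hinv]
    congr 3
    ext i
    rw [Pi.coe_exp, ← Complex.exp_eq_exp_ℂ, Complex.ofReal_exp]
  have htr : (NormedSpace.exp ((-β : ℂ) • H)).trace
      = ((∑ j, Real.exp (-β * ε j) : ℝ) : ℂ) := by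
    rw [hexp, trace_mul_comm, ← mul_assoc, h.left, one_mul, trace_diagonal]; push_cast; rfl
  have h0 : Diagonalizes U (fun i => Real.exp (-β * ε i)) (NormedSpace.exp ((-β : ℂ) • H)) :=
    ⟨h.left, h.right, hexp⟩
  have h1 := h0.smul (∑ j, Real.exp (-β * ε j))⁻¹
  rw [QEC.gibbs, htr, ← Complex.ofReal_inv]
  convert h1 using 2 with i
  rw [div_eq_inv_mul]

theorem gibbs_posSemidef (β : ℝ) {H : Matrix n n ℂ} (h : H.IsHermitian) :
    (gibbs β H).PosSemidef := by
  have hd := (exists_diagonalizes h).gibbs β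
  rw [hd.eq]
  refine PosSemidef.mul_mul_conjTranspose_same (PosSemidef.diagonal fun (_ : n) => ?_) _
  simp only [Pi.zero_apply]
  exact_mod_cast div_nonneg (Real.exp_pos _).le (Finset.sum_nonneg fun j _ => (Real.exp_pos _).le)

theorem sum_exp_pos [Nonempty n] (f : n → ℝ) : 0 < ∑ i, Real.exp (f i) :=
  Finset.sum_pos (fun _ _ => Real.exp_pos _) Finset.univ_nonempty

theorem trace_gibbs [Nonempty n] (β : ℝ) {H : Matrix n n ℂ} (h : H.IsHermitian) :
    (gibbs β H).trace = 1 := by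
  rw [((exists_diagonalizes h).gibbs β).trace_eq, ← Finset.sum_div, div_self (sum_exp_pos _).ne',
    Complex.ofReal_one]

theorem Diagonalizes.expect_eq {U H : Matrix n n ℂ} {ε : n → ℝ} (h : Diagonalizes U ε H)
    (ρ : Matrix n n ℂ) : expect ρ H = ∑ j, ((Uᴴ * ρ * U) j j).re * ε j := by
  have : (ρ * H).trace = ((Uᴴ * ρ * U) * diagonal fun i => (ε i : ℂ)).trace := by
    calc _ = (ρ * U * diagonal (fun i => (ε i : ℂ)) * Uᴴ).trace := by
          conv_lhs => rw [h.eq]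
          simp only [mul_assoc]
      _ = _ := by rw [trace_mul_comm]; simp only [mul_assoc]
  rw [expect, this, trace, Complex.re_sum]
  refine Finset.sum_congr rfl fun j _ => ?_
  rw [diag_apply, mul_diagonal, Complex.re_mul_ofReal]

/-- The Gibbs variational principle. -/
theorem entropy_sub_entropy_gibbs_le (β : ℝ) {H ρ : Matrix n n ℂ} (hH : H.IsHermitian)
    (hρ : ρ.PosSemidef) (h1 : ρ.trace = 1) :
    entropy ρ - entropy (gibbs β H) ≤ β * (expect ρ H - expect (gibbs β H) H) := by
  have hne : Nonempty n := by
    by_contra h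
    rw [not_nonempty_iff] at h
    simp [trace] at h1
  have hd := exists_diagonalizes hH
  have hg := hd.gibbs β
  generalize (hH.eigenvectorUnitary : Matrix n n ℂ) = U at hd hg
  generalize hH.eigenvalues = ε at hd hg
  set Z := ∑ j, Real.exp (-β * ε j) with hZ
  have hZ0 : 0 < Z := sum_exp_pos _
  have hlog : ∀ j, Real.log (Real.exp (-β * ε j) / Z) = -β * ε j - Real.log Z := fun j => by
    rw [Real.log_div (Real.exp_pos _).ne' hZ0.ne', Real.log_exp]
  have hq : ∑ j, Real.exp (-β * ε j) / Z = 1 := by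
    rw [← Finset.sum_div, div_self hZ0.ne']
  -- Klein's inequality against the Boltzmann weights. Their logarithms are affine in the energy, so
  -- the cross entropy is β⟨H⟩ + ln Z, and `e2` says that the Gibbs state attains it.
  have hm := entropy_le_crossEntropy hρ hd.left hd.right
    (q := fun j => Real.exp (-β * ε j) / Z) (fun j => by positivity)
    (fun j h => absurd h (by positivity))
  have htr : ∑ j, ((Uᴴ * ρ * U) j j).re = 1 := by
    have : (Uᴴ * ρ * U).trace = 1 := by
      rw [trace_mul_comm, ← mul_assoc, hd.right, one_mul, h1]
    rw [← Complex.re_sum]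
    exact (congrArg Complex.re this).trans Complex.one_re
  have e1 : ∑ j, ((Uᴴ * ρ * U) j j).re * Real.log (Real.exp (-β * ε j) / Z)
      = -β * expect ρ H - Real.log Z := by
    rw [hd.expect_eq, Finset.mul_sum]
    simp only [hlog, mul_sub, Finset.sum_sub_distrib]
    rw [← Finset.sum_mul, htr, one_mul]
    congr 1
    exact Finset.sum_congr rfl fun j _ => by ring
  have e2 : entropy (gibbs β H) = β * expect (gibbs β H) H + Real.log Z := by
    rw [hg.entropy_eq, hd.expect_eq, hg.conj_conjTranspose, Finset.mul_sum]
    simp only [Real.negMulLog, hlog, mul_sub, Finset.sum_sub_distrib, diagonal_apply_eq,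
      Complex.ofReal_re]
    rw [← Finset.sum_mul, Finset.sum_neg_distrib, hq]
    have : ∀ i, -(Real.exp (-β * ε i) / Z) * (-β * ε i)
      = β * (Real.exp (-β * ε i) / Z * ε i) := fun i => by ring
    simp only [this]; ring
  rw [e1, hq, h1, Complex.one_re] at hm
  rw [e2]; linarith

end Marginals

section LocalMaps

set_option linter.unusedSectionVars false

variable {n n' m k k' k₂ l l₂ l₃ c y : Type*} [Fintype n] [DecidableEq n]
  [Fintype n'] [DecidableEq n'] [Fintype m] [DecidableEq m]
  [Fintype k] [DecidableEq k] [Fintype k'] [DecidableEq k'] [Fintype l] [DecidableEq l]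
  [Fintype k₂] [DecidableEq k₂] [Fintype l₂] [DecidableEq l₂]
  [Fintype l₃] [DecidableEq l₃] [Fintype c] [DecidableEq c] [Fintype y] [DecidableEq y]

/-! ### Maps acting on a subsystem -/

/-- A linear map that preserves the trace. -/
def IsTracePreserving (N : Matrix k k ℂ →ₗ[ℂ] Matrix k' k' ℂ) : Prop :=
  ∀ ρ, (N ρ).trace = ρ.trace

/-- Conjugation by `U` as a linear map. -/
def conjLin (U : Matrix k k ℂ) : Matrix k k ℂ →ₗ[ℂ] Matrix k k ℂ where
  toFun := conj U
  map_add' ρ σ := by simp [conj, mul_add, add_mul]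
  map_smul' a ρ := by simp [conj]

theorem conjLin_isTracePreserving {U : Matrix k k ℂ} (h : U ∈ unitaryGroup k ℂ) :
    IsTracePreserving (conjLin U) := trace_conj h

theorem applyLocal_apply (e : n ≃ k × l) (e' : n' ≃ k' × l)
    (N : Matrix k k ℂ →ₗ[ℂ] Matrix k' k' ℂ) (ρ : Matrix n n ℂ) (i j : n') :
    applyLocal e e' N ρ i j
      = N (of fun a b => ρ (e.symm (a, (e' i).2)) (e.symm (b, (e' j).2))) (e' i).1 (e' j).1 := rfl

theorem embed_mul_apply (e : n ≃ k × l) (U : Matrix k k ℂ) (X : Matrix n n ℂ) (i j : n) :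
    (embed e U * X) i j = ∑ a, U (e i).1 a * X (e.symm (a, (e i).2)) j := by
  rw [mul_apply, ← e.symm.sum_comp, Fintype.sum_prod_type]
  refine Finset.sum_congr rfl fun a _ => ?_
  rw [Finset.sum_eq_single (e i).2]
  · simp [embed]
  · intro s _ hs; simp [embed, one_apply, hs.symm]
  · simp

/-- Unitary steps become local maps, so they obey the same locality lemmas as the instruments. -/
theorem conj_embed (e : n ≃ k × l) (U : Matrix k k ℂ) (ρ : Matrix n n ℂ) :
    conj (embed e U) ρ = applyLocal e e (conjLin U) ρ := by
  have hr : ∀ X : Matrix n n ℂ, X * (embed e U)ᴴ = (embed e U * Xᴴ)ᴴ := fun X => by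
    rw [conjTranspose_mul, conjTranspose_conjTranspose]
  ext i j
  rw [conj, hr, conjTranspose_apply, embed_mul_apply, applyLocal_apply]
  change _ = (U * (of fun a b => ρ (e.symm (a, (e i).2)) (e.symm (b, (e j).2))) * Uᴴ : Matrix k k ℂ)
    (e i).1 (e j).1
  rw [mul_apply, star_sum]
  refine Finset.sum_congr rfl fun b _ => ?_
  rw [star_mul', conjTranspose_apply, conjTranspose_apply, star_star, embed_mul_apply, mul_apply,
    mul_comm]
  rfl

/-- Complete positivity is phrased with spectators `Fin r`; enumerating l carries it over to an
arbitrary spectator system. -/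
theorem applyLocal_posSemidef (e : n ≃ k × l) (e' : n' ≃ k' × l)
    {N : Matrix k k ℂ →ₗ[ℂ] Matrix k' k' ℂ} (hN : IsCP N) {ρ : Matrix n n ℂ}
    (hρ : ρ.PosSemidef) : (applyLocal e e' N ρ).PosSemidef := by
  let f := Fintype.equivFin l
  have h := hN (Fintype.card l) (ρ.submatrix (fun i => e.symm (i.1, f.symm i.2))
    (fun i => e.symm (i.1, f.symm i.2))) (hρ.submatrix _)
  have h2 := h.submatrix fun i => ((e' i).1, f (e' i).2)
  convert h2 using 1
  ext i j
  simp [applyLocal_apply, submatrix_apply]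

/-- No signalling: N acts separately on the block belonging to each pair of spectator labels, and
the entry of the reduced state at that pair is the trace of the block. -/
theorem marginal_applyLocal_compl (e : n ≃ k × l) (e' : n' ≃ k' × l)
    {N : Matrix k k ℂ →ₗ[ℂ] Matrix k' k' ℂ} (hN : IsTracePreserving N) (ρ : Matrix n n ℂ) :
    marginal (e'.trans (Equiv.prodComm k' l)) (applyLocal e e' N ρ)
      = marginal (e.trans (Equiv.prodComm k l)) ρ := by
  ext i j
  have := hN (of fun a b => ρ (e.symm (a, i)) (e.symm (b, j)))
  simpa [marginal_apply, applyLocal_apply, trace] using this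

theorem trace_applyLocal (e : n ≃ k × l) (e' : n' ≃ k' × l)
    {N : Matrix k k ℂ →ₗ[ℂ] Matrix k' k' ℂ} (hN : IsTracePreserving N) (ρ : Matrix n n ℂ) :
    (applyLocal e e' N ρ).trace = ρ.trace := by
  rw [← trace_marginal (e'.trans (Equiv.prodComm k' l)), marginal_applyLocal_compl e e' hN,
    trace_marginal]

/-- A local trace-preserving map does not change the state of a disjoint subsystem. -/
theorem marginal_applyLocal_of_disjoint (e : n ≃ k × l) (g : l ≃ k₂ × l₂) (f : n ≃ k₂ × l₃)
    (h₁ : ∀ i t, (f ((subEquiv (e.trans (Equiv.prodComm k l)) g).symm (i, t))).1 = i)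
    (h₂ : ∀ i j t, (f ((subEquiv (e.trans (Equiv.prodComm k l)) g).symm (i, t))).2
      = (f ((subEquiv (e.trans (Equiv.prodComm k l)) g).symm (j, t))).2)
    {N : Matrix k k ℂ →ₗ[ℂ] Matrix k k ℂ} (hN : IsTracePreserving N) (ρ : Matrix n n ℂ) :
    marginal f (applyLocal e e N ρ) = marginal f ρ := by
  rw [← marginal_marginal_congr _ g f h₁ h₂, marginal_applyLocal_compl e e hN,
    marginal_marginal_congr _ g f h₁ h₂]

theorem applyLocal_sum {ι : Type*} (s : Finset ι) (e : n ≃ k × l) (e' : n' ≃ k' × l)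
    (N : ι → Matrix k k ℂ →ₗ[ℂ] Matrix k' k' ℂ) (ρ : Matrix n n ℂ) :
    applyLocal e e' (∑ i ∈ s, N i) ρ = ∑ i ∈ s, applyLocal e e' (N i) ρ := by
  ext i j
  simp [applyLocal_apply, Matrix.sum_apply]

theorem applyLocal_one (e : n ≃ k × l) (e' : n' ≃ k' × l)
    (N : Matrix k k ℂ →ₗ[ℂ] Matrix k' k' ℂ) : applyLocal e e' N 1 = embed e' (N 1) := by
  ext i j
  rw [applyLocal_apply, embed, submatrix_apply, kroneckerMap_apply]
  have : (of fun a b => (1 : Matrix n n ℂ) (e.symm (a, (e' i).2)) (e.symm (b, (e' j).2)))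
      = (1 : Matrix l l ℂ) (e' i).2 (e' j).2 • (1 : Matrix k k ℂ) := by
    ext a b
    by_cases h1 : a = b <;> by_cases h2 : (e' i).2 = (e' j).2 <;> simp [one_apply, h1, h2]
  rw [this, map_smul, Matrix.smul_apply, smul_eq_mul, mul_comm]

/-- Tracing out a part of the system on which a local map does not act. -/
theorem marginal_applyLocal (e : n ≃ k × l) (f : n ≃ m × l₂) (e₂ : m ≃ k × l₃)
    (h : l₃ → l₂ → l) (hh : ∀ a t s, f.symm (e₂.symm (a, t), s) = e.symm (a, h t s))
    (N : Matrix k k ℂ →ₗ[ℂ] Matrix k k ℂ) (ρ : Matrix n n ℂ) :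
    marginal f (applyLocal e e N ρ) = applyLocal e₂ e₂ N (marginal f ρ) := by
  ext i j
  obtain ⟨⟨a, t⟩, rfl⟩ := e₂.symm.surjective i
  obtain ⟨⟨b, t'⟩, rfl⟩ := e₂.symm.surjective j
  rw [marginal_apply, applyLocal_apply]
  simp only [applyLocal_apply, hh, Equiv.apply_symm_apply]
  have : (of fun a b => marginal f ρ (e₂.symm (a, t)) (e₂.symm (b, t')))
      = ∑ s, of fun a b => ρ (e.symm (a, h t s)) (e.symm (b, h t' s)) := by
    ext a b; simp [marginal_apply, hh, Matrix.sum_apply]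
  rw [this, map_sum, Matrix.sum_apply]

/-- Local maps act on one factor of a product. -/
theorem applyLocal_factor (e : n ≃ k × l) (e₂ : m ≃ k × l₂) (π : n → m) (γ : n → c)
    (h₁ : ∀ a u, π (e.symm (a, (e u).2)) = e₂.symm (a, (e₂ (π u)).2))
    (h₂ : ∀ u, (e₂ (π u)).1 = (e u).1) (h₃ : ∀ a u, γ (e.symm (a, (e u).2)) = γ u)
    (N : Matrix k k ℂ →ₗ[ℂ] Matrix k k ℂ) (ω : Matrix m m ℂ) (τ : Matrix c c ℂ) :
    applyLocal e e N (of fun i j => ω (π i) (π j) * τ (γ i) (γ j))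
      = of fun i j => applyLocal e₂ e₂ N ω (π i) (π j) * τ (γ i) (γ j) := by
  ext i j
  rw [applyLocal_apply, of_apply, applyLocal_apply]
  have : (of fun a b => (of fun i j => ω (π i) (π j) * τ (γ i) (γ j) : Matrix n n ℂ)
        (e.symm (a, (e i).2)) (e.symm (b, (e j).2)))
      = τ (γ i) (γ j) • of fun a b => ω (e₂.symm (a, (e₂ (π i)).2)) (e₂.symm (b, (e₂ (π j)).2)) := by
    ext a b; simp [h₁, h₃, mul_comm]
  rw [this, map_smul, Matrix.smul_apply, smul_eq_mul, mul_comm, h₂, h₂]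

theorem applyLocal_recordMap (e : n ≃ k × l) (e' : n × y ≃ (k × y) × l)
    (he : ∀ i z, e' (i, z) = (((e i).1, z), (e i).2))
    (N : y → Matrix k k ℂ →ₗ[ℂ] Matrix k k ℂ) (ρ : Matrix n n ℂ) :
    applyLocal e e' (recordMap N) ρ = ∑ z, applyLocal e e (N z) ρ ⊗ₖ proj z := by
  ext ⟨i, z⟩ ⟨j, z'⟩
  simp [applyLocal_apply, recordMap, Matrix.sum_apply, he]

theorem recordMap_isTracePreserving {N : y → Matrix k k ℂ →ₗ[ℂ] Matrix k k ℂ}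
    (hN : IsInstrument N) : IsTracePreserving (recordMap N) := by
  intro ρ
  rw [← hN.trace_sum ρ]
  simp [recordMap, trace_sum, trace_kronecker, trace_proj]

theorem sum_isTracePreserving {N : y → Matrix k k ℂ →ₗ[ℂ] Matrix k k ℂ}
    (hN : IsInstrument N) : IsTracePreserving (∑ z, N z) := fun ρ => by
  rw [← hN.trace_sum ρ, LinearMap.sum_apply]

/-! ### Subunital maps -/

theorem trace_mul_re_nonneg {ρ σ : Matrix n n ℂ} (hρ : ρ.PosSemidef) (hσ : σ.PosSemidef) :
    0 ≤ (ρ * σ).trace.re := by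
  obtain ⟨U, d, hd, h0⟩ := exists_diagonalizes_nonneg hσ
  have := hd.expect_eq ρ
  rw [expect] at this
  rw [this]
  exact Finset.sum_nonneg fun j _ => mul_nonneg (diag_conj_re_nonneg hρ U j) (h0 j)

/-- The extended map sends 1 to N(1) ⊗ 1, so the efficacy is the expectation of N(1) in the reduced
output state, and N(1) ≤ 1. -/
theorem efficacy_applyLocal_le_one (e : n ≃ k × l) (e' : n' ≃ k' × l)
    {N : Matrix k k ℂ →ₗ[ℂ] Matrix k' k' ℂ} (hN : IsSubunital N) (htp : IsTracePreserving N)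
    {ρ : Matrix n n ℂ} (hpos : (applyLocal e e' N ρ).PosSemidef) (h1 : ρ.trace = 1) :
    efficacy (applyLocal e e' N) ρ ≤ 1 := by
  have h := trace_mul_re_nonneg (marginal_posSemidef e' hpos) hN
  rw [mul_sub, mul_one, trace_sub, trace_marginal, trace_applyLocal e e' htp, h1,
    ← trace_mul_embed, ← applyLocal_one e e', Complex.sub_re, Complex.one_re] at h
  rw [efficacy_eq]; linarith

/-- The two conditions are positivity of the two Schur complements of the block matrix with unit
diagonal blocks and off-diagonal blocks K, K†, each equivalent to positivity of the whole. -/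
theorem posSemidef_one_sub_mul_conjTranspose {K : Matrix k k ℂ} (h : (1 - Kᴴ * K).PosSemidef) :
    (1 - K * Kᴴ).PosSemidef := by
  let := invertibleOne (α := Matrix k k ℂ)
  have h1 := (PosDef.fromBlocks₁₁ (A := (1 : Matrix k k ℂ)) K 1 PosDef.one).2 (by simpa using h)
  have h2 := (PosDef.fromBlocks₂₂ (1 : Matrix k k ℂ) K (D := 1) PosDef.one).1 h1
  simpa using h2

theorem posSemidef_of_trace_mul_nonneg {B : Matrix k k ℂ} (hB : B.IsHermitian)
    (h : ∀ ρ : Matrix k k ℂ, ρ.PosSemidef → 0 ≤ (ρ * B).trace.re) : B.PosSemidef := by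
  refine PosSemidef.of_dotProduct_mulVec_nonneg hB fun x => ?_
  have h1 := h _ (posSemidef_vecMulVec_self_star x)
  rw [vecMulVec_mul, trace_vecMulVec, dotProduct_comm, ← dotProduct_mulVec] at h1
  rw [Complex.le_def]
  refine ⟨h1, ?_⟩
  have := hB.im_star_dotProduct_mulVec_self x
  simpa using this.symm

/-- Trace non-increase gives K†K ≤ 1 for each outcome, hence KK† ≤ 1. The record is essential: the
operators KK† sit in orthogonal blocks of the register and are bounded one at a time, whereas their
unrecorded sum may exceed 1. -/
theorem isSubunital_recordMap_of_isEfficient {N : y → Matrix k k ℂ →ₗ[ℂ] Matrix k k ℂ}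
    (hN : IsInstrument N) (he : IsEfficient N) : IsSubunital (recordMap N) := by
  choose K hK using he
  have h1 : ∀ z, (1 - K z * (K z)ᴴ).PosSemidef := by
    intro z
    refine posSemidef_one_sub_mul_conjTranspose (posSemidef_of_trace_mul_nonneg ?_ fun ρ hρ => ?_)
    · exact isHermitian_one.sub (isHermitian_conjTranspose_mul_self _)
    · have := hN.trace_le z ρ hρ
      rw [hK, trace_mul_comm, ← mul_assoc, trace_mul_comm] at this
      rw [mul_sub, mul_one, trace_sub, Complex.sub_re]; linarith
  have h2 : (1 : Matrix (k × y) (k × y) ℂ) - recordMap N 1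
      = ∑ z, (1 - K z * (K z)ᴴ) ⊗ₖ proj z := by
    have : (1 : Matrix (k × y) (k × y) ℂ) = ∑ z : y, (1 : Matrix k k ℂ) ⊗ₖ proj z := by
      rw [← one_kronecker_one, ← sum_proj (n := y)]
      ext i j; simp only [kroneckerMap_apply, Matrix.sum_apply, Finset.mul_sum]
    rw [this]
    simp only [recordMap, LinearMap.coe_mk, AddHom.coe_mk, hK, mul_one]
    rw [← Finset.sum_sub_distrib]
    refine Finset.sum_congr rfl fun z _ => ?_
    ext i j; simp [sub_mul]
  rw [IsSubunital, h2]
  exact posSemidef_sum _ fun z _ => (h1 z).kronecker (proj_posSemidef z)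

end LocalMaps

/-! ### Classical-quantum states -/

section ClassicalQuantum

set_option linter.unusedSectionVars false

variable {N n m a k k' l l' : Type*} [Fintype N] [DecidableEq N] [Fintype n] [DecidableEq n]
  [Fintype m] [DecidableEq m] [Fintype a] [DecidableEq a]
  [Fintype k] [DecidableEq k] [Fintype k'] [DecidableEq k'] [Fintype l] [DecidableEq l]
  [Fintype l'] [DecidableEq l']

/-- `ρ` is a density operator. -/
structure IsState (ρ : Matrix n n ℂ) : Prop where
  pos : ρ.PosSemidef
  trace : ρ.trace = 1

theorem IsState.marginal {ρ : Matrix n n ℂ} (h : IsState ρ) (e : n ≃ k × l) :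
    IsState (marginal e ρ) :=
  ⟨marginal_posSemidef e h.pos, by rw [trace_marginal, h.trace]⟩

theorem IsState.conj {ρ U : Matrix n n ℂ} (h : IsState ρ) (hU : U ∈ unitaryGroup n ℂ) :
    IsState (conj U ρ) :=
  ⟨conj_posSemidef h.pos U, by rw [trace_conj hU, h.trace]⟩

theorem IsState.kronecker {ρ : Matrix n n ℂ} {σ : Matrix m m ℂ} (h : IsState ρ) (h' : IsState σ) :
    IsState (ρ ⊗ₖ σ) :=
  ⟨h.pos.kronecker h'.pos, by rw [trace_kronecker, h.trace, h'.trace, one_mul]⟩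

theorem isState_proj (x : n) : IsState (proj x : Matrix n n ℂ) :=
  ⟨proj_posSemidef x, trace_proj x⟩

theorem isState_gibbs [Nonempty n] (β : ℝ) {H : Matrix n n ℂ} (h : H.IsHermitian) :
    IsState (gibbs β H) := ⟨gibbs_posSemidef β h, trace_gibbs β h⟩

theorem IsState.entropy_kronecker {ρ : Matrix n n ℂ} {σ : Matrix m m ℂ} (h : IsState ρ)
    (h' : IsState σ) : entropy (ρ ⊗ₖ σ) = entropy ρ + entropy σ := by
  rw [QEC.entropy_kronecker h.pos.isHermitian h'.pos.isHermitian, h.trace, h'.trace]; simp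

theorem IsState.entropy_unit {ρ : Matrix Unit Unit ℂ} (h : IsState ρ) : entropy ρ = 0 := by
  have : ρ = proj () := by
    ext i j
    have := h.trace
    simpa [Matrix.trace, proj] using this
  rw [this, entropy_proj]

/-- In the presentation `e`, the operator `σ` is `∑ x, p x • ω x ⊗ |x⟩⟨x|`. -/
def IsCQ (e : N ≃ n × a) (p : a → ℝ) (ω : a → Matrix n n ℂ) (σ : Matrix N N ℂ) : Prop :=
  ∀ i x j x', σ (e.symm (i, x)) (e.symm (j, x')) = if x = x' then (p x : ℂ) * ω x i j else 0

namespace IsCQ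

variable {e : N ≃ n × a} {p : a → ℝ} {ω : a → Matrix n n ℂ} {σ : Matrix N N ℂ}

/-- The blocks are the operators p x • ω x, and scaling a normalized block by p x contributes one
Shannon term and p x times its own entropy. -/
theorem entropy_eq (h : IsCQ e p ω σ) (hω : ∀ x, IsState (ω x)) :
    entropy σ = ∑ x, Real.negMulLog (p x) + ∑ x, p x * entropy (ω x) := by
  have hh : ∀ x, ((p x : ℂ) • ω x).IsHermitian := fun x => by
    have := (hω x).pos.isHermitian
    rw [IsHermitian] at this ⊢
    rw [conjTranspose_smul, this]; simp
  rw [entropy_of_blocks e (B := fun x => (p x : ℂ) • ω x) hh fun i x j x' => by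
    rw [h i x j x']; simp, ← Finset.sum_add_distrib]
  refine Finset.sum_congr rfl fun x _ => ?_
  rw [entropy_smul _ (hω x).pos.isHermitian, (hω x).trace, Complex.one_re]; ring

theorem posSemidef (h : IsCQ e p ω σ) (hp : ∀ x, 0 ≤ p x) (hω : ∀ x, (ω x).PosSemidef) :
    σ.PosSemidef := by
  have : σ = (∑ x, (p x : ℂ) • (ω x ⊗ₖ proj x)).submatrix e e := by
    ext i j
    have := h (e i).1 (e i).2 (e j).1 (e j).2
    simp only [Prod.mk.eta, Equiv.symm_apply_apply] at this
    rw [this, submatrix_apply, Matrix.sum_apply, Finset.sum_eq_single (e i).2]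
    · by_cases hx : (e i).2 = (e j).2 <;> simp [proj, hx]
    · intro b _ hb; simp [proj, hb]
    · simp
  rw [this]
  refine (posSemidef_sum _ fun x _ => ?_).submatrix _
  exact ((hω x).kronecker (proj_posSemidef x)).smul (by exact_mod_cast hp x)

/-- Discarding a part of the quantum system. -/
theorem marginal (h : IsCQ e p ω σ) (f : N ≃ k × l) (g : n ≃ k' × l') (e' : k ≃ k' × a)
    (h₁ : ∀ i x t, f (e.symm (g.symm (i, t), x)) = (e'.symm (i, x), (f (e.symm (g.symm (i, t), x))).2))
    (h₂ : ∀ i x j x' t, (f (e.symm (g.symm (i, t), x))).2 = (f (e.symm (g.symm (j, t), x'))).2) :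
    IsCQ e' p (fun x => QEC.marginal g (ω x)) (QEC.marginal f σ) := by
  -- This presentation keeps the remaining quantum part together with the register; `h₁` and `h₂`
  -- say that it shows the same subsystem as f.
  let e₄ : N ≃ (k' × a) × l' := (e.trans (g.prodCongr (Equiv.refl a))).trans
    ⟨fun u => ((u.1.1, u.2), u.1.2), fun u => ((u.1.1, u.2), u.1.2), fun _ => rfl, fun _ => rfl⟩
  have hm := marginal_congr e₄ f e'.symm
    (fun i t => congrArg Prod.fst (h₁ i.1 i.2 t))
    (fun i j t => h₂ i.1 i.2 j.1 j.2 t) σ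
  intro i x j x'
  have h3 := congrFun (congrFun hm (i, x)) (j, x')
  rw [submatrix_apply] at h3
  rw [← h3, marginal_apply]
  have h4 : ∀ t, σ (e₄.symm ((i, x), t)) (e₄.symm ((j, x'), t))
      = if x = x' then (p x : ℂ) * ω x (g.symm (i, t)) (g.symm (j, t)) else 0 :=
    fun t => h _ _ _ _
  simp only [h4]
  split_ifs
  · rw [marginal_apply, Finset.mul_sum]
  · simp

/-- Discarding a part of the quantum system and the classical register. -/
theorem marginal_eq_sum (h : IsCQ e p ω σ) (f : N ≃ k × l) (g : n ≃ k × l')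
    (h₁ : ∀ i x t, (f (e.symm (g.symm (i, t), x))).1 = i)
    (h₂ : ∀ i j x t, (f (e.symm (g.symm (i, t), x))).2 = (f (e.symm (g.symm (j, t), x))).2) :
    QEC.marginal f σ = ∑ x, (p x : ℂ) • QEC.marginal g (ω x) := by
  let e₄ : N ≃ k × (l' × a) := (e.trans (g.prodCongr (Equiv.refl a))).trans
    (Equiv.prodAssoc _ _ _)
  have hm := marginal_congr_left e₄ f (fun i t => h₁ i t.2 t.1) (fun i j t => h₂ i j t.2 t.1) σ
  rw [← hm]
  ext i j
  rw [marginal_apply, Fintype.sum_prod_type_right, Matrix.sum_apply]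
  refine Finset.sum_congr rfl fun x _ => ?_
  rw [Matrix.smul_apply, marginal_apply, smul_eq_mul, Finset.mul_sum]
  refine Finset.sum_congr rfl fun t _ => ?_
  exact (h _ _ _ _).trans (if_pos rfl)

end IsCQ

end ClassicalQuantum

/-! ### Classical registers, recorded outcomes and pure states -/

section Helpers

set_option linter.unusedSectionVars false

variable {N n a k k' l l' y : Type*} [Fintype N] [DecidableEq N] [Fintype n] [DecidableEq n]
  [Fintype a] [DecidableEq a] [Fintype k] [DecidableEq k] [Fintype k'] [DecidableEq k']
  [Fintype l] [DecidableEq l] [Fintype l'] [DecidableEq l'] [Fintype y] [DecidableEq y]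

theorem IsCQ.entropy_marginal {e : N ≃ n × a} {p : a → ℝ} {ω : a → Matrix n n ℂ}
    {σ : Matrix N N ℂ} (h : IsCQ e p ω σ) (hω : ∀ x, IsState (ω x)) (f : N ≃ k × l)
    (g : n ≃ k' × l') (e' : k ≃ k' × a)
    (h₁ : ∀ i x t,
      f (e.symm (g.symm (i, t), x)) = (e'.symm (i, x), (f (e.symm (g.symm (i, t), x))).2))
    (h₂ : ∀ i x j x' t,
      (f (e.symm (g.symm (i, t), x))).2 = (f (e.symm (g.symm (j, t), x'))).2) :
    entropy (QEC.marginal f σ)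
      = ∑ x, Real.negMulLog (p x) + ∑ x, p x * entropy (QEC.marginal g (ω x)) :=
  (h.marginal f g e' h₁ h₂).entropy_eq fun x => (hω x).marginal g

/-- The entropy of the classical register of a classical-quantum state. -/
theorem IsCQ.entropy_marginal_register {e : N ≃ n × a} {p : a → ℝ} {ω : a → Matrix n n ℂ}
    {σ : Matrix N N ℂ} (h : IsCQ e p ω σ) (hω : ∀ x, IsState (ω x)) (f : N ≃ a × l)
    (h₁ : ∀ i x, f (e.symm (i, x)) = (x, (f (e.symm (i, x))).2))
    (h₂ : ∀ i x x', (f (e.symm (i, x))).2 = (f (e.symm (i, x'))).2) :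
    entropy (QEC.marginal f σ) = ∑ x, Real.negMulLog (p x) := by
  -- Keeping only the register amounts to keeping a one-dimensional quantum part, whose states have
  -- zero entropy.
  rw [h.entropy_marginal hω f (Equiv.punitProd.{0} n).symm (Equiv.punitProd.{0} a).symm
    (fun _ x t => h₁ t x) (fun _ x _ x' t => h₂ t x x')]
  simp only [fun x => ((hω x).marginal (Equiv.punitProd.{0} n).symm).entropy_unit, mul_zero,
    Finset.sum_const_zero, add_zero]

theorem isCQ_of_eq (e : N ≃ n × a) (p : a → ℝ) (ω : a → Matrix n n ℂ) {σ : Matrix N N ℂ}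
    (h : ∀ i j, σ i j = ∑ x, (p x : ℂ) * (ω x (e i).1 (e j).1 * proj x (e i).2 (e j).2)) :
    IsCQ e p ω σ := by
  intro i x j x'
  rw [h, Finset.sum_eq_single x]
  · by_cases hx : x = x' <;> simp [proj, hx]
  · intro b _ hb; simp [proj, hb]
  · simp

/-- The state `∑ z, ω z ⊗ |z⟩⟨z|`. -/
def record (ω : y → Matrix n n ℂ) : Matrix (n × y) (n × y) ℂ := ∑ z, ω z ⊗ₖ proj z

theorem record_posSemidef {ω : y → Matrix n n ℂ} (h : ∀ z, (ω z).PosSemidef) :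
    (record ω).PosSemidef :=
  posSemidef_sum _ fun z _ => (h z).kronecker (proj_posSemidef z)

theorem trace_record (ω : y → Matrix n n ℂ) : (record ω).trace = ∑ z, (ω z).trace := by
  simp [record, trace_sum, trace_kronecker, trace_proj]

theorem marginal_record (ω : y → Matrix n n ℂ) :
    marginal (Equiv.refl _) (record ω) = ∑ z, ω z := by
  rw [record, marginal_sum]
  simp [marginal_kronecker_left, trace_proj]

theorem marginal_record_right (ω : y → Matrix n n ℂ) :
    marginal (Equiv.prodComm n y) (record ω) = ∑ z, (ω z).trace • proj z := by
  rw [record, marginal_sum]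
  simp [marginal_kronecker_right]

theorem entropy_record {ω : y → Matrix n n ℂ} (h : ∀ z, (ω z).PosSemidef) :
    entropy (record ω) = ∑ z, entropy (ω z) := by
  refine entropy_of_blocks (Equiv.refl _) (fun z => (h z).isHermitian) fun i z j z' => ?_
  rw [record, Matrix.sum_apply, Finset.sum_eq_single z]
  · by_cases hz : z = z' <;> simp [proj, hz]
  · intro b _ hb; simp [proj, hb]
  · simp

theorem entropy_eq_zero_of_idempotent {ρ : Matrix n n ℂ} (h : ρ.IsHermitian) (h2 : ρ * ρ = ρ) :
    entropy ρ = 0 := by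
  have hd := exists_diagonalizes h
  rw [hd.entropy_eq]
  refine Finset.sum_eq_zero fun i _ => ?_
  have hc := hd.conj_conjTranspose
  have h3 : (diagonal fun i => (h.eigenvalues i : ℂ)) * (diagonal fun i => (h.eigenvalues i : ℂ))
      = diagonal fun i => (h.eigenvalues i : ℂ) := by
    rw [← hc]
    calc _ = (h.eigenvectorUnitary : Matrix n n ℂ)ᴴ * ρ
          * ((h.eigenvectorUnitary : Matrix n n ℂ) * (h.eigenvectorUnitary : Matrix n n ℂ)ᴴ)
          * ρ * (h.eigenvectorUnitary : Matrix n n ℂ) := by simp only [mul_assoc]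
      _ = (h.eigenvectorUnitary : Matrix n n ℂ)ᴴ * (ρ * ρ)
          * (h.eigenvectorUnitary : Matrix n n ℂ) := by
        rw [hd.right, mul_one]; simp only [mul_assoc]
      _ = _ := by rw [h2]
  rw [diagonal_mul_diagonal] at h3
  have h4 := congrFun (congrFun h3 i) i
  rw [diagonal_apply_eq, diagonal_apply_eq] at h4
  have h5 : h.eigenvalues i * h.eigenvalues i = h.eigenvalues i := by exact_mod_cast h4
  rcases mul_eq_zero.1 (show h.eigenvalues i * (h.eigenvalues i - 1) = 0 by linarith) with h6 | h6
  · simp [h6]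
  · simp [sub_eq_zero.1 h6]

theorem vecMulVec_mul_self {v : n → ℂ} (hv : star v ⬝ᵥ v = 1) :
    vecMulVec v (star v) * vecMulVec v (star v) = vecMulVec v (star v) := by
  rw [vecMulVec_mul_vecMulVec, hv, one_smul]

theorem isState_vecMulVec {v : n → ℂ} (hv : star v ⬝ᵥ v = 1) :
    IsState (vecMulVec v (star v)) :=
  ⟨posSemidef_vecMulVec_self_star v, by rw [trace_vecMulVec, dotProduct_comm, hv]⟩

open scoped MatrixOrder Matrix.Norms.L2Operator in
theorem exists_eq_conjTranspose_mul_self {ρ : Matrix n n ℂ} (h : ρ.PosSemidef) :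
    ∃ B : Matrix n n ℂ, ρ = Bᴴ * B :=
  CStarAlgebra.nonneg_iff_eq_star_mul_self.mp h.nonneg

/-- A state with unit fidelity to a pure state is that pure state. -/
theorem IsState.eq_of_fidelity {ρ : Matrix n n ℂ} (h : IsState ρ) {v : n → ℂ}
    (hv : star v ⬝ᵥ v = 1) (hF : (star v ⬝ᵥ (ρ *ᵥ v)).re = 1) :
    ρ = vecMulVec v (star v) := by
  set P := vecMulVec v (star v) with hP
  have hPP : P * P = P := vecMulVec_mul_self hv
  have hPh : Pᴴ = P := (posSemidef_vecMulVec_self_star v).isHermitian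
  have hf : star v ⬝ᵥ (ρ *ᵥ v) = 1 := by
    refine Complex.ext hF ?_
    simpa using h.pos.isHermitian.im_star_dotProduct_mulVec_self v
  have hPρP : P * ρ * P = P := by
    rw [hP, vecMulVec_mul, vecMulVec_mul_vecMulVec, ← dotProduct_mulVec, hf, one_smul]
  obtain ⟨B, hB⟩ := exists_eq_conjTranspose_mul_self h.pos
  -- The fidelity already exhausts the trace. With ρ = B†B this trace is the squared Hilbert–Schmidt
  -- norm of B(1 - P), so ρ vanishes on the complement of v.
  have htr : ((1 - P) * ρ * (1 - P)).trace = 0 := by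
    have : ((1 - P) * ρ * (1 - P)).trace = ρ.trace - (P * ρ * P).trace := by
      have e1 : (1 - P) * (1 - P) = 1 - P := by
        rw [mul_sub, mul_one, sub_mul, one_mul, hPP]; simp
      rw [mul_assoc, trace_mul_comm, mul_assoc, e1, mul_sub, mul_one, trace_sub]
      congr 1
      rw [mul_assoc P ρ P, trace_mul_comm P, mul_assoc, hPP]
    rw [this, hPρP, h.trace, (isState_vecMulVec hv).trace, sub_self]
  have hBP : B * (1 - P) = 0 := by
    rw [← trace_conjTranspose_mul_self_eq_zero_iff, ← htr, hB, conjTranspose_mul,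
      conjTranspose_sub, hPh, conjTranspose_one]
    simp only [mul_assoc]
  have h1 : ρ = ρ * P := by
    have : ρ * (1 - P) = 0 := by rw [hB, mul_assoc, hBP, mul_zero]
    rw [mul_sub, mul_one, sub_eq_zero] at this; exact this
  have h2 : ρ = P * ρ := by
    have := congrArg conjTranspose h1
    rwa [conjTranspose_mul, hPh, h.pos.isHermitian] at this
  calc ρ = P * ρ := h2
    _ = P * (ρ * P) := by rw [← h1]
    _ = P := by rw [← mul_assoc, hPρP]

end Helpers

namespace Engine

set_option linter.unusedSectionVars false

variable {R S A H C M Y : Type*}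
    [Fintype R] [DecidableEq R] [Fintype S] [DecidableEq S] [Fintype A] [DecidableEq A]
    [Fintype H] [DecidableEq H] [Fintype C] [DecidableEq C] [Fintype M] [DecidableEq M]
    [Fintype Y] [DecidableEq Y]

/-! ### Subsystems of `E`, `EY` and `EYM` -/

/-- `S` inside `E`. -/
def eS : EIdx R S A H C ≃ S × (R × A × H × C) :=
  ⟨fun i => (i.2.1, i.1, i.2.2.1, i.2.2.2.1, i.2.2.2.2),
   fun j => (j.2.1, j.1, j.2.2.1, j.2.2.2.1, j.2.2.2.2), fun _ => rfl, fun _ => rfl⟩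

/-- `B_h` inside `E`. -/
def eH : EIdx R S A H C ≃ H × (R × S × A × C) :=
  ⟨fun i => (i.2.2.2.1, i.1, i.2.1, i.2.2.1, i.2.2.2.2),
   fun j => (j.2.1, j.2.2.1, j.2.2.2.1, j.1, j.2.2.2.2), fun _ => rfl, fun _ => rfl⟩

/-- `B_c` inside `E`. -/
def eC : EIdx R S A H C ≃ C × (R × S × A × H) :=
  ⟨fun i => (i.2.2.2.2, i.1, i.2.1, i.2.2.1, i.2.2.2.1),
   fun j => (j.2.1, j.2.2.1, j.2.2.2.1, j.2.2.2.2, j.1), fun _ => rfl, fun _ => rfl⟩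

/-- `RS` inside `E`. -/
def eRS : EIdx R S A H C ≃ (R × S) × (A × H × C) := (Equiv.prodAssoc R S (A × H × C)).symm

/-- `E` and `A` inside `EXY`, with `X` as classical register. -/
def eXY : EIdx R S A H C × A × Y ≃ (EIdx R S A H C × Y) × A :=
  ⟨fun i => ((i.1, i.2.2), i.2.1), fun j => (j.1.1, j.2, j.1.2), fun _ => rfl, fun _ => rfl⟩

/-- `RSAY` inside `EY`. -/
def eRSAY : EIdx R S A H C × Y ≃ ((R × S × A) × Y) × (H × C) :=
  ⟨fun i => (((i.1.1, i.1.2.1, i.1.2.2.1), i.2), i.1.2.2.2.1, i.1.2.2.2.2),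
   fun j => ((j.1.1.1, j.1.1.2.1, j.1.1.2.2, j.2.1, j.2.2), j.1.2), fun _ => rfl, fun _ => rfl⟩

/-- `RSA` inside `E`. -/
def eRSA : EIdx R S A H C ≃ (R × S × A) × (H × C) :=
  ⟨fun i => ((i.1, i.2.1, i.2.2.1), i.2.2.2.1, i.2.2.2.2),
   fun j => (j.1.1, j.1.2.1, j.1.2.2, j.2.1, j.2.2), fun _ => rfl, fun _ => rfl⟩

/-- `M` inside `EYM`. -/
def mM : EIdx R S A H C × Y × M ≃ M × (EIdx R S A H C × Y) :=
  ⟨fun i => (i.2.2, i.1, i.2.1), fun j => (j.2.1, j.2.2, j.1), fun _ => rfl, fun _ => rfl⟩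

/-- `Y` inside `EYM`. -/
def mY : EIdx R S A H C × Y × M ≃ Y × (EIdx R S A H C × M) :=
  ⟨fun i => (i.2.1, i.1, i.2.2), fun j => (j.2.1, j.1, j.2.2), fun _ => rfl, fun _ => rfl⟩

/-- `YM` inside `EYM`. -/
def mYM : EIdx R S A H C × Y × M ≃ (Y × M) × EIdx R S A H C := Equiv.prodComm _ _

/-- `EY` inside `EYM`. -/
def mEY : EIdx R S A H C × Y × M ≃ (EIdx R S A H C × Y) × M := (Equiv.prodAssoc _ _ _).symm

/-- `RSAYM` inside `EYM`. -/
def mRSAYM : EIdx R S A H C × Y × M ≃ ((R × S × A) × Y × M) × (H × C) :=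
  ⟨fun i => (((i.1.1, i.1.2.1, i.1.2.2.1), i.2), i.1.2.2.2.1, i.1.2.2.2.2),
   fun j => ((j.1.1.1, j.1.1.2.1, j.1.1.2.2, j.2.1, j.2.2), j.1.2), fun _ => rfl, fun _ => rfl⟩

/-- `SAYM` inside `RSAYM`. -/
def rSAYM : (R × S × A) × Y × M ≃ ((S × A) × Y × M) × R :=
  ⟨fun i => ((i.1.2, i.2), i.1.1), fun j => ((j.2, j.1.1), j.1.2), fun _ => rfl, fun _ => rfl⟩

/-- `RSAY` inside `EYM`. -/
def mRSAY : EIdx R S A H C × Y × M ≃ ((R × S × A) × Y) × (H × C × M) :=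
  ⟨fun i => (((i.1.1, i.1.2.1, i.1.2.2.1), i.2.1), i.1.2.2.2.1, i.1.2.2.2.2, i.2.2),
   fun j => ((j.1.1.1, j.1.1.2.1, j.1.1.2.2, j.2.1, j.2.2.1), j.1.2, j.2.2.2),
   fun _ => rfl, fun _ => rfl⟩

variable (Q : Engine R S A H C M Y)

/-! ### The initial state -/

theorem nonempty_A (Q : Engine R S A H C M Y) : Nonempty A := ⟨Q.x₀⟩

theorem hamA_isHermitian : Q.hamA.IsHermitian := by
  rw [hamA, IsHermitian, diagonal_conjTranspose]
  congr 1; ext i; simp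

theorem isState_tauA : IsState Q.tauA :=
  have := Q.nonempty_A
  isState_gibbs _ Q.hamA_isHermitian

theorem isState_tauH [Nonempty H] : IsState Q.tauH := isState_gibbs _ Q.hamH_herm
theorem isState_tauC [Nonempty C] : IsState Q.tauC := isState_gibbs _ Q.hamC_herm
theorem isState_tauM [Nonempty M] : IsState Q.tauM := isState_gibbs _ Q.hamM_herm
theorem isState_psiState : IsState Q.psiState := isState_vecMulVec Q.psi_unit

theorem entropy_psiState : entropy Q.psiState = 0 :=
  entropy_eq_zero_of_idempotent Q.isState_psiState.pos.isHermitian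
    (vecMulVec_mul_self Q.psi_unit)

theorem tauA_eq : Q.tauA = diagonal fun a => (Q.pX a : ℂ) := by
  have h := ((Diagonalizes.of_diagonal Q.energyA).gibbs (1 / (Q.kB * Q.Tc))).eq
  rw [conjTranspose_one, mul_one, one_mul] at h
  rw [tauA, hamA, h]
  have : ∀ a, -(1 / (Q.kB * Q.Tc)) * Q.energyA a = -Q.energyA a / (Q.kB * Q.Tc) :=
    fun a => by ring
  simp only [pX, this]

theorem tauA_eq_sum : Q.tauA = ∑ x, (Q.pX x : ℂ) • (proj x : Matrix A A ℂ) := by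
  rw [sum_smul_proj, tauA_eq]

theorem pX_pos (x : A) : 0 < Q.pX x :=
  have := Q.nonempty_A
  div_pos (Real.exp_pos _) (sum_exp_pos _)

theorem sum_pX : ∑ x, Q.pX x = 1 := by
  have h := Q.isState_tauA.trace
  rw [tauA_eq, trace_diagonal] at h
  exact_mod_cast h

theorem entropy_tauA : entropy Q.tauA = ∑ x, Real.negMulLog (Q.pX x) := by
  rw [tauA_eq, entropy_diagonal]

/-- The state `ψ ⊗ ω ⊗ τ_h ⊗ τ_c`. -/
def prodState (ω : Matrix A A ℂ) : Matrix (EIdx R S A H C) (EIdx R S A H C) ℂ :=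
  (Q.psiState ⊗ₖ (ω ⊗ₖ (Q.tauH ⊗ₖ Q.tauC))).submatrix
    (Equiv.prodAssoc R S (A × H × C)).symm (Equiv.prodAssoc R S (A × H × C)).symm

/-- The Gibbs state of A is diagonal in the measured basis with entries p(x) > 0, so the projection
only produces a factor p(x), which the normalization cancels. -/
theorem rho0_eq (x : A) : Q.rho0 x = Q.prodState (proj x) := by
  have hc : embed eA (proj x) * Q.rhoI * embed eA (proj x)
      = conj (embed eA (proj x)) (Q.rhoI) := by
    rw [conj, embed_conjTranspose, (proj_posSemidef x).isHermitian]
  rw [rho0, hc, conj_embed]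
  ext i j
  rw [Matrix.smul_apply, applyLocal_apply]
  change _ • (proj x * _ * (proj x)ᴴ : Matrix A A ℂ) i.2.2.1 j.2.2.1 = _
  have hb : ∀ X : Matrix A A ℂ, proj x * X * (proj x)ᴴ = single x x (X x x) := fun X => by
    rw [(proj_posSemidef x).isHermitian, proj, single_mul_mul_single, one_mul, mul_one]
  have hp : (Q.pX x : ℂ) ≠ 0 := by exact_mod_cast (Q.pX_pos x).ne'
  have hr : ∀ i j : EIdx R S A H C, Q.rhoI i j = Q.psiState (i.1, i.2.1) (j.1, j.2.1)
    * (Q.tauA i.2.2.1 j.2.2.1 * (Q.tauH i.2.2.2.1 j.2.2.2.1 * Q.tauC i.2.2.2.2 j.2.2.2.2)) :=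
    fun _ _ => rfl
  have hr' : Q.prodState (proj x) i j = Q.psiState (i.1, i.2.1) (j.1, j.2.1)
    * ((proj x : Matrix A A ℂ) i.2.2.1 j.2.2.1
      * (Q.tauH i.2.2.2.1 j.2.2.2.1 * Q.tauC i.2.2.2.2 j.2.2.2.2)) := rfl
  rw [hr', hb, of_apply, hr]
  by_cases h1 : x = i.2.2.1 <;> by_cases h2 : x = j.2.2.1
  · simp only [proj, single_apply, ← h1, ← h2, tauA_eq, eA, Equiv.coe_fn_symm_mk, Equiv.coe_fn_mk,
      diagonal_apply_eq]
    simp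
    field_simp
  all_goals
    rw [proj, single_apply, single_apply, if_neg (by tauto), if_neg (by tauto)]
    simp

theorem isState_prodState [Nonempty H] [Nonempty C] {ω : Matrix A A ℂ} (h : IsState ω) :
    IsState (Q.prodState ω) := by
  have h1 := Q.isState_psiState.kronecker (h.kronecker (Q.isState_tauH.kronecker Q.isState_tauC))
  refine ⟨h1.pos.submatrix _, ?_⟩
  rw [← h1.trace, ← trace_marginal (Equiv.refl ((R × S) × A × H × C)),
    ← trace_marginal (eRS (R := R) (S := S) (A := A) (H := H) (C := C))]
  rfl

theorem entropy_prodState [Nonempty H] [Nonempty C] {ω : Matrix A A ℂ} (h : IsState ω) :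
    entropy (Q.prodState ω) = entropy ω + entropy Q.tauH + entropy Q.tauC := by
  have h3 := Q.isState_tauH.kronecker Q.isState_tauC
  have h2 := h.kronecker h3
  have h1 := Q.isState_psiState.kronecker h2
  rw [prodState, entropy_submatrix _ h1.pos.isHermitian, Q.isState_psiState.entropy_kronecker h2,
    h.entropy_kronecker h3, Q.isState_tauH.entropy_kronecker Q.isState_tauC, entropy_psiState]
  ring

theorem marginal_eRS_prodState [Nonempty H] [Nonempty C] {ω : Matrix A A ℂ} (h : IsState ω) :
    marginal eRS (Q.prodState ω) = Q.psiState := by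
  have : marginal eRS (Q.prodState ω) = marginal (Equiv.refl _)
    (Q.psiState ⊗ₖ (ω ⊗ₖ (Q.tauH ⊗ₖ Q.tauC))) := rfl
  rw [this, marginal_kronecker_left,
    (h.kronecker (Q.isState_tauH.kronecker Q.isState_tauC)).trace, one_smul]

theorem marginal_AHC_prodState {ω : Matrix A A ℂ} :
    marginal (eRS.trans (Equiv.prodComm _ _)) (Q.prodState ω) = ω ⊗ₖ (Q.tauH ⊗ₖ Q.tauC) := by
  have : marginal (eRS.trans (Equiv.prodComm _ _)) (Q.prodState ω)
    = marginal (Equiv.prodComm _ _) (Q.psiState ⊗ₖ (ω ⊗ₖ (Q.tauH ⊗ₖ Q.tauC))) := rfl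
  rw [this, marginal_kronecker_right, Q.isState_psiState.trace, one_smul]

theorem marginal_eA_prodState [Nonempty H] [Nonempty C] (ω : Matrix A A ℂ) :
    marginal eA (Q.prodState ω) = ω := by
  rw [← marginal_marginal_congr (eRS.trans (Equiv.prodComm _ _)) (Equiv.refl _) eA
    (by intros; rfl) (by intros; rfl) (Q.prodState ω), marginal_AHC_prodState, marginal_kronecker_left,
    (Q.isState_tauH.kronecker Q.isState_tauC).trace, one_smul]

theorem marginal_HC_prodState {ω : Matrix A A ℂ} (h : IsState ω) :
    marginal (subEquiv (eRS.trans (Equiv.prodComm _ _)) (Equiv.prodComm A (H × C)))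
      (Q.prodState ω) = Q.tauH ⊗ₖ Q.tauC := by
  rw [← marginal_marginal, marginal_AHC_prodState, marginal_kronecker_right, h.trace, one_smul]

theorem marginal_eH_prodState [Nonempty C] {ω : Matrix A A ℂ} (h : IsState ω) :
    marginal eH (Q.prodState ω) = Q.tauH := by
  rw [← marginal_marginal_congr (subEquiv (eRS.trans (Equiv.prodComm _ _))
    (Equiv.prodComm A (H × C))) (Equiv.refl _) eH
    (by intros; rfl) (by intros; rfl) (Q.prodState ω), marginal_HC_prodState _ h, marginal_kronecker_left,
    Q.isState_tauC.trace, one_smul]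

theorem marginal_eC_prodState [Nonempty H] {ω : Matrix A A ℂ} (h : IsState ω) :
    marginal eC (Q.prodState ω) = Q.tauC := by
  rw [← marginal_marginal_congr (subEquiv (eRS.trans (Equiv.prodComm _ _))
    (Equiv.prodComm A (H × C))) (Equiv.prodComm H C) eC
    (by intros; rfl) (by intros; rfl) (Q.prodState ω), marginal_HC_prodState _ h, marginal_kronecker_right,
    Q.isState_tauH.trace, one_smul]

end Engine

/-! ### Embedded unitaries and nested subsystems -/

section Helpers

set_option linter.unusedSectionVars false

variable {n k l k₁ l₁ k₂ l₂ l₃ : Type*} [Fintype n] [DecidableEq n] [Fintype k] [DecidableEq k]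
  [Fintype l] [DecidableEq l] [Fintype k₁] [DecidableEq k₁] [Fintype l₁] [DecidableEq l₁]
  [Fintype k₂] [DecidableEq k₂] [Fintype l₂] [DecidableEq l₂] [Fintype l₃] [DecidableEq l₃]

theorem marginal_applyLocal_self (e : n ≃ k × l) (N : Matrix k k ℂ →ₗ[ℂ] Matrix k k ℂ)
    (ρ : Matrix n n ℂ) : marginal e (applyLocal e e N ρ) = N (marginal e ρ) := by
  have : marginal e ρ = ∑ t, of fun a b => ρ (e.symm (a, t)) (e.symm (b, t)) := by
    ext a b; simp [marginal_apply, Matrix.sum_apply]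
  rw [this, map_sum]
  ext a b
  simp [marginal_apply, applyLocal_apply, Matrix.sum_apply]

theorem marginal_conj_embed (e : n ≃ k × l) (U : Matrix k k ℂ) (ρ : Matrix n n ℂ) :
    marginal e (conj (embed e U) ρ) = conj U (marginal e ρ) := by
  rw [conj_embed, marginal_applyLocal_self]; rfl

theorem Commute.embed (e : n ≃ k × l) {U V : Matrix k k ℂ} (h : Commute U V) :
    Commute (QEC.embed e U) (QEC.embed e V) := by
  rw [Commute, SemiconjBy, embed_mul, embed_mul, h.eq]

theorem marginal_marginal_marginal_congr (e : n ≃ k × l) (e₁ : k ≃ k₁ × l₁) (e₂ : k₁ ≃ k₂ × l₂)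
    (e₃ : n ≃ k₂ × l₃)
    (h₁ : ∀ i t, (e₃ ((subEquiv (subEquiv e e₁) e₂).symm (i, t))).1 = i)
    (h₂ : ∀ i j t, (e₃ ((subEquiv (subEquiv e e₁) e₂).symm (i, t))).2
      = (e₃ ((subEquiv (subEquiv e e₁) e₂).symm (j, t))).2)
    (ρ : Matrix n n ℂ) : marginal e₂ (marginal e₁ (marginal e ρ)) = marginal e₃ ρ := by
  rw [marginal_marginal e e₁, marginal_marginal_congr _ _ e₃ h₁ h₂]

/-- The second of three factors. -/
def factor₂ {a b c : Type*} : a × b × c ≃ b × (a × c) :=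
  ⟨fun i => (i.2.1, i.1, i.2.2), fun j => (j.2.1, j.1, j.2.2), fun _ => rfl, fun _ => rfl⟩

/-- The third of three factors. -/
def factor₃ {a b c : Type*} : a × b × c ≃ c × (a × b) :=
  ⟨fun i => (i.2.2, i.1, i.2.1), fun j => (j.2.1, j.2.2, j.1), fun _ => rfl, fun _ => rfl⟩

end Helpers

namespace Engine

set_option linter.unusedSectionVars false

variable {R S A H C M Y : Type*}
    [Fintype R] [DecidableEq R] [Fintype S] [DecidableEq S] [Fintype A] [DecidableEq A]
    [Fintype H] [DecidableEq H] [Fintype C] [DecidableEq C] [Fintype M] [DecidableEq M]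
    [Fintype Y] [DecidableEq Y]

variable (Q : Engine R S A H C M Y)

/-! ### The states along the cycle -/

theorem isState_rho0 [Nonempty H] [Nonempty C] (x : A) : IsState (Q.rho0 x) :=
  Q.rho0_eq x ▸ Q.isState_prodState (isState_proj x)

theorem isState_rhoEnc [Nonempty H] [Nonempty C] (x : A) : IsState (Q.rhoEnc x) :=
  (Q.isState_rho0 x).conj (embed_mem_unitaryGroup _ (Q.Uenc_unitary x))

theorem isState_rho1 [Nonempty H] [Nonempty C] (x : A) : IsState (Q.rho1 x) :=
  (Q.isState_rhoEnc x).conj (embed_mem_unitaryGroup _ Q.Uh_unitary)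

/-- Given x, RSA starts pure and the encoding and thermal operation are unitary, so only the baths
carry entropy. -/
theorem entropy_rho1 [Nonempty H] [Nonempty C] (x : A) :
    entropy (Q.rho1 x) = entropy Q.tauH + entropy Q.tauC := by
  rw [rho1, entropy_conj (embed_mem_unitaryGroup _ Q.Uh_unitary)
    (Q.isState_rhoEnc x).pos.isHermitian, rhoEnc,
    entropy_conj (embed_mem_unitaryGroup _ (Q.Uenc_unitary x))
    (Q.isState_rho0 x).pos.isHermitian, rho0_eq, Q.entropy_prodState (isState_proj x),
    entropy_proj, zero_add]

theorem rho2_posSemidef [Nonempty H] [Nonempty C] (x : A) (y : Y) : (Q.rho2 x y).PosSemidef :=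
  applyLocal_posSemidef _ _ ((Q.inst_isInstrument x).cp y) (Q.isState_rho1 x).pos

theorem rho3_posSemidef [Nonempty H] [Nonempty C] (x : A) (y : Y) : (Q.rho3 x y).PosSemidef :=
  conj_posSemidef (Q.rho2_posSemidef x y) _

theorem rhoF_posSemidef [Nonempty H] [Nonempty C] (x : A) (y : Y) : (Q.rhoF x y).PosSemidef :=
  conj_posSemidef (Q.rho3_posSemidef x y) _

theorem trace_rho3 (x : A) (y : Y) : (Q.rho3 x y).trace = (Q.rho2 x y).trace :=
  trace_conj (embed_mem_unitaryGroup _ (Q.Udec_unitary x y)) _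

theorem trace_rhoF (x : A) (y : Y) : (Q.rhoF x y).trace = (Q.rho2 x y).trace :=
  (trace_conj (embed_mem_unitaryGroup _ Q.Uc_unitary) _).trans (Q.trace_rho3 x y)

theorem record_rho2 (x : A) :
    record (Q.rho2 x) = applyLocal eSA eSAY (Q.measMap x) (Q.rho1 x) :=
  (applyLocal_recordMap eSA eSAY (fun _ _ => rfl) (Q.inst x) (Q.rho1 x)).symm

theorem measMap_isTracePreserving (x : A) : IsTracePreserving (Q.measMap x) :=
  recordMap_isTracePreserving (Q.inst_isInstrument x)

theorem isState_record_rho2 [Nonempty H] [Nonempty C] (x : A) : IsState (record (Q.rho2 x)) :=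
  ⟨record_posSemidef (Q.rho2_posSemidef x), by
    rw [record_rho2, trace_applyLocal _ _ (Q.measMap_isTracePreserving x),
      (Q.isState_rho1 x).trace]⟩

theorem isState_record_rho3 [Nonempty H] [Nonempty C] (x : A) : IsState (record (Q.rho3 x)) :=
  ⟨record_posSemidef (Q.rho3_posSemidef x), by
    rw [← (Q.isState_record_rho2 x).trace, trace_record, trace_record]
    simp only [trace_rho3]⟩

theorem isState_record_rhoF [Nonempty H] [Nonempty C] (x : A) : IsState (record (Q.rhoF x)) :=
  ⟨record_posSemidef (Q.rhoF_posSemidef x), by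
    rw [← (Q.isState_record_rho2 x).trace, trace_record, trace_record]
    simp only [trace_rhoF]⟩

/-- The record is block diagonal in y, and within each block feedback and reset are unitary. -/
theorem entropy_record_rhoF [Nonempty H] [Nonempty C] (x : A) :
    entropy (record (Q.rhoF x)) = entropy (record (Q.rho2 x)) := by
  rw [entropy_record (Q.rhoF_posSemidef x), entropy_record (Q.rho2_posSemidef x)]
  refine Finset.sum_congr rfl fun y _ => ?_
  rw [rhoF, entropy_conj (embed_mem_unitaryGroup _ Q.Uc_unitary)
    (Q.rho3_posSemidef x y).isHermitian, rho3,
    entropy_conj (embed_mem_unitaryGroup _ (Q.Udec_unitary x y))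
    (Q.rho2_posSemidef x y).isHermitian]

theorem applyLocal_measMap_posSemidef (x : A)
    {ρ : Matrix (EIdx R S A H C) (EIdx R S A H C) ℂ} (hρ : ρ.PosSemidef) :
    (applyLocal eSA eSAY (Q.measMap x) ρ).PosSemidef := by
  rw [measMap, applyLocal_recordMap eSA eSAY (fun _ _ => rfl)]
  exact record_posSemidef fun y =>
    applyLocal_posSemidef _ _ ((Q.inst_isInstrument x).cp y) hρ

theorem neg_log_efficacyX_le [Nonempty H] [Nonempty C] (x : A) :
    -Real.log (Q.efficacyX x)
      ≤ entropy (record (Q.rho2 x)) - (entropy Q.tauH + entropy Q.tauC) := by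
  rw [record_rho2, ← Q.entropy_rho1 x]
  exact neg_log_efficacy_le _ (fun ρ hρ => Q.applyLocal_measMap_posSemidef x hρ)
    (trace_applyLocal _ _ (Q.measMap_isTracePreserving x)) (Q.isState_rho1 x).pos
    (Q.isState_rho1 x).trace

theorem efficacyX_le_one [Nonempty H] [Nonempty C] (x : A) (h : IsSubunital (Q.measMap x)) :
    Q.efficacyX x ≤ 1 :=
  efficacy_applyLocal_le_one _ _ h (Q.measMap_isTracePreserving x)
    (Q.applyLocal_measMap_posSemidef x (Q.isState_rho1 x).pos) (Q.isState_rho1 x).trace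

theorem isCQ_withXY (ω : A → Y → Matrix (EIdx R S A H C) (EIdx R S A H C) ℂ) :
    IsCQ eXY Q.pX (fun x => record (ω x)) (Q.withXY ω) := by
  refine isCQ_of_eq _ _ _ fun i j => ?_
  simp only [withXY, record, Matrix.sum_apply, Finset.sum_mul, Finset.mul_sum, Matrix.smul_apply,
    kroneckerMap_apply, smul_eq_mul, eXY, Equiv.coe_fn_mk]
  exact Finset.sum_congr rfl fun x _ => Finset.sum_congr rfl fun y _ => by ring

theorem isCQ_withX (ω : A → Matrix (EIdx R S A H C) (EIdx R S A H C) ℂ) :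
    IsCQ eXY Q.pX (fun x => ω x ⊗ₖ proj Q.y₀) (Q.withX ω) := by
  refine isCQ_of_eq _ _ _ fun i j => ?_
  simp only [withX, Matrix.sum_apply, Matrix.smul_apply,
    kroneckerMap_apply, smul_eq_mul, eXY, Equiv.coe_fn_mk]
  exact Finset.sum_congr rfl fun x _ => by ring

/-- The average `∑ x, p(x) ω_x`. -/
def avg {n : Type*} (ω : A → Matrix n n ℂ) : Matrix n n ℂ := ∑ x, (Q.pX x : ℂ) • ω x

theorem marginal_avg {n k l : Type*} [Fintype n] [DecidableEq n] [Fintype k] [DecidableEq k]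
    [Fintype l] [DecidableEq l] (e : n ≃ k × l) (ω : A → Matrix n n ℂ) :
    marginal e (Q.avg ω) = Q.avg fun x => marginal e (ω x) := by
  rw [avg, marginal_sum]; simp only [marginal_smul]; rfl

theorem avg_const {n : Type*} (X : Matrix n n ℂ) : (Q.avg fun _ => X) = X := by
  rw [avg, ← Finset.sum_smul]
  have : ∑ x, (Q.pX x : ℂ) = 1 := by exact_mod_cast Q.sum_pX
  rw [this, one_smul]

theorem isState_avg {n : Type*} [Fintype n] [DecidableEq n] {ω : A → Matrix n n ℂ}
    (h : ∀ x, IsState (ω x)) : IsState (Q.avg ω) where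
  pos := posSemidef_sum _ fun x _ => (h x).pos.smul (by exact_mod_cast (Q.pX_pos x).le)
  trace := by
    rw [avg, trace_sum]
    simp only [trace_smul, (h _).trace, smul_eq_mul, mul_one]
    exact_mod_cast Q.sum_pX

theorem conj_avg {n : Type*} [Fintype n] [DecidableEq n] (U : Matrix n n ℂ)
    (ω : A → Matrix n n ℂ) : conj U (Q.avg ω) = Q.avg fun x => conj U (ω x) := by
  have := map_sum (conjLin U) (fun x => (Q.pX x : ℂ) • ω x) Finset.univ
  simp only [map_smul] at this
  exact this

theorem expect_avg {n : Type*} [Fintype n] [DecidableEq n] (ω : A → Matrix n n ℂ)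
    (O : Matrix n n ℂ) : expect (Q.avg ω) O = ∑ x, Q.pX x * expect (ω x) O := by
  rw [avg, expect_sum]; simp only [expect_smul]

/-- The states of `E` averaged over the outcomes. -/
def avg0 : Matrix (EIdx R S A H C) (EIdx R S A H C) ℂ := Q.avg Q.rho0
def avgEnc : Matrix (EIdx R S A H C) (EIdx R S A H C) ℂ := Q.avg Q.rhoEnc
def avg1 : Matrix (EIdx R S A H C) (EIdx R S A H C) ℂ := Q.avg Q.rho1
def avg3 : Matrix (EIdx R S A H C) (EIdx R S A H C) ℂ := Q.avg fun x => ∑ y, Q.rho3 x y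
def avgF : Matrix (EIdx R S A H C) (EIdx R S A H C) ℂ := Q.avg fun x => ∑ y, Q.rhoF x y

theorem marginal_E_withXY (ω : A → Y → Matrix (EIdx R S A H C) (EIdx R S A H C) ℂ) :
    marginal (Equiv.refl _) (Q.withXY ω) = Q.avg fun x => ∑ y, ω x y := by
  rw [(Q.isCQ_withXY ω).marginal_eq_sum (Equiv.refl _) (Equiv.refl _) (fun _ _ _ => rfl)
    (fun _ _ _ _ => rfl)]
  simp only [marginal_record]; rfl

theorem marginal_E_withX (ω : A → Matrix (EIdx R S A H C) (EIdx R S A H C) ℂ) :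
    marginal (Equiv.refl _) (Q.withX ω) = Q.avg ω := by
  rw [(Q.isCQ_withX ω).marginal_eq_sum (Equiv.refl _) (Equiv.refl _) (fun _ _ _ => rfl)
    (fun _ _ _ _ => rfl)]
  simp only [marginal_kronecker_left, trace_proj, one_smul]; rfl

theorem marginal_E_sigmaI : marginal (Equiv.refl _) Q.sigmaI = Q.rhoI := by
  rw [sigmaI, marginal_kronecker_left, trace_kronecker, trace_proj, trace_proj, one_mul, one_smul]

theorem marginal_fY_withXY (ω : A → Y → Matrix (EIdx R S A H C) (EIdx R S A H C) ℂ) :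
    marginal fY (Q.withXY ω) = Q.avg fun x => ∑ y, (ω x y).trace • proj y := by
  rw [(Q.isCQ_withXY ω).marginal_eq_sum fY (Equiv.prodComm _ _) (fun _ _ _ => rfl)
    (fun _ _ _ _ => rfl)]
  simp only [marginal_record_right]; rfl

theorem marginal_fY_withX (ω : A → Matrix (EIdx R S A H C) (EIdx R S A H C) ℂ)
    (h : ∀ x, IsState (ω x)) : marginal fY (Q.withX ω) = proj Q.y₀ := by
  rw [(Q.isCQ_withX ω).marginal_eq_sum fY (Equiv.prodComm _ _) (fun _ _ _ => rfl)
    (fun _ _ _ _ => rfl)]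
  simp only [marginal_kronecker_right, (h _).trace, one_smul]
  exact Q.avg_const _

theorem marginal_fY_sigmaI [Nonempty H] [Nonempty C] : marginal fY Q.sigmaI = proj Q.y₀ := by
  rw [← marginal_marginal_congr (Equiv.prodComm _ _) (Equiv.prodComm _ _) fY (by intros; rfl)
    (by intros; rfl) Q.sigmaI, sigmaI, marginal_kronecker_right]
  have : Q.rhoI.trace = 1 := (Q.isState_prodState Q.isState_tauA).trace
  rw [this, one_smul, marginal_kronecker_right, trace_proj, one_smul]

/-! ### Energies -/

/-- The energy of `S` and `A`. -/
def energySA (ρ : Matrix (EIdx R S A H C) (EIdx R S A H C) ℂ) : ℝ :=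
  expect (marginal eS ρ) Q.hamS + expect (marginal eA ρ) Q.hamA

/-- The energy of the hot bath. -/
def energyH (ρ : Matrix (EIdx R S A H C) (EIdx R S A H C) ℂ) : ℝ :=
  expect (marginal eH ρ) Q.hamH

/-- The energy of the cold bath. -/
def energyC (ρ : Matrix (EIdx R S A H C) (EIdx R S A H C) ℂ) : ℝ :=
  expect (marginal eC ρ) Q.hamC

theorem energy_eq (σ : Matrix (EIdx R S A H C × A × Y) (EIdx R S A H C × A × Y) ℂ) :
    Q.energy σ = Q.energySA (marginal (Equiv.refl _) σ) + expect (marginal fY σ) Q.hamY := by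
  rw [energy, hamRSAY, expect_add_right, expect_add_right, expect_embed, expect_embed,
    expect_embed, energySA,
    marginal_marginal_congr (Equiv.refl _) eS fS (by intros; rfl) (by intros; rfl) σ,
    marginal_marginal_congr (Equiv.refl _) eA fA (by intros; rfl) (by intros; rfl) σ]

theorem expect_fH (σ : Matrix (EIdx R S A H C × A × Y) (EIdx R S A H C × A × Y) ℂ) :
    expect σ (embed fH Q.hamH) = Q.energyH (marginal (Equiv.refl _) σ) := by
  rw [expect_embed, energyH,
    marginal_marginal_congr (Equiv.refl _) eH fH (by intros; rfl) (by intros; rfl) σ]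

theorem expect_fC (σ : Matrix (EIdx R S A H C × A × Y) (EIdx R S A H C × A × Y) ℂ) :
    expect σ (embed fC Q.hamC) = Q.energyC (marginal (Equiv.refl _) σ) := by
  rw [expect_embed, energyC,
    marginal_marginal_congr (Equiv.refl _) eC fC (by intros; rfl) (by intros; rfl) σ]

/-- The sum of local energies is the expectation of the total Hamiltonian of SAB_h, which commutes
with the interaction. -/
theorem energy_conserved_hot (ρ : Matrix (EIdx R S A H C) (EIdx R S A H C) ℂ) :
    Q.energySA (conj (embed eSAH Q.Uh) ρ) + Q.energyH (conj (embed eSAH Q.Uh) ρ)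
      = Q.energySA ρ + Q.energyH ρ := by
  have key : ∀ ρ : Matrix (EIdx R S A H C) (EIdx R S A H C) ℂ,
      Q.energySA ρ + Q.energyH ρ = expect ρ (embed eSAH
        ((Q.hamS ⊗ₖ (1 : Matrix A A ℂ)
          + (1 : Matrix S S ℂ) ⊗ₖ Matrix.diagonal fun a => (Q.energyA a : ℂ))
            ⊗ₖ (1 : Matrix H H ℂ)
        + (1 : Matrix (S × A) (S × A) ℂ) ⊗ₖ Q.hamH)) := by
    intro ρ
    rw [expect_embed, expect_add_right, kronecker_one_eq_embed, expect_embed, expect_add_right,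
      kronecker_one_eq_embed, expect_embed, one_kronecker_eq_embed, one_kronecker_eq_embed,
      expect_embed, expect_embed,
      marginal_marginal_congr eSAH (Equiv.prodComm _ _) eH (by intros; rfl) (by intros; rfl) ρ,
      marginal_marginal_marginal_congr eSAH (Equiv.refl _) (Equiv.refl _) eS
        (by intros; rfl) (by intros; rfl) ρ,
      marginal_marginal_marginal_congr eSAH (Equiv.refl _) (Equiv.prodComm _ _) eA
        (by intros; rfl) (by intros; rfl) ρ]
    rfl
  rw [key, key]
  exact expect_conj_of_commute (embed_mem_unitaryGroup _ Q.Uh_unitary)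
    (Commute.embed _ Q.Uh_comm) ρ

theorem energy_conserved_cold (ρ : Matrix (EIdx R S A H C) (EIdx R S A H C) ℂ) :
    expect (marginal eA (conj (embed eAC Q.Uc) ρ)) Q.hamA + Q.energyC (conj (embed eAC Q.Uc) ρ)
      = expect (marginal eA ρ) Q.hamA + Q.energyC ρ := by
  have key : ∀ ρ : Matrix (EIdx R S A H C) (EIdx R S A H C) ℂ,
      expect (marginal eA ρ) Q.hamA + Q.energyC ρ = expect ρ (embed eAC
        ((Matrix.diagonal fun a => (Q.energyA a : ℂ)) ⊗ₖ (1 : Matrix C C ℂ)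
      + (1 : Matrix A A ℂ) ⊗ₖ Q.hamC)) := by
    intro ρ
    rw [expect_embed, expect_add_right, kronecker_one_eq_embed, one_kronecker_eq_embed,
      expect_embed, expect_embed,
      marginal_marginal_congr eAC (Equiv.prodComm _ _) eC (by intros; rfl) (by intros; rfl) ρ,
      marginal_marginal_congr eAC (Equiv.refl _) eA (by intros; rfl) (by intros; rfl) ρ]
    rfl
  rw [key, key]
  exact expect_conj_of_commute (embed_mem_unitaryGroup _ Q.Uc_unitary)
    (Commute.embed _ Q.Uc_comm) ρ

/-! ### Subsystems that do not take part in a step -/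

theorem marginal_eH_SA {N : Matrix (S × A) (S × A) ℂ →ₗ[ℂ] Matrix (S × A) (S × A) ℂ}
    (hN : IsTracePreserving N) (ρ : Matrix (EIdx R S A H C) (EIdx R S A H C) ℂ) :
    marginal eH (applyLocal eSA eSA N ρ) = marginal eH ρ :=
  marginal_applyLocal_of_disjoint eSA factor₂ eH (by intros; rfl) (by intros; rfl) hN ρ

theorem marginal_eC_SA {N : Matrix (S × A) (S × A) ℂ →ₗ[ℂ] Matrix (S × A) (S × A) ℂ}
    (hN : IsTracePreserving N) (ρ : Matrix (EIdx R S A H C) (EIdx R S A H C) ℂ) :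
    marginal eC (applyLocal eSA eSA N ρ) = marginal eC ρ :=
  marginal_applyLocal_of_disjoint eSA factor₃ eC (by intros; rfl) (by intros; rfl) hN ρ

theorem marginal_eC_SAH (ρ : Matrix (EIdx R S A H C) (EIdx R S A H C) ℂ) :
    marginal eC (conj (embed eSAH Q.Uh) ρ) = marginal eC ρ := by
  rw [conj_embed]
  exact marginal_applyLocal_of_disjoint eSAH (Equiv.prodComm _ _) eC (by intros; rfl)
    (by intros; rfl) (conjLin_isTracePreserving Q.Uh_unitary) ρ

theorem marginal_eH_AC (ρ : Matrix (EIdx R S A H C) (EIdx R S A H C) ℂ) :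
    marginal eH (conj (embed eAC Q.Uc) ρ) = marginal eH ρ := by
  rw [conj_embed]
  exact marginal_applyLocal_of_disjoint eAC factor₃ eH (by intros; rfl)
    (by intros; rfl) (conjLin_isTracePreserving Q.Uc_unitary) ρ

theorem marginal_eS_AC (ρ : Matrix (EIdx R S A H C) (EIdx R S A H C) ℂ) :
    marginal eS (conj (embed eAC Q.Uc) ρ) = marginal eS ρ := by
  rw [conj_embed]
  exact marginal_applyLocal_of_disjoint eAC factor₂ eS (by intros; rfl)
    (by intros; rfl) (conjLin_isTracePreserving Q.Uc_unitary) ρ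

theorem avgF_eq : Q.avgF = conj (embed eAC Q.Uc) Q.avg3 := by
  rw [avgF, avg3, conj_avg]
  congr 1; ext1 x
  exact (map_sum (conjLin (embed eAC Q.Uc)) (fun y => Q.rho3 x y) Finset.univ).symm

theorem avg1_eq : Q.avg1 = conj (embed eSAH Q.Uh) Q.avgEnc := by
  rw [avg1, avgEnc, conj_avg]; rfl

theorem sum_rho2 (x : A) :
    ∑ y, Q.rho2 x y = applyLocal eSA eSA (∑ y, Q.inst x y) (Q.rho1 x) :=
  (applyLocal_sum _ _ _ _ _).symm

theorem marginal_eH_avgEnc [Nonempty H] [Nonempty C] : marginal eH Q.avgEnc = Q.tauH := by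
  rw [avgEnc, marginal_avg]
  have : ∀ x, marginal eH (Q.rhoEnc x) = Q.tauH := fun x => by
    rw [rhoEnc, conj_embed, marginal_eH_SA (conjLin_isTracePreserving (Q.Uenc_unitary x)),
      rho0_eq, Q.marginal_eH_prodState (isState_proj x)]
  simp only [this, avg_const]

/-- Measurement, feedback and reset do not act on B_h. A single outcome could still change its state
through correlations, but the sum over y is trace preserving and cannot. -/
theorem marginal_eH_avgF : marginal eH Q.avgF = marginal eH Q.avg1 := by
  rw [avgF_eq, marginal_eH_AC, avg3, avg1, marginal_avg, marginal_avg]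
  congr 1; ext1 x
  rw [← marginal_eH_SA (sum_isTracePreserving (Q.inst_isInstrument x)) (Q.rho1 x), ← sum_rho2,
    marginal_sum, marginal_sum]
  refine Finset.sum_congr rfl fun y _ => ?_
  rw [rho3, conj_embed, marginal_eH_SA (conjLin_isTracePreserving (Q.Udec_unitary x y))]

theorem marginal_eC_avg3 [Nonempty H] [Nonempty C] : marginal eC Q.avg3 = Q.tauC := by
  rw [avg3, marginal_avg]
  have : ∀ x, marginal eC (∑ y, Q.rho3 x y) = Q.tauC := fun x => by
    have h2 : marginal eC (∑ y, Q.rho3 x y) = marginal eC (∑ y, Q.rho2 x y) := by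
      rw [marginal_sum, marginal_sum]
      refine Finset.sum_congr rfl fun y _ => ?_
      rw [rho3, conj_embed, marginal_eC_SA (conjLin_isTracePreserving (Q.Udec_unitary x y))]
    rw [h2, sum_rho2, marginal_eC_SA (sum_isTracePreserving (Q.inst_isInstrument x)), rho1,
      marginal_eC_SAH, rhoEnc, conj_embed,
      marginal_eC_SA (conjLin_isTracePreserving (Q.Uenc_unitary x)), rho0_eq,
      Q.marginal_eC_prodState (isState_proj x)]
  simp only [this, avg_const]

theorem marginal_eS_of_eRS {ρ : Matrix (EIdx R S A H C) (EIdx R S A H C) ℂ}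
    (h : marginal eRS ρ = Q.psiState) :
    marginal eS ρ = marginal (Equiv.prodComm R S) Q.psiState := by
  rw [← h, marginal_marginal_congr eRS (Equiv.prodComm R S) eS (by intros; rfl)
    (by intros; rfl) ρ]

theorem marginal_eRS_avg0 [Nonempty H] [Nonempty C] : marginal eRS Q.avg0 = Q.psiState := by
  rw [avg0, marginal_avg]
  simp only [rho0_eq, Q.marginal_eRS_prodState (isState_proj _), avg_const]

theorem marginal_eA_avg0 [Nonempty H] [Nonempty C] : marginal eA Q.avg0 = Q.tauA := by
  rw [avg0, marginal_avg, tauA_eq_sum]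
  simp only [rho0_eq, Q.marginal_eA_prodState]; rfl

/-! ### The cold bath stays uncorrelated until the reset of `A` -/

/-- `ρ` is a product of an operator of `RSAB_h` and the thermal state of `B_c`. -/
def IsProdCold (ρ : Matrix (EIdx R S A H C) (EIdx R S A H C) ℂ) : Prop :=
  ∃ ω : Matrix (R × S × A × H) (R × S × A × H) ℂ,
    ρ = of fun i j => ω (i.1, i.2.1, i.2.2.1, i.2.2.2.1) (j.1, j.2.1, j.2.2.1, j.2.2.2.1)
      * Q.tauC i.2.2.2.2 j.2.2.2.2

/-- `SA` inside `RSAB_h`. -/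
def bSA : R × S × A × H ≃ (S × A) × (R × H) :=
  ⟨fun i => ((i.2.1, i.2.2.1), i.1, i.2.2.2), fun j => (j.2.1, j.1.1, j.1.2, j.2.2),
   fun _ => rfl, fun _ => rfl⟩

/-- `SAB_h` inside `RSAB_h`. -/
def bSAH : R × S × A × H ≃ ((S × A) × H) × R :=
  ⟨fun i => (((i.2.1, i.2.2.1), i.2.2.2), i.1), fun j => (j.2, j.1.1.1, j.1.1.2, j.1.2),
   fun _ => rfl, fun _ => rfl⟩

/-- `A` inside `RSAB_h`. -/
def bA : R × S × A × H ≃ A × (R × S × H) :=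
  ⟨fun i => (i.2.2.1, i.1, i.2.1, i.2.2.2), fun j => (j.2.1, j.2.2.1, j.1, j.2.2.2),
   fun _ => rfl, fun _ => rfl⟩

variable {Q} in
theorem IsProdCold.applyLocal_eSA {ρ : Matrix (EIdx R S A H C) (EIdx R S A H C) ℂ}
    (h : Q.IsProdCold ρ) (N : Matrix (S × A) (S × A) ℂ →ₗ[ℂ] Matrix (S × A) (S × A) ℂ) :
    Q.IsProdCold (applyLocal eSA eSA N ρ) := by
  obtain ⟨ω, rfl⟩ := h
  exact ⟨_, applyLocal_factor eSA bSA
    (fun i : EIdx R S A H C => (i.1, i.2.1, i.2.2.1, i.2.2.2.1)) (fun i => i.2.2.2.2)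
    (by intros; rfl) (by intros; rfl) (by intros; rfl) N ω Q.tauC⟩

variable {Q} in
theorem IsProdCold.applyLocal_eSAH {ρ : Matrix (EIdx R S A H C) (EIdx R S A H C) ℂ}
    (h : Q.IsProdCold ρ)
    (N : Matrix ((S × A) × H) ((S × A) × H) ℂ →ₗ[ℂ] Matrix ((S × A) × H) ((S × A) × H) ℂ) :
    Q.IsProdCold (applyLocal eSAH eSAH N ρ) := by
  obtain ⟨ω, rfl⟩ := h
  exact ⟨_, applyLocal_factor eSAH bSAH
    (fun i : EIdx R S A H C => (i.1, i.2.1, i.2.2.1, i.2.2.2.1)) (fun i => i.2.2.2.2)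
    (by intros; rfl) (by intros; rfl) (by intros; rfl) N ω Q.tauC⟩

theorem isProdCold_sum {ι : Type*} [Fintype ι]
    {ρ : ι → Matrix (EIdx R S A H C) (EIdx R S A H C) ℂ} (h : ∀ i, Q.IsProdCold (ρ i)) :
    Q.IsProdCold (∑ i, ρ i) := by
  choose ω hω using h
  refine ⟨∑ i, ω i, ?_⟩
  ext u v
  simp only [Matrix.sum_apply, of_apply, Finset.sum_mul]
  refine Finset.sum_congr rfl fun i _ => ?_
  rw [hω i, of_apply]

variable {Q} in
theorem IsProdCold.smul {ρ : Matrix (EIdx R S A H C) (EIdx R S A H C) ℂ}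
    (h : Q.IsProdCold ρ) (c : ℂ) : Q.IsProdCold (c • ρ) := by
  obtain ⟨ω, rfl⟩ := h
  exact ⟨c • ω, by ext u v; simp [mul_assoc]⟩

theorem isProdCold_rho0 (x : A) : Q.IsProdCold (Q.rho0 x) := by
  rw [rho0_eq]
  refine ⟨of fun i j => Q.psiState (i.1, i.2.1) (j.1, j.2.1)
    * ((proj x : Matrix A A ℂ) i.2.2.1 j.2.2.1 * Q.tauH i.2.2.2 j.2.2.2), ?_⟩
  ext i j
  have : Q.prodState (proj x) i j = Q.psiState (i.1, i.2.1) (j.1, j.2.1)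
    * ((proj x : Matrix A A ℂ) i.2.2.1 j.2.2.1
      * (Q.tauH i.2.2.2.1 j.2.2.2.1 * Q.tauC i.2.2.2.2 j.2.2.2.2)) := rfl
  rw [this, of_apply, of_apply]; ring

/-- Every step before the reset is a local map on SA or SAB_h, and so leaves the factor of B_c in
place. -/
theorem isProdCold_avg3 : Q.IsProdCold Q.avg3 := by
  refine Q.isProdCold_sum fun x => IsProdCold.smul (Q.isProdCold_sum fun y => ?_) _
  rw [rho3, conj_embed]
  refine IsProdCold.applyLocal_eSA (IsProdCold.applyLocal_eSA ?_ _) _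
  rw [rho1, conj_embed, rhoEnc, conj_embed]
  exact ((Q.isProdCold_rho0 x).applyLocal_eSA _).applyLocal_eSAH _

theorem isState_avg3 [Nonempty H] [Nonempty C] : IsState Q.avg3 :=
  Q.isState_avg fun x => marginal_record (Q.rho3 x) ▸ (Q.isState_record_rho3 x).marginal _

theorem isState_avgF [Nonempty H] [Nonempty C] : IsState Q.avgF :=
  Q.avgF_eq ▸ Q.isState_avg3.conj (embed_mem_unitaryGroup _ Q.Uc_unitary)

/-- `Uc_resets` concerns only inputs that are products with the thermal state of B_c, which
`isProdCold_avg3` provides. -/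
theorem marginal_eA_avgF [Nonempty H] [Nonempty C] : marginal eA Q.avgF = Q.tauA := by
  obtain ⟨ω, hω⟩ := Q.isProdCold_avg3
  have h1 : marginal eAC Q.avg3 = marginal bA ω ⊗ₖ Q.tauC := by
    rw [hω]
    ext i j
    simp only [marginal_apply, kroneckerMap_apply, Finset.sum_mul]
    rfl
  have hA : ∀ ρ : Matrix (EIdx R S A H C) (EIdx R S A H C) ℂ,
      marginal (Equiv.refl _) (marginal eAC ρ) = marginal eA ρ := fun ρ =>
    marginal_marginal_congr eAC (Equiv.refl _) eA (by intros; rfl) (by intros; rfl) ρ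
  have h2 : IsState (marginal bA ω) := by
    have h3 := hA Q.avg3
    rw [h1, marginal_kronecker_left, Q.isState_tauC.trace, one_smul] at h3
    rw [h3]; exact Q.isState_avg3.marginal _
  obtain ⟨ξ, hξ⟩ := Q.Uc_resets _ h2.pos h2.trace
  have h4 : marginal eAC Q.avgF = Q.tauA ⊗ₖ ξ := by
    rw [avgF_eq, marginal_conj_embed, h1]; exact hξ
  have h5 : ξ.trace = 1 := by
    have := (Q.isState_avgF.marginal eAC).trace
    rwa [h4, trace_kronecker, Q.isState_tauA.trace, one_mul] at this
  rw [← hA, h4, marginal_kronecker_left, h5, one_smul]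

end Engine

/-! ### Conditional mutual information as a combination of entropies -/

section Helpers

set_option linter.unusedSectionVars false

variable {k l m : Type*} [Fintype k] [DecidableEq k] [Fintype l] [DecidableEq l]
  [Fintype m] [DecidableEq m]

/-- The first and third of three factors. -/
def factor₁₃ : k × l × m ≃ (k × m) × l :=
  ⟨fun i => ((i.1, i.2.2), i.2.1), fun i => (i.1.1, i.2, i.1.2), fun _ => rfl, fun _ => rfl⟩

theorem condMutualInfo_eq {ρ : Matrix (k × l × m) (k × l × m) ℂ} (h : ρ.PosSemidef) :
    condMutualInfo ρ = entropy (marginal factor₁₃ ρ)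
      + entropy (marginal (Equiv.prodComm k (l × m)) ρ) - entropy ρ
      - entropy (marginal factor₃ ρ) := by
  have e1 := marginal_marginal_congr (factor₁₃ (k := k) (l := l) (m := m))
    (Equiv.prodComm k m) factor₃ (by intros; rfl) (by intros; rfl) ρ
  have e2 := marginal_marginal_congr (Equiv.prodComm k (l × m))
    (Equiv.prodComm l m) factor₃ (by intros; rfl) (by intros; rfl) ρ
  have e3 : marginal (Equiv.prodComm (k × l) m)
      (ρ.submatrix (Equiv.prodAssoc k l m) (Equiv.prodAssoc k l m)) = marginal factor₃ ρ := by
    rw [marginal_submatrix]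
    exact marginal_congr_left _ _ (by intros; rfl) (by intros; rfl) ρ
  change (entropy (marginal factor₁₃ ρ) - entropy (marginal _ (marginal factor₁₃ ρ)))
    + (_ - entropy (marginal _ (marginal _ _)))
    - (entropy (ρ.submatrix _ _) - entropy (marginal _ (ρ.submatrix _ _))) = _
  rw [e1, e2, e3, entropy_submatrix _ h.isHermitian]
  ring

end Helpers

namespace Engine

set_option linter.unusedSectionVars false

variable {R S A H C M Y : Type*}
    [Fintype R] [DecidableEq R] [Fintype S] [DecidableEq S] [Fintype A] [DecidableEq A]
    [Fintype H] [DecidableEq H] [Fintype C] [DecidableEq C] [Fintype M] [DecidableEq M]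
    [Fintype Y] [DecidableEq Y]

variable (Q : Engine R S A H C M Y)

/-! ### Entropies conditioned on the register `X` -/

/-- The Shannon entropy of X occurs in both H(XY) and H(X) and cancels, leaving an average over x.
-/
theorem HYX_eq {T : A → Matrix (EIdx R S A H C × Y) (EIdx R S A H C × Y) ℂ}
    {σ : Matrix (EIdx R S A H C × A × Y) (EIdx R S A H C × A × Y) ℂ}
    (h : IsCQ eXY Q.pX T σ) (hT : ∀ x, IsState (T x)) :
    HYX σ = ∑ x, Q.pX x * entropy (marginal (Equiv.prodComm _ _) (T x)) := by
  rw [HYX, condEntropy, marginal_marginal,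
    h.entropy_marginal hT fYX (Equiv.prodComm _ _) (Equiv.refl _) (by intros; rfl)
      (by intros; rfl),
    h.entropy_marginal_register hT (subEquiv fYX (Equiv.prodComm _ _)) (by intros; rfl)
      (by intros; rfl)]
  ring

/-- `X` and `Y` as registers. -/
def regXY {k : Type*} : k × (A × Y) ≃ (k × Y) × A :=
  ⟨fun i => ((i.1, i.2.2), i.2.1), fun j => (j.1.1, j.2, j.1.2), fun _ => rfl, fun _ => rfl⟩

theorem HRSAXY_eq {T : A → Matrix (EIdx R S A H C × Y) (EIdx R S A H C × Y) ℂ}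
    {σ : Matrix (EIdx R S A H C × A × Y) (EIdx R S A H C × A × Y) ℂ}
    (h : IsCQ eXY Q.pX T σ) (hT : ∀ x, IsState (T x)) :
    HRSAXY σ = ∑ x, Q.pX x * entropy (marginal eRSAY (T x))
      - ∑ x, Q.pX x * entropy (marginal (Equiv.prodComm _ _) (T x)) := by
  rw [HRSAXY, condEntropy, marginal_marginal,
    h.entropy_marginal hT fRSAXY eRSAY regXY (by intros; rfl) (by intros; rfl),
    h.entropy_marginal hT (subEquiv fRSAXY (Equiv.prodComm _ _)) (Equiv.prodComm _ _)
      (Equiv.prodComm _ _) (by intros; rfl) (by intros; rfl)]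
  ring

/-- The state of `EYM` after the measurement, given `x`. -/
def postMeas (x : A) : Matrix (EIdx R S A H C × Y × M) (EIdx R S A H C × Y × M) ℂ :=
  conj (embed eSAYM (Q.Umeas x)) (Q.rho1 x ⊗ₖ (proj Q.y₀ ⊗ₖ Q.tauM))

theorem isState_preMeas [Nonempty H] [Nonempty C] [Nonempty M] (x : A) :
    IsState (Q.rho1 x ⊗ₖ (proj Q.y₀ ⊗ₖ Q.tauM)) :=
  (Q.isState_rho1 x).kronecker ((isState_proj _).kronecker Q.isState_tauM)

theorem isState_postMeas [Nonempty H] [Nonempty C] [Nonempty M] (x : A) :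
    IsState (Q.postMeas x) :=
  (Q.isState_preMeas x).conj (embed_mem_unitaryGroup _ (Q.Umeas_unitary x))

theorem isCQ_sigma1M : IsCQ (Equiv.prodComm A (EIdx R S A H C × Y × M)) Q.pX
    (fun x => Q.rho1 x ⊗ₖ (proj Q.y₀ ⊗ₖ Q.tauM)) Q.sigma1M := by
  refine isCQ_of_eq _ _ _ fun i j => ?_
  rw [sigma1M, Matrix.sum_apply]
  refine Finset.sum_congr rfl fun x _ => ?_
  rw [Matrix.smul_apply, kroneckerMap_apply, smul_eq_mul, mul_comm (proj x i.1 j.1)]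
  rfl

theorem isCQ_sigma2M : IsCQ (Equiv.prodComm A (EIdx R S A H C × Y × M)) Q.pX
    Q.postMeas Q.sigma2M := by
  refine isCQ_of_eq _ _ _ fun i j => ?_
  rw [sigma2M, Matrix.sum_apply]
  refine Finset.sum_congr rfl fun x _ => ?_
  rw [Matrix.smul_apply, kroneckerMap_apply, smul_eq_mul, mul_comm (proj x i.1 j.1)]
  rfl

theorem sigma2M_posSemidef [Nonempty H] [Nonempty C] [Nonempty M] : Q.sigma2M.PosSemidef :=
  Q.isCQ_sigma2M.posSemidef (fun x => (Q.pX_pos x).le) fun x => (Q.isState_postMeas x).pos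

theorem condMutualInfo_gYMX [Nonempty H] [Nonempty C] [Nonempty M] :
    condMutualInfo (marginal gYMX Q.sigma2M)
      = ∑ x, Q.pX x * entropy (marginal mY (Q.postMeas x))
        + ∑ x, Q.pX x * entropy (marginal mM (Q.postMeas x))
        - ∑ x, Q.pX x * entropy (marginal mYM (Q.postMeas x)) := by
  have h := Q.isCQ_sigma2M
  have hV := Q.isState_postMeas
  rw [condMutualInfo_eq (marginal_posSemidef _ Q.sigma2M_posSemidef), marginal_marginal,
    marginal_marginal, marginal_marginal,
    h.entropy_marginal hV (subEquiv gYMX factor₁₃) mY (Equiv.refl _) (by intros; rfl)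
      (by intros; rfl),
    h.entropy_marginal hV (subEquiv gYMX (Equiv.prodComm _ _)) mM (Equiv.refl _) (by intros; rfl)
      (by intros; rfl),
    h.entropy_marginal hV gYMX mYM (Equiv.prodAssoc _ _ _).symm (by intros; rfl)
      (by intros; rfl),
    h.entropy_marginal_register hV (subEquiv gYMX factor₃) (by intros; rfl) (by intros; rfl)]
  ring

/-- `Y` and `M` with register `X`. -/
def regMXY {k : Type*} : k × M × (A × Y) ≃ (k × Y × M) × A :=
  ⟨fun i => ((i.1, i.2.2.2, i.2.1), i.2.2.1), fun j => (j.1.1, j.1.2.2, j.2, j.1.2.1),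
   fun _ => rfl, fun _ => rfl⟩

/-- `YM` with register `X`. -/
def regM : M × (A × Y) ≃ (Y × M) × A :=
  ⟨fun i => ((i.2.2, i.1), i.2.1), fun j => (j.1.2, j.2, j.1.1), fun _ => rfl, fun _ => rfl⟩

theorem condMutualInfo_gRSAMXY [Nonempty H] [Nonempty C] [Nonempty M] :
    condMutualInfo (marginal gRSAMXY Q.sigma2M)
      = ∑ x, Q.pX x * entropy (marginal mRSAY (Q.postMeas x))
        + ∑ x, Q.pX x * entropy (marginal mYM (Q.postMeas x))
        - ∑ x, Q.pX x * entropy (marginal mRSAYM (Q.postMeas x))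
        - ∑ x, Q.pX x * entropy (marginal mY (Q.postMeas x)) := by
  have h := Q.isCQ_sigma2M
  have hV := Q.isState_postMeas
  rw [condMutualInfo_eq (marginal_posSemidef _ Q.sigma2M_posSemidef), marginal_marginal,
    marginal_marginal, marginal_marginal,
    h.entropy_marginal hV (subEquiv gRSAMXY factor₁₃) mRSAY regXY (by intros; rfl)
      (by intros; rfl),
    h.entropy_marginal hV (subEquiv gRSAMXY (Equiv.prodComm _ _)) mYM regM (by intros; rfl)
      (by intros; rfl),
    h.entropy_marginal hV gRSAMXY mRSAYM regMXY (by intros; rfl) (by intros; rfl),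
    h.entropy_marginal hV (subEquiv gRSAMXY factor₃) mY (Equiv.prodComm _ _) (by intros; rfl)
      (by intros; rfl)]
  ring

/-- `Umeas_realizes` is linear in the operator on SA, so it applies to each block of the state of E
with fixed spectator labels, whether or not that block is a state. -/
theorem marginal_mEY_postMeas (x : A) : marginal mEY (Q.postMeas x) = record (Q.rho2 x) := by
  rw [record_rho2, postMeas, conj_embed]
  ext i j
  rw [marginal_apply, applyLocal_apply, measMap, ← Q.Umeas_realizes, marginal_apply]
  refine Finset.sum_congr rfl fun m _ => ?_
  rw [applyLocal_apply]
  rfl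

theorem marginal_mY_postMeas (x : A) :
    marginal mY (Q.postMeas x) = marginal (Equiv.prodComm _ _) (record (Q.rho2 x)) := by
  rw [← marginal_mEY_postMeas, marginal_marginal_congr mEY (Equiv.prodComm _ _) mY
    (by intros; rfl) (by intros; rfl) (Q.postMeas x)]

theorem marginal_mRSAY_postMeas (x : A) :
    marginal mRSAY (Q.postMeas x) = marginal eRSAY (record (Q.rho2 x)) := by
  rw [← marginal_mEY_postMeas, marginal_marginal_congr mEY eRSAY mRSAY
    (by intros; rfl) (by intros; rfl) (Q.postMeas x)]

/-- The measurement unitary acts inside RSAYM, which enters as a product of RSA, a pure pointer and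
the thermal apparatus. -/
theorem entropy_mRSAYM_postMeas [Nonempty H] [Nonempty C] [Nonempty M] (x : A) :
    entropy (marginal mRSAYM (Q.postMeas x))
      = entropy (marginal eRSA (Q.rho1 x)) + entropy Q.tauM := by
  have h1 : marginal mRSAYM (Q.rho1 x ⊗ₖ (proj Q.y₀ ⊗ₖ Q.tauM))
      = marginal eRSA (Q.rho1 x) ⊗ₖ (proj Q.y₀ ⊗ₖ Q.tauM) := by
    ext i j
    simp only [marginal_apply, kroneckerMap_apply, Finset.sum_mul]
    rfl
  have hs := ((Q.isState_rho1 x).marginal eRSA).kronecker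
    ((isState_proj Q.y₀).kronecker Q.isState_tauM)
  rw [postMeas, conj_embed, marginal_applyLocal eSAYM mRSAYM rSAYM (fun r t => (r, t))
    (by intros; rfl), h1, ← conj_embed,
    entropy_conj (embed_mem_unitaryGroup _ (Q.Umeas_unitary x)) hs.pos.isHermitian,
    ((Q.isState_rho1 x).marginal eRSA).entropy_kronecker
      ((isState_proj Q.y₀).kronecker Q.isState_tauM),
    (isState_proj Q.y₀).entropy_kronecker Q.isState_tauM, entropy_proj, zero_add]

theorem isState_rho1_proj [Nonempty H] [Nonempty C] (x : A) :
    IsState (Q.rho1 x ⊗ₖ (proj Q.y₀ : Matrix Y Y ℂ)) :=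
  (Q.isState_rho1 x).kronecker (isState_proj _)

theorem HYX_sigma1 [Nonempty H] [Nonempty C] : HYX Q.sigma1 = 0 := by
  rw [sigma1, Q.HYX_eq (Q.isCQ_withX Q.rho1) Q.isState_rho1_proj]
  simp only [marginal_kronecker_right, (Q.isState_rho1 _).trace, one_smul, entropy_proj, mul_zero,
    Finset.sum_const_zero]

theorem HRSAXY_sigma1 [Nonempty H] [Nonempty C] :
    HRSAXY Q.sigma1 = ∑ x, Q.pX x * entropy (marginal eRSA (Q.rho1 x)) := by
  have h1 : ∀ x, marginal eRSAY (Q.rho1 x ⊗ₖ (proj Q.y₀ : Matrix Y Y ℂ))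
      = marginal eRSA (Q.rho1 x) ⊗ₖ (proj Q.y₀ : Matrix Y Y ℂ) := fun x => by
    ext i j
    simp only [marginal_apply, kroneckerMap_apply, Finset.sum_mul]
    rfl
  rw [sigma1, Q.HRSAXY_eq (Q.isCQ_withX Q.rho1) Q.isState_rho1_proj]
  simp only [marginal_kronecker_right, (Q.isState_rho1 _).trace, one_smul, entropy_proj, mul_zero,
    Finset.sum_const_zero, sub_zero, h1,
    ((Q.isState_rho1 _).marginal eRSA).entropy_kronecker (isState_proj Q.y₀), add_zero]

/-- The entropies of Y, YM and RSAY occur with opposite signs and cancel. Unitarity on RSAYM removes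
the rest, apart from the entropy decrease of M. -/
theorem QmeasY_add_QmeasRSA [Nonempty H] [Nonempty C] [Nonempty M] :
    Q.QmeasY + Q.QmeasRSA = Q.kB * Q.Tm *
      ∑ x, Q.pX x * (entropy Q.tauM - entropy (marginal mM (Q.postMeas x))) := by
  rw [QmeasY, QmeasRSA, HYX_sigma1, HRSAXY_sigma1, condMutualInfo_gYMX, condMutualInfo_gRSAMXY,
    sigma2, Q.HYX_eq (Q.isCQ_withXY Q.rho2) Q.isState_record_rho2,
    Q.HRSAXY_eq (Q.isCQ_withXY Q.rho2) Q.isState_record_rho2]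
  simp only [marginal_mY_postMeas, marginal_mRSAY_postMeas, entropy_mRSAYM_postMeas, mul_add,
    mul_sub, Finset.sum_add_distrib, Finset.sum_sub_distrib]
  ring

theorem Qmeas_eq [Nonempty H] [Nonempty C] [Nonempty M] :
    Q.Qmeas = ∑ x, Q.pX x *
      (expect Q.tauM Q.hamM - expect (marginal mM (Q.postMeas x)) Q.hamM) := by
  have h1 : marginal gM Q.sigma1M = Q.avg fun _ => Q.tauM := by
    rw [Q.isCQ_sigma1M.marginal_eq_sum gM mM (by intros; rfl) (by intros; rfl), avg]
    refine Finset.sum_congr rfl fun x _ => ?_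
    congr 1
    rw [← marginal_marginal_congr (Equiv.prodComm _ _) (Equiv.prodComm _ _) mM (by intros; rfl)
      (by intros; rfl) (Q.rho1 x ⊗ₖ (proj Q.y₀ ⊗ₖ Q.tauM)), marginal_kronecker_right,
      (Q.isState_rho1 x).trace, one_smul, marginal_kronecker_right, trace_proj, one_smul]
  have h2 : marginal gM Q.sigma2M = Q.avg fun x => marginal mM (Q.postMeas x) :=
    Q.isCQ_sigma2M.marginal_eq_sum gM mM (by intros; rfl) (by intros; rfl)
  rw [Qmeas, expect_embed, expect_embed, h1, h2, expect_avg, expect_avg,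
    ← Finset.sum_sub_distrib]
  exact Finset.sum_congr rfl fun x _ => by ring

/-- The apparatus starts thermal, so for each x the variational principle bounds its energy decrease
by k_BT_m times its entropy decrease. -/
theorem Qmeas_le [Nonempty H] [Nonempty C] [Nonempty M] : Q.Qmeas ≤ Q.QmeasY + Q.QmeasRSA := by
  have hk : 0 < Q.kB * Q.Tm := mul_pos Q.kB_pos Q.Tm_pos
  rw [QmeasY_add_QmeasRSA, Qmeas_eq, Finset.mul_sum]
  refine Finset.sum_le_sum fun x _ => ?_
  rw [mul_left_comm]
  refine mul_le_mul_of_nonneg_left ?_ (Q.pX_pos x).le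
  have hs := (Q.isState_postMeas x).marginal mM
  have h := entropy_sub_entropy_gibbs_le (1 / (Q.kB * Q.Tm)) Q.hamM_herm hs.pos hs.trace
  rw [one_div, inv_mul_eq_div, le_div_iff₀ hk, ← one_div] at h
  change (_ - entropy Q.tauM) * _ ≤ expect _ _ - expect Q.tauM _ at h
  linarith

/-! ### The first law -/

theorem rhoI_eq : Q.rhoI = Q.prodState Q.tauA := rfl

theorem marginal_eRS_avgF [Nonempty H] [Nonempty C] (hF : Q.fidelity = 1) :
    marginal eRS Q.avgF = Q.psiState := by
  refine (Q.isState_avgF.marginal eRS).eq_of_fidelity Q.psi_unit ?_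
  rw [← hF, fidelity, avgF, ← marginal_E_withXY,
    marginal_marginal_congr (Equiv.refl _) eRS fRS (by intros; rfl) (by intros; rfl)]
  rfl

/-- Averaged over x, the measured ancilla is again in its Gibbs state, which is also its state after
the reset. Unit fidelity restores RS and hence S. -/
theorem energySA_avg0 [Nonempty H] [Nonempty C] (hF : Q.fidelity = 1) :
    Q.energySA Q.avg0 = Q.energySA Q.avgF := by
  rw [energySA, energySA, Q.marginal_eS_of_eRS Q.marginal_eRS_avg0,
    Q.marginal_eS_of_eRS (Q.marginal_eRS_avgF hF), marginal_eA_avg0, marginal_eA_avgF]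

theorem Qh_eq [Nonempty H] [Nonempty C] :
    Q.Qh = expect Q.tauH Q.hamH - expect (marginal eH Q.avgF) Q.hamH := by
  rw [Qh, expect_fH, expect_fH, marginal_E_sigmaI, sigmaF, marginal_E_withXY, energyH, energyH,
    rhoI_eq, Q.marginal_eH_prodState Q.isState_tauA]
  rfl

theorem Qc_eq [Nonempty H] [Nonempty C] :
    Q.Qc = expect Q.tauC Q.hamC - expect (marginal eC Q.avgF) Q.hamC := by
  rw [Qc, expect_fC, expect_fC, marginal_E_sigmaI, sigmaF, marginal_E_withXY, energyC, energyC,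
    rhoI_eq, Q.marginal_eC_prodState Q.isState_tauA]
  rfl

theorem QeraseY_eq [Nonempty H] [Nonempty C] :
    Q.QeraseY = expect (proj Q.y₀) Q.hamY - expect (marginal fY Q.sigmaF) Q.hamY := by
  rw [QeraseY, expect_embed, expect_embed, marginal_fY_sigmaI]

/-- With unit fidelity the cycle restores the internal energy, so that the extracted work is the
total heat. -/
theorem neg_Wtot [Nonempty H] [Nonempty C] (hF : Q.fidelity = 1) :
    -Q.Wtot = Q.Qh + Q.Qc + Q.Qmeas + Q.QeraseY := by
  have hY : marginal fY Q.sigma3 = marginal fY Q.sigmaF := by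
    rw [sigma3, sigmaF, marginal_fY_withXY, marginal_fY_withXY]
    simp only [trace_rho3, trace_rhoF]
  -- The work omits two energy changes, from σ_enc to σ_1 and from σ_3 to σ_f; conservation in the
  -- two bath interactions identifies them with Q_h and Q_c. The energy of σ_2 cancels between
  -- measurement and decoding.
  have hhot := Q.energy_conserved_hot Q.avgEnc
  rw [← avg1_eq, energyH, energyH, ← marginal_eH_avgF, marginal_eH_avgEnc] at hhot
  have hcold := Q.energy_conserved_cold Q.avg3
  rw [← avgF_eq, energyC, energyC, marginal_eC_avg3] at hcold
  have hS : marginal eS Q.avgF = marginal eS Q.avg3 := by rw [avgF_eq, marginal_eS_AC]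
  have hSA := Q.energySA_avg0 hF
  have hF' : Q.energySA Q.avgF
      = expect (marginal eS Q.avg3) Q.hamS + expect (marginal eA Q.avgF) Q.hamA := by
    rw [energySA, hS]
  have h3 : Q.energySA Q.avg3
      = expect (marginal eS Q.avg3) Q.hamS + expect (marginal eA Q.avg3) Q.hamA := rfl
  have e0 : Q.energy Q.sigma0 = Q.energySA Q.avg0 + expect (proj Q.y₀) Q.hamY := by
    rw [energy_eq, sigma0, marginal_E_withX, Q.marginal_fY_withX _ Q.isState_rho0]; rfl
  have eEnc : Q.energy Q.sigmaEnc = Q.energySA Q.avgEnc + expect (proj Q.y₀) Q.hamY := by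
    rw [energy_eq, sigmaEnc, marginal_E_withX, Q.marginal_fY_withX _ Q.isState_rhoEnc]; rfl
  have e1 : Q.energy Q.sigma1 = Q.energySA Q.avg1 + expect (proj Q.y₀) Q.hamY := by
    rw [energy_eq, sigma1, marginal_E_withX, Q.marginal_fY_withX _ Q.isState_rho1]; rfl
  have e3 : Q.energy Q.sigma3 = Q.energySA Q.avg3 + expect (marginal fY Q.sigmaF) Q.hamY := by
    rw [energy_eq, hY, sigma3, marginal_E_withXY]; rfl
  rw [Wtot, Wenc, Wmeas, Wdec, e0, eEnc, e1, e3, Qh_eq, Qc_eq, QeraseY_eq]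
  linarith

/-- The pointer starts in a ground state, so Y can only have gained energy. This fixes the sign
inside the absolute value of Landauer's condition. -/
theorem QeraseY_nonpos [Nonempty H] [Nonempty C] : Q.QeraseY ≤ 0 := by
  obtain ⟨ε, h1, h2⟩ := Q.y₀_ground
  have h3 : expect (proj Q.y₀) Q.hamY = ε := by
    have h4 := congrFun h1 Q.y₀
    rw [mulVec_single_one] at h4
    simp only [col_apply, Pi.smul_apply, Pi.single_eq_same, smul_eq_mul, mul_one] at h4
    rw [expect, trace_mul_comm, trace_mul_proj, h4, Complex.ofReal_re]
  have hs : IsState (marginal fY Q.sigmaF) := by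
    have hp := (Q.isCQ_withXY Q.rhoF).posSemidef (fun x => (Q.pX_pos x).le)
      fun x => (Q.isState_record_rhoF x).pos
    refine ⟨marginal_posSemidef _ hp, ?_⟩
    rw [trace_marginal, ← trace_marginal (Equiv.refl _), sigmaF, marginal_E_withXY]
    exact Q.isState_avgF.trace
  have h5 := trace_mul_re_nonneg hs.pos h2
  rw [mul_sub, trace_sub, Complex.sub_re, mul_smul_comm, mul_one, trace_smul, hs.trace,
    smul_eq_mul, mul_one, Complex.ofReal_re] at h5
  rw [QeraseY_eq, h3, expect]
  linarith

/-! ### Entropy balance -/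

/-- The bath starts thermal, so by the variational principle the heat it gives up is at most k_BT_h
times its entropy decrease. -/
theorem Qh_div_le [Nonempty H] [Nonempty C] :
    Q.Qh / (Q.kB * Q.Th) ≤ entropy Q.tauH - entropy (marginal eH Q.avgF) := by
  have hs := Q.isState_avgF.marginal eH
  have h := entropy_sub_entropy_gibbs_le (1 / (Q.kB * Q.Th)) Q.hamH_herm hs.pos hs.trace
  change _ - entropy Q.tauH ≤ _ * (_ - expect Q.tauH _) at h
  have h2 : Q.Qh / (Q.kB * Q.Th) = -(1 / (Q.kB * Q.Th)
    * (expect (marginal eH Q.avgF) Q.hamH - expect Q.tauH Q.hamH)) := by rw [Qh_eq]; ring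
  linarith

theorem Qc_div_le [Nonempty H] [Nonempty C] :
    Q.Qc / (Q.kB * Q.Tc) ≤ entropy Q.tauC - entropy (marginal eC Q.avgF) := by
  have hs := Q.isState_avgF.marginal eC
  have h := entropy_sub_entropy_gibbs_le (1 / (Q.kB * Q.Tc)) Q.hamC_herm hs.pos hs.trace
  change _ - entropy Q.tauC ≤ _ * (_ - expect Q.tauC _) at h
  have h2 : Q.Qc / (Q.kB * Q.Tc) = -(1 / (Q.kB * Q.Tc)
    * (expect (marginal eC Q.avgF) Q.hamC - expect Q.tauC Q.hamC)) := by rw [Qc_eq]; ring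
  linarith

/-- `AB_hB_c` inside `E`. -/
def eAHC : EIdx R S A H C ≃ (A × H × C) × (R × S) := eRS.trans (Equiv.prodComm _ _)

/-- Subadditivity over RS, A and the two baths: unit fidelity makes RS pure, so it contributes
nothing, and the reset A contributes the Shannon entropy of p. -/
theorem entropy_avgF_le [Nonempty H] [Nonempty C] (hF : Q.fidelity = 1) :
    entropy Q.avgF ≤ ∑ x, Real.negMulLog (Q.pX x) + entropy (marginal eH Q.avgF)
      + entropy (marginal eC Q.avgF) := by
  have hs := Q.isState_avgF
  have h1 := entropy_le_add eRS eAHC (by intros; rfl) (by intros; rfl) hs.pos hs.trace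
  rw [Q.marginal_eRS_avgF hF, entropy_psiState] at h1
  have hs2 := hs.marginal eAHC
  have h2 := entropy_le_add_prod hs2.pos hs2.trace
  have hs3 := hs2.marginal (Equiv.prodComm A (H × C))
  have h3 := entropy_le_add_prod hs3.pos hs3.trace
  rw [marginal_marginal_congr eAHC (Equiv.refl _) eA (by intros; rfl) (by intros; rfl) Q.avgF,
    marginal_eA_avgF, entropy_tauA] at h2
  rw [marginal_marginal_marginal_congr eAHC (Equiv.prodComm _ _) (Equiv.refl _) eH
      (by intros; rfl) (by intros; rfl) Q.avgF,
    marginal_marginal_marginal_congr eAHC (Equiv.prodComm _ _) (Equiv.prodComm _ _) eC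
      (by intros; rfl) (by intros; rfl) Q.avgF] at h3
  linarith

theorem sigmaF_posSemidef [Nonempty H] [Nonempty C] : Q.sigmaF.PosSemidef :=
  (Q.isCQ_withXY Q.rhoF).posSemidef (fun x => (Q.pX_pos x).le)
    fun x => (Q.isState_record_rhoF x).pos

theorem entropy_sigmaF [Nonempty H] [Nonempty C] :
    entropy Q.sigmaF = ∑ x, Real.negMulLog (Q.pX x)
      + ∑ x, Q.pX x * entropy (record (Q.rho2 x)) := by
  rw [sigmaF, (Q.isCQ_withXY Q.rhoF).entropy_eq Q.isState_record_rhoF]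
  simp only [entropy_record_rhoF]

theorem HYEX_eq [Nonempty H] [Nonempty C] :
    Q.HYEX = entropy Q.sigmaF - entropy (marginal fXE Q.sigmaF) := by
  rw [HYEX, condEntropy, entropy_submatrix _ Q.sigmaF_posSemidef.isHermitian, marginal_submatrix,
    entropy_marginal_congr (fYEX.symm.trans (Equiv.prodComm _ _)) fXE (Equiv.prodComm _ _)
      (by intros; rfl) (by intros; rfl) Q.sigmaF_posSemidef]

theorem HXE_add_HYEX [Nonempty H] [Nonempty C] :
    Q.HXE + Q.HYEX = entropy Q.sigmaF - entropy Q.avgF := by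
  rw [HYEX_eq, HXE, condEntropy, marginal_marginal_congr fXE (Equiv.prodComm _ _) (Equiv.refl _)
    (by intros; rfl) (by intros; rfl) Q.sigmaF]
  have : marginal (Equiv.refl _) Q.sigmaF = Q.avgF := Q.marginal_E_withXY Q.rhoF
  rw [this]; ring

/-- Conditioning on `E` does not increase the entropy of `Y` given `X`. -/
theorem HYEX_le [Nonempty H] [Nonempty C] : Q.HYEX ≤ HYX Q.sigma2 := by
  have h := Q.isCQ_withXY Q.rhoF
  have hT := Q.isState_record_rhoF
  -- Feedback and reset preserve the trace of each branch, so the distribution of Y given x is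
  -- settled by the measurement.
  have hY : ∀ x, marginal (Equiv.prodComm _ _) (record (Q.rho2 x))
      = marginal (Equiv.prodComm _ _) (record (Q.rhoF x)) := fun x => by
    rw [marginal_record_right, marginal_record_right]
    simp only [trace_rhoF]
  rw [HYEX_eq, sigmaF, h.entropy_eq hT, h.entropy_marginal hT fXE (Equiv.refl _)
    (Equiv.prodComm _ _) (by intros; rfl) (by intros; rfl), sigma2,
    Q.HYX_eq (Q.isCQ_withXY Q.rho2) Q.isState_record_rho2]
  simp only [hY]
  rw [add_sub_add_left_eq_sub, ← Finset.sum_sub_distrib]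
  refine Finset.sum_le_sum fun x _ => ?_
  rw [← mul_sub]
  refine mul_le_mul_of_nonneg_left ?_ (Q.pX_pos x).le
  have := entropy_le_add_prod (hT x).pos (hT x).trace
  linarith

/-- The entropy balance of the cycle. -/
theorem heat_add_efficacy_le [Nonempty H] [Nonempty C] (hF : Q.fidelity = 1) :
    Q.Qh / (Q.kB * Q.Th) + Q.Qc / (Q.kB * Q.Tc) + ∑ x, Q.pX x * (-Real.log (Q.efficacyX x))
      ≤ Q.HXE + Q.HYEX := by
  have h1 : ∑ x, Q.pX x * (-Real.log (Q.efficacyX x))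
      ≤ ∑ x, Q.pX x * entropy (record (Q.rho2 x)) - (entropy Q.tauH + entropy Q.tauC) := by
    have : entropy Q.tauH + entropy Q.tauC
        = ∑ x, Q.pX x * (entropy Q.tauH + entropy Q.tauC) := by
      rw [← Finset.sum_mul, sum_pX, one_mul]
    rw [this, ← Finset.sum_sub_distrib]
    refine Finset.sum_le_sum fun x _ => ?_
    rw [← mul_sub]
    exact mul_le_mul_of_nonneg_left (Q.neg_log_efficacyX_le x) (Q.pX_pos x).le
  have h2 := Q.HXE_add_HYEX
  have h3 := Q.entropy_sigmaF
  have h4 := Q.entropy_avgF_le hF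
  have h5 := Q.Qh_div_le
  have h6 := Q.Qc_div_le
  linarith

/-! ### Nondegeneracy and the trade-off relation -/

theorem nonempty_of_fidelity (hF : Q.fidelity = 1) : Nonempty H ∧ Nonempty C := by
  have key : ¬ IsEmpty (A × H × C × A × Y) := fun h => by
    have : marginal fRS Q.sigmaF = 0 := by
      ext i j; rw [marginal_apply, Finset.univ_eq_empty, Finset.sum_empty]; rfl
    rw [fidelity, this] at hF
    simp at hF
  rw [not_isEmpty_iff] at key
  obtain ⟨_, h, c, _⟩ := key
  exact ⟨⟨h⟩, ⟨c⟩⟩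

/-- With M empty the partial trace over it would be zero, while the instrument it realizes preserves
the trace. -/
theorem nonempty_M (Q : Engine R S A H C M Y) : Nonempty M := by
  by_contra h
  rw [not_nonempty_iff] at h
  have hne : Nonempty S := by
    by_contra hS
    rw [not_nonempty_iff] at hS
    have := Q.psi_unit
    simp [dotProduct] at this
  obtain ⟨s⟩ := hne
  have h1 := Q.Umeas_realizes Q.x₀ (proj (s, Q.x₀))
  have h2 := recordMap_isTracePreserving (Q.inst_isInstrument Q.x₀) (proj (s, Q.x₀))
  rw [← h1, trace_marginal, trace_proj] at h2
  simp [Matrix.trace] at h2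

/-- The excess of the efficiency over the Carnot efficiency in units of entropy. -/
theorem input_mul_eq (hin : 0 < Q.Qinput) :
    Q.Qinput / (Q.kB * Q.Th) * ((Q.eta - Q.etaC) / (1 - Q.etaC))
      = (-Q.Wtot - Q.Qinput) / (Q.kB * Q.Tc) + Q.Qinput / (Q.kB * Q.Th) := by
  have hk := Q.kB_pos.ne'
  have hh := Q.Th_pos.ne'
  have hc := Q.Tc_pos.ne'
  have hi := hin.ne'
  rw [eta, etaC]
  have : 1 - (1 - Q.Tc / Q.Th) = Q.Tc / Q.Th := by ring
  rw [this]
  field_simp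
  ring

theorem tradeoff {δ₁ δ₂ δ₃ : ℝ} (hreg : Q.Regime δ₁ δ₂ δ₃) (hF : Q.fidelity = 1) :
    Q.Qinput / (Q.kB * Q.Th) * ((Q.eta - Q.etaC) / (1 - Q.etaC))
        + ∑ x, Q.pX x * (-Real.log (Q.efficacyX x))
      ≤ δ₂ * Q.HYEX + δ₃ * HYX Q.sigma2 := by
  obtain ⟨hH, hC⟩ := Q.nonempty_of_fidelity hF
  have hM := Q.nonempty_M
  have hkc : 0 < Q.kB * Q.Tc := mul_pos Q.kB_pos Q.Tc_pos
  have hkh : 0 < Q.kB * Q.Th := mul_pos Q.kB_pos Q.Th_pos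
  have h1 := Q.heat_add_efficacy_le hF
  have h2 := Q.HYEX_le
  have h3 := Q.Qmeas_le
  have h4 := Q.neg_Wtot hF
  have h5 := Q.QeraseY_nonpos
  have h6 := hreg.memory_small
  have h7 := (abs_le.1 hreg.landauer).1
  rw [abs_of_nonpos h5] at h7
  have h8 := hreg.dissipation
  rw [abs_of_nonpos hreg.meas_nonpos] at h8
  -- The lower half of Landauer's condition: erasure releases at least (1 - δ₃) k_BT_c H(Y|X).
  have h9 : Q.QeraseY / (Q.kB * Q.Tc) ≤ -HYX Q.sigma2 + δ₃ * HYX Q.sigma2 := by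
    rw [div_le_iff₀ hkc]; linarith
  have h10 : Q.QmeasRSA / (Q.kB * Q.Tc) ≤ -(Q.QmeasY / (Q.kB * Q.Th)) := by
    rw [div_le_iff₀ hkc]
    have : -(Q.QmeasY / (Q.kB * Q.Th)) * (Q.kB * Q.Tc) = -(Q.Tc / Q.Th * Q.QmeasY) := by
      have := Q.kB_pos.ne'
      have := Q.Th_pos.ne'
      field_simp
    rw [this]; linarith
  -- By the first law the numerator is Q_c + Q_meas + Q_erase^Y - Q_meas^Y, and `Qmeas_le` replaces
  -- Q_meas - Q_meas^Y by Q_meas^{RSA|Y}.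
  have h11 : (-Q.Wtot - Q.Qinput) / (Q.kB * Q.Tc)
      ≤ Q.Qc / (Q.kB * Q.Tc) + Q.QmeasRSA / (Q.kB * Q.Tc) + Q.QeraseY / (Q.kB * Q.Tc) := by
    rw [← add_div, ← add_div]
    refine div_le_div_of_nonneg_right ?_ hkc.le
    rw [Qinput]; linarith
  rw [Q.input_mul_eq hreg.input_pos]
  have h12 : Q.Qinput / (Q.kB * Q.Th) = Q.Qh / (Q.kB * Q.Th) + Q.QmeasY / (Q.kB * Q.Th) := by
    rw [Qinput, add_div]
  linarith

/-- Efficacies at most 1 make the logarithmic sum nonnegative, which leaves no room for a positive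
Carnot excess. -/
theorem eta_le_etaC (hin : 0 < Q.Qinput)
    (h : Q.Qinput / (Q.kB * Q.Th) * ((Q.eta - Q.etaC) / (1 - Q.etaC))
        + ∑ x, Q.pX x * (-Real.log (Q.efficacyX x)) ≤ 0)
    (he : ∀ x, Q.efficacyX x ≤ 1) (h0 : ∀ x, 0 ≤ Q.efficacyX x) : Q.eta ≤ Q.etaC := by
  have h1 : 0 ≤ ∑ x, Q.pX x * (-Real.log (Q.efficacyX x)) :=
    Finset.sum_nonneg fun x _ => mul_nonneg (Q.pX_pos x).le
      (neg_nonneg.2 (Real.log_nonpos (h0 x) (he x)))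
  by_contra hlt
  rw [not_le] at hlt
  have h2 : 0 < 1 - Q.etaC := by
    rw [etaC, sub_sub_cancel]; exact div_pos Q.Tc_pos Q.Th_pos
  have h3 : 0 < Q.Qinput / (Q.kB * Q.Th) * ((Q.eta - Q.etaC) / (1 - Q.etaC)) :=
    mul_pos (div_pos hin (mul_pos Q.kB_pos Q.Th_pos)) (div_pos (sub_pos.2 hlt) h2)
  linarith

theorem efficacyX_nonneg [Nonempty H] [Nonempty C] (x : A) : 0 ≤ Q.efficacyX x := by
  rw [efficacyX, efficacy_eq]
  exact trace_mul_re_nonneg (Q.applyLocal_measMap_posSemidef x (Q.isState_rho1 x).pos)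
    (Q.applyLocal_measMap_posSemidef x PosSemidef.one)

end Engine

end

end QEC

theorem mainTheorem8 {R S A H C M Y : Type*}
    [Fintype R] [DecidableEq R] [Fintype S] [DecidableEq S] [Fintype A] [DecidableEq A]
    [Fintype H] [DecidableEq H] [Fintype C] [DecidableEq C] [Fintype M] [DecidableEq M]
    [Fintype Y] [DecidableEq Y]
    (Q : QEC.Engine R S A H C M Y) (δ₁ δ₂ δ₃ : ℝ)
    (hreg : Q.Regime δ₁ δ₂ δ₃) (hF : Q.fidelity = 1) :
    -- the trade-off relation, up to the tolerances
    (Q.Qinput / (Q.kB * Q.Th) * ((Q.eta - Q.etaC) / (1 - Q.etaC))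
        + ∑ x, Q.pX x * (-Real.log (Q.efficacyX x))
      ≤ δ₂ * Q.HYEX + δ₃ * QEC.Engine.HYX Q.sigma2) ∧
    -- the idealized regime
    (δ₂ = 0 → δ₃ = 0 →
      (Q.Qinput / (Q.kB * Q.Th) * ((Q.eta - Q.etaC) / (1 - Q.etaC))
          + ∑ x, Q.pX x * (-Real.log (Q.efficacyX x)) ≤ 0) ∧
      ((∀ x, QEC.IsSubunital (Q.measMap x)) → Q.eta ≤ Q.etaC) ∧
      ((∀ x, QEC.IsEfficient (Q.inst x)) →
        (∀ x, QEC.IsSubunital (Q.measMap x)) ∧ Q.eta ≤ Q.etaC) ∧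
      (Q.etaC < Q.eta →
        ∃ x, 1 < Q.efficacyX x ∧ ¬ QEC.IsSubunital (Q.measMap x))) := by
  obtain ⟨hH, hC⟩ := Q.nonempty_of_fidelity hF
  have hmain := Q.tradeoff hreg hF
  refine ⟨hmain, fun h2 h3 => ?_⟩
  have h0 : Q.Qinput / (Q.kB * Q.Th) * ((Q.eta - Q.etaC) / (1 - Q.etaC))
      + ∑ x, Q.pX x * (-Real.log (Q.efficacyX x)) ≤ 0 := by
    rw [h2, h3, zero_mul, zero_mul, add_zero] at hmain
    exact hmain
  have hle : (∀ x, Q.efficacyX x ≤ 1) → Q.eta ≤ Q.etaC := fun he =>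
    Q.eta_le_etaC hreg.input_pos h0 he Q.efficacyX_nonneg
  have hsub : (∀ x, QEC.IsSubunital (Q.measMap x)) → Q.eta ≤ Q.etaC := fun h =>
    hle fun x => Q.efficacyX_le_one x (h x)
  refine ⟨h0, hsub, fun he => ?_, fun hlt => ?_⟩
  · have hs : ∀ x, QEC.IsSubunital (Q.measMap x) := fun x =>
      QEC.isSubunital_recordMap_of_isEfficient (Q.inst_isInstrument x) (he x)
    exact ⟨hs, hsub hs⟩
  · by_contra hno
    -- One x serves both claims: an efficacy above 1 already rules out subunitality of the same map.
    refine absurd (hle fun x => ?_) (not_le.2 hlt)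
    by_contra hx
    exact hno ⟨x, not_le.1 hx, fun hs => hx (Q.efficacyX_le_one x hs)⟩
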